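/- **Theorem.** Let $n\ge 1$, and let $S$ be a set of $n$ segments of non-zero length in $\mathbb{R}^2$. A *stabbing rectangle* for $S$ is a closed axis-parallel rectangle that contains exactly one endpoint of each segment of $S$; two stabbing rectangles are *combinatorially different* if the sets of endpoints of segments of $S$ that they contain are different. A list of rectangles *reports all combinatorially different stabbing rectangles* if each of its entries is a stabbing rectangle, given by four endpoints of segments of $S$ that lie in it, one on each of its four sides (the four endpoints need not be distinct, and a rectangle may degenerate to a segment or a point), no two entries are combinatorially equivalent, and every stabbing rectangle for $S$ is combinatorially equivalent to an entry. 1. There is an algorithm that, given $n$ segments, reports all combinatorially different stabbing rectangles in $O(n^2\log n)$ time. Here the model of computation is a random access machine with unit-cost operations, with words of $O(\log n)$ bits, in which the only operations on the real input coordinates are comparisons of the $x$-coordinates, or of the $y$-coordinates, of two input points. 2. The number of combinatorially different stabbing rectangles for $n$ segments is $O(n^2)$. 3. This bound is attained: there is a constant $c>0$ such that for every $n\ge 1$ there is a set of $n$ segments, none of them horizontal or vertical, with at least $c\,n^2$ combinatorially different stabbing rectangles. -/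

import Mathlib

namespace Stab

/-! ### Segments and stabbing rectangles -/

/-- A point of the plane, given by its two coordinates. -/
abbrev Point := ℝ × ℝ

/-- A segment, given by its two endpoints. -/
abbrev Segment := Point × Point

/-- The `2n` endpoints of `n` segments, numbered `0, …, 2n - 1`: number `i < n` is the first
endpoint of segment `i` and number `n + i` is its second endpoint. -/
def endpoint {n : ℕ} (S : Fin n → Segment) : Fin (n + n) → Point :=
  Fin.append (fun i => (S i).1) (fun i => (S i).2)

/-- The closed region `[a, b] × [c, d]`. -/
def box (a b c d : ℝ) : Set Point := Set.Icc a b ×ˢ Set.Icc c d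

/-- Closed axis-parallel rectangles (sides of length zero are allowed). -/
def IsRectangle (R : Set Point) : Prop :=
  ∃ a b c d : ℝ, a ≤ b ∧ c ≤ d ∧ R = box a b c d

/-- The region `R` contains exactly one endpoint of each segment. -/
def Stabs {n : ℕ} (R : Set Point) (S : Fin n → Segment) : Prop :=
  ∀ i, Xor ((S i).1 ∈ R) ((S i).2 ∈ R)

/-- `R` is a stabbing rectangle for `S`. -/
def IsStabbingRectangle {n : ℕ} (S : Fin n → Segment) (R : Set Point) : Prop :=
  IsRectangle R ∧ Stabs R S

/-- The set of segment endpoints contained in `R`. -/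
def redPoints {n : ℕ} (S : Fin n → Segment) (R : Set Point) : Set Point :=
  Set.range (endpoint S) ∩ R

/-- Two regions are combinatorially equivalent if they contain the same segment endpoints. -/
def CombEquiv {n : ℕ} (S : Fin n → Segment) (R R' : Set Point) : Prop :=
  redPoints S R = redPoints S R'

/-- The combinatorially different stabbing rectangles: one element for each combinatorial
equivalence class, namely the set of endpoints that its members contain. -/
def stabberClasses {n : ℕ} (S : Fin n → Segment) : Set (Set Point) :=
  {A | ∃ R, IsStabbingRectangle S R ∧ redPoints S R = A}

/-! ### A random access machine

The machine has registers and arrays holding natural numbers, all initially zero except for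
register `0`, which holds the number `n` of segments. The coordinates of the input points can be
used in one way only: the `x`-coordinates, or the `y`-coordinates, of two input points with given
numbers can be compared. Programs are finite, and independent of `n`. Every operation takes one
time unit, and every number that occurs in a computation has to fit into a machine word, that is,
it has to be at most the word bound `B`. -/

/-- Memory and output. Registers and arrays are named by natural numbers; a reported rectangle
is a quadruple of numbers of input points (left, right, bottom, top). -/
structure State where
  reg : ℕ → ℕ
  arr : ℕ → ℕ → ℕ
  out : List (ℕ × ℕ × ℕ × ℕ)

/-- The initial state on an input of `n` segments. -/
def State.init (n : ℕ) : State where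
  reg := fun x => if x = 0 then n else 0
  arr := fun _ _ => 0
  out := []

/-- Write the value `v` into register `x`. -/
def State.setReg (s : State) (x v : ℕ) : State :=
  { s with reg := Function.update s.reg x v }

/-- Write the value `v` into cell `i` of array `a`. -/
def State.setArr (s : State) (a i v : ℕ) : State :=
  { s with arr := Function.update s.arr a (Function.update (s.arr a) i v) }

/-- Append a quadruple to the output. -/
def State.report (s : State) (l r b t : ℕ) : State :=
  { s with out := s.out ++ [(l, r, b, t)] }

/-- Arithmetic expressions: constants, registers, array cells, and the operations of word
arithmetic (truncated subtraction, and division rounded down). -/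
inductive Expr where
  | const (k : ℕ)
  | reg (x : ℕ)
  | cell (a : ℕ) (i : Expr)
  | add (e f : Expr)
  | sub (e f : Expr)
  | mul (e f : Expr)
  | div (e f : Expr)

namespace Expr

/-- The value of an expression. -/
def eval (s : State) : Expr → ℕ
  | const k => k
  | reg x => s.reg x
  | cell a i => s.arr a (i.eval s)
  | add e f => e.eval s + f.eval s
  | sub e f => e.eval s - f.eval s
  | mul e f => e.eval s * f.eval s
  | div e f => e.eval s / f.eval s

/-- The time needed to evaluate an expression: one unit for each operation. -/
def cost : Expr → ℕ
  | const _ => 1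
  | reg _ => 1
  | cell _ i => i.cost + 1
  | add e f => e.cost + f.cost + 1
  | sub e f => e.cost + f.cost + 1
  | mul e f => e.cost + f.cost + 1
  | div e f => e.cost + f.cost + 1

/-- All values that occur during the evaluation, addresses included, are at most `B`. -/
def Fits (B : ℕ) (s : State) : Expr → Prop
  | const k => k ≤ B
  | reg x => s.reg x ≤ B
  | cell a i => i.Fits B s ∧ s.arr a (i.eval s) ≤ B
  | add e f => e.Fits B s ∧ f.Fits B s ∧ e.eval s + f.eval s ≤ B
  | sub e f => e.Fits B s ∧ f.Fits B s
  | mul e f => e.Fits B s ∧ f.Fits B s ∧ e.eval s * f.eval s ≤ B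
  | div e f => e.Fits B s ∧ f.Fits B s

end Expr

/-- Tests. The test `xlt e f` compares the `x`-coordinates of the input points with the numbers
`e` and `f`, and `ylt e f` their `y`-coordinates. -/
inductive Test where
  | eq (e f : Expr)
  | lt (e f : Expr)
  | xlt (e f : Expr)
  | ylt (e f : Expr)
  | not (p : Test)
  | and (p q : Test)
  | or (p q : Test)

namespace Test

/-- The truth value of a test; a comparison of coordinates is false if one of the two numbers is
not the number of an input point. -/
def Holds {m : ℕ} (P : Fin m → Point) (s : State) : Test → Prop
  | eq e f => e.eval s = f.eval s
  | lt e f => e.eval s < f.eval s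
  | xlt e f => ∃ i j : Fin m, (i : ℕ) = e.eval s ∧ (j : ℕ) = f.eval s ∧ (P i).1 < (P j).1
  | ylt e f => ∃ i j : Fin m, (i : ℕ) = e.eval s ∧ (j : ℕ) = f.eval s ∧ (P i).2 < (P j).2
  | not p => ¬ p.Holds P s
  | and p q => p.Holds P s ∧ q.Holds P s
  | or p q => p.Holds P s ∨ q.Holds P s

/-- The time needed to evaluate a test. -/
def cost : Test → ℕ
  | eq e f => e.cost + f.cost + 1
  | lt e f => e.cost + f.cost + 1
  | xlt e f => e.cost + f.cost + 1
  | ylt e f => e.cost + f.cost + 1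
  | not p => p.cost + 1
  | and p q => p.cost + q.cost + 1
  | or p q => p.cost + q.cost + 1

/-- All values that occur during the evaluation of a test are at most `B`. -/
def Fits (B : ℕ) (s : State) : Test → Prop
  | eq e f => e.Fits B s ∧ f.Fits B s
  | lt e f => e.Fits B s ∧ f.Fits B s
  | xlt e f => e.Fits B s ∧ f.Fits B s
  | ylt e f => e.Fits B s ∧ f.Fits B s
  | not p => p.Fits B s
  | and p q => p.Fits B s ∧ q.Fits B s
  | or p q => p.Fits B s ∧ q.Fits B s

end Test

/-- Programs. -/
inductive Program where
  | skip
  | assign (x : ℕ) (e : Expr)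
  | store (a : ℕ) (i e : Expr)
  | report (l r b t : Expr)
  | seq (c d : Program)
  | cond (p : Test) (c d : Program)
  | loop (p : Test) (c : Program)

/-- `Exec P B c s s' t`: with the input points `P` and the word bound `B`, the program `c` started
in the state `s` halts in the state `s'` after exactly `t` time units, and all numbers that occur
fit into a word. (`loop p c` repeats `c` as long as `p` holds.) -/
inductive Exec {m : ℕ} (P : Fin m → Point) (B : ℕ) : Program → State → State → ℕ → Prop
  | skip (s : State) : Exec P B Program.skip s s 1
  | assign (s : State) (x : ℕ) (e : Expr) (he : e.Fits B s) :
      Exec P B (Program.assign x e) s (s.setReg x (e.eval s)) (e.cost + 1)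
  | store (s : State) (a : ℕ) (i e : Expr) (hi : i.Fits B s) (he : e.Fits B s) :
      Exec P B (Program.store a i e) s (s.setArr a (i.eval s) (e.eval s)) (i.cost + e.cost + 1)
  | report (s : State) (l r b t : Expr) (hl : l.Fits B s) (hr : r.Fits B s) (hb : b.Fits B s)
      (ht : t.Fits B s) :
      Exec P B (Program.report l r b t) s
        (s.report (l.eval s) (r.eval s) (b.eval s) (t.eval s))
        (l.cost + r.cost + b.cost + t.cost + 1)
  | seq (c d : Program) (s s₁ s₂ : State) (t₁ t₂ : ℕ) (hc : Exec P B c s s₁ t₁)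
      (hd : Exec P B d s₁ s₂ t₂) : Exec P B (Program.seq c d) s s₂ (t₁ + t₂)
  | cond_true (p : Test) (c d : Program) (s s₁ : State) (t : ℕ) (hf : p.Fits B s)
      (hp : p.Holds P s) (hc : Exec P B c s s₁ t) :
      Exec P B (Program.cond p c d) s s₁ (p.cost + t)
  | cond_false (p : Test) (c d : Program) (s s₁ : State) (t : ℕ) (hf : p.Fits B s)
      (hp : ¬ p.Holds P s) (hd : Exec P B d s s₁ t) :
      Exec P B (Program.cond p c d) s s₁ (p.cost + t)
  | loop_false (p : Test) (c : Program) (s : State) (hf : p.Fits B s) (hp : ¬ p.Holds P s) :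
      Exec P B (Program.loop p c) s s p.cost
  | loop_true (p : Test) (c : Program) (s s₁ s₂ : State) (t₁ t₂ : ℕ) (hf : p.Fits B s)
      (hp : p.Holds P s) (hc : Exec P B c s s₁ t₁) (hl : Exec P B (Program.loop p c) s₁ s₂ t₂) :
      Exec P B (Program.loop p c) s s₂ (p.cost + t₁ + t₂)

/-! ### Correct output -/

/-- The quadruple `q = (l, r, b, t)` of endpoint numbers represents the rectangle `R`: it is the
rectangle whose left, right, bottom and top side is determined by the endpoint number `l`, `r`,
`b` and `t`, respectively, and it contains these four endpoints (so they lie on its sides). -/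
def Represents {n : ℕ} (S : Fin n → Segment) (q : ℕ × ℕ × ℕ × ℕ) (R : Set Point) : Prop :=
  ∃ l r b t : Fin (n + n), q = ((l : ℕ), (r : ℕ), (b : ℕ), (t : ℕ)) ∧
    R = box (endpoint S l).1 (endpoint S r).1 (endpoint S b).2 (endpoint S t).2 ∧
    endpoint S l ∈ R ∧ endpoint S r ∈ R ∧ endpoint S b ∈ R ∧ endpoint S t ∈ R

/-- The list `L` reports all combinatorially different stabbing rectangles for `S`: every entry
represents a stabbing rectangle, different entries represent combinatorially different ones, and
every stabbing rectangle is combinatorially equivalent to one that is represented. -/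
def ReportsAll {n : ℕ} (S : Fin n → Segment) (L : List (ℕ × ℕ × ℕ × ℕ)) : Prop :=
  (∀ q ∈ L, ∃ R, Represents S q R ∧ IsStabbingRectangle S R) ∧
  L.Pairwise (fun q q' => ∀ R R', Represents S q R → Represents S q' R' → ¬ CombEquiv S R R') ∧
  ∀ R, IsStabbingRectangle S R → ∃ q ∈ L, ∃ R', Represents S q R' ∧ CombEquiv S R R'

end Stab

/-! A stabbing rectangle contains an endpoint exactly when it misses the other endpoint of the same
segment, its partner. Hence two stabbing rectangles whose sets of endpoints are nested are
equivalent (`Stabs.combEquiv_of_subset`). A stabbing rectangle can be shrunk to the bounding box of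
its endpoints, so a class is described by a quadruple (left, right, bottom, top) of endpoints.

Upper bound (`card_le_of_spans`). Choose one quadruple for each class. Those whose bottom is highest
for their left and right endpoints are determined by these two, since equal bottoms make the
rectangles nested. Among the others, fix left and bottom. A leftmost right side leaves one
quadruple. If two quadruples have right sides r < r' and the second can be raised, then the partner
of the bottom endpoint has its abscissa in (r, r'] (`partner_between`). These intervals are disjoint
for three successive right sides, so at most one further quadruple exists. Each of the three kinds
is counted by the 4n² pairs of endpoints.

Lower bound. Half of the segments can be cut only by the left or right side of a large square, the
other half only by its bottom or top. Horizontal and vertical shifts of the square are then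
independent, with about n/2 choices each.

Algorithm. Coordinates are replaced by ranks. A box of rank space stabs if and only if it is free,
that is, contains no segment entirely, and contains n endpoints (`Free.stabBox`); prefix sums count
endpoints in constant time. Fix the left side A and let the right side b grow. If the
inclusion-minimal y-intervals of the segments between A and b are (lo₁, hi₁), (lo₂, hi₂), … in
increasing order, then the maximal free y-windows are (loᵢ, hiᵢ₊₁), with the conventions 0 and 2n +
1 at the ends. They are kept as a linked list (`Chain`). Inserting a segment removes a run of
consecutive windows and creates two new ones (`Chain.insert_segment`), so O(n) windows occur for
each A.

A window is examined just before it disappears, and those that remain are examined at the end. A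
free window contains at most n endpoints; if it contains n, then all tight boxes in it with left
side A coincide, and three binary searches find this box (`tight_of_shrink`). Conversely, the
y-range of a tight box is a free window, and it lies in a maximal one when it is about to lose this
property. The first removed window is read from a table (`FSpec`) that is updated in O(n) time when
A moves left. With O(n) left sides, O(n) windows each and O(log n) time for a window, the total is
O(n² log n).

Ranks break ties arbitrarily, so a tight box of rank space need not come from a rectangle of the
plane; it does if the rectangle spanned by its four endpoints still contains only n of them
(`Good`). -/

namespace Stab

/-! ### Endpoints numbered by natural numbers -/

/-- The number of the other endpoint of the segment of endpoint number `e`. -/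
def partner (n e : ℕ) : ℕ := if e < n then e + n else e - n

/-- Endpoint number `e`, with a default value outside the range. -/
def pos {n : ℕ} (S : Fin n → Segment) (e : ℕ) : Point :=
  if h : e < n + n then endpoint S ⟨e, h⟩ else 0

theorem pos_coe {n : ℕ} (S : Fin n → Segment) (e : Fin (n + n)) : pos S e = endpoint S e := by
  simp [pos]

theorem pos_of_lt {n : ℕ} (S : Fin n → Segment) {i : ℕ} (h : i < n) : pos S i = (S ⟨i, h⟩).1 := by
  have h' : i < n + n := by omega
  have : (⟨i, h'⟩ : Fin (n + n)) = Fin.castAdd n ⟨i, h⟩ := rfl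
  rw [pos, dif_pos h', this, endpoint, Fin.append_left]

theorem pos_add {n : ℕ} (S : Fin n → Segment) {i : ℕ} (h : i < n) :
    pos S (i + n) = (S ⟨i, h⟩).2 := by
  have h' : i + n < n + n := by omega
  have : (⟨i + n, h'⟩ : Fin (n + n)) = Fin.natAdd n ⟨i, h⟩ := by ext; simp [add_comm]
  rw [pos, dif_pos h', this, endpoint, Fin.append_right]

theorem partner_lt {n e : ℕ} (h : e < n + n) : partner n e < n + n := by
  unfold partner; split_ifs <;> omega

theorem partner_partner {n e : ℕ} (h : e < n + n) : partner n (partner n e) = e := by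
  unfold partner; split_ifs <;> omega

theorem partner_ne {n e : ℕ} (h : e < n + n) : partner n e ≠ e := by
  unfold partner; split_ifs <;> omega

theorem stabs_iff {n : ℕ} (R : Set Point) (S : Fin n → Segment) :
    Stabs R S ↔ ∀ e < n + n, (pos S (partner n e) ∈ R ↔ pos S e ∉ R) := by
  constructor
  · intro h e he
    by_cases hn : e < n
    · have := h ⟨e, hn⟩
      rw [partner, if_pos hn, pos_add S hn, pos_of_lt S hn]
      exact (iff_not_comm.mp (xor_iff_iff_not.mp this))
    · have hk : e - n < n := by omega
      have := h ⟨e - n, hk⟩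
      rw [partner, if_neg hn, pos_of_lt S hk]
      have e1 : pos S e = (S ⟨e - n, hk⟩).2 := by
        rw [← pos_add S hk]; congr 1; omega
      rw [e1]
      exact xor_iff_iff_not.mp this
  · intro h i
    have := h i (by omega)
    rw [partner, if_pos i.2, pos_add S i.2, pos_of_lt S i.2] at this
    exact xor_iff_iff_not.mpr (iff_not_comm.mp this)

theorem mem_redPoints {n : ℕ} {S : Fin n → Segment} {R : Set Point} {x : Point} :
    x ∈ redPoints S R ↔ ∃ e < n + n, pos S e = x ∧ x ∈ R := by
  constructor
  · rintro ⟨⟨e, rfl⟩, h⟩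
    exact ⟨e, e.2, pos_coe S e, h⟩
  · rintro ⟨e, he, rfl, h⟩
    exact ⟨⟨⟨e, he⟩, (pos_coe S ⟨e, he⟩).symm⟩, h⟩

theorem combEquiv_iff {n : ℕ} {S : Fin n → Segment} {R R' : Set Point} :
    CombEquiv S R R' ↔ ∀ e < n + n, (pos S e ∈ R ↔ pos S e ∈ R') := by
  constructor
  · intro h e he
    have h1 := Set.ext_iff.mp h (pos S e)
    simp only [mem_redPoints] at h1
    constructor
    · intro hr
      obtain ⟨_, _, _, h⟩ := h1.mp ⟨e, he, rfl, hr⟩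
      exact h
    · intro hr
      obtain ⟨_, _, _, h⟩ := h1.mpr ⟨e, he, rfl, hr⟩
      exact h
  · intro h
    ext x
    simp only [mem_redPoints]
    constructor
    · rintro ⟨e, he, rfl, hr⟩; exact ⟨e, he, rfl, (h e he).mp hr⟩
    · rintro ⟨e, he, rfl, hr⟩; exact ⟨e, he, rfl, (h e he).mpr hr⟩

/-- An endpoint in `R'` but not in `R` has its partner in `R`, hence in `R'`, and `R'` would contain
a whole segment. -/
theorem Stabs.combEquiv_of_subset {n : ℕ} {S : Fin n → Segment} {R R' : Set Point}
    (h : Stabs R S) (h' : Stabs R' S) (hsub : ∀ e < n + n, pos S e ∈ R → pos S e ∈ R') :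
    CombEquiv S R R' := by
  rw [stabs_iff] at h h'
  refine combEquiv_iff.mpr fun e he => ⟨hsub e he, fun hr => ?_⟩
  by_contra hn
  exact (h' e he).mp (hsub _ (partner_lt he) ((h e he).mpr hn)) hr

/-- Needed for real coordinates in `IsStabbingRectangle.exists_spans` and for ranks in
`IsStabbingRectangle.exists_good`, hence the general order. -/
theorem exists_extremes {α : Type*} [LinearOrder α] {N : ℕ} (u v : ℕ → α) {p : ℕ → Prop}
    (h : ∃ e < N, p e) :
    ∃ l r b t, (l < N ∧ p l) ∧ (r < N ∧ p r) ∧ (b < N ∧ p b) ∧ (t < N ∧ p t) ∧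
      ∀ e < N, p e → u l ≤ u e ∧ u e ≤ u r ∧ v b ≤ v e ∧ v e ≤ v t := by
  classical
  set I := (Finset.range N).filter p
  have hI : I.Nonempty := by
    obtain ⟨e, he, hp⟩ := h
    exact ⟨e, by simp [I, he, hp]⟩
  obtain ⟨l, hl, hl'⟩ := I.exists_min_image u hI
  obtain ⟨r, hr, hr'⟩ := I.exists_max_image u hI
  obtain ⟨b, hb, hb'⟩ := I.exists_min_image v hI
  obtain ⟨t, ht, ht'⟩ := I.exists_max_image v hI
  simp only [I, Finset.mem_filter, Finset.mem_range] at hl hr hb ht hl' hr' hb' ht'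
  exact ⟨l, r, b, t, hl, hr, hb, ht, fun e he hp =>
    ⟨hl' e ⟨he, hp⟩, hr' e ⟨he, hp⟩, hb' e ⟨he, hp⟩, ht' e ⟨he, hp⟩⟩⟩

theorem Stabs.exists_mem {n : ℕ} {S : Fin n → Segment} {R : Set Point} (hn : 1 ≤ n)
    (h : Stabs R S) : ∃ e < n + n, pos S e ∈ R := by
  rw [stabs_iff] at h
  by_cases h0 : pos S 0 ∈ R
  · exact ⟨0, by omega, h0⟩
  · exact ⟨_, partner_lt (by omega), (h 0 (by omega)).mpr h0⟩

/-- The rectangle spanned by four endpoints. -/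
def spanBox {n : ℕ} (S : Fin n → Segment) (q : ℕ × ℕ × ℕ × ℕ) : Set Point :=
  box (pos S q.1).1 (pos S q.2.1).1 (pos S q.2.2.1).2 (pos S q.2.2.2).2

theorem mem_spanBox {n : ℕ} {S : Fin n → Segment} {q : ℕ × ℕ × ℕ × ℕ} {x : Point} :
    x ∈ spanBox S q ↔ ((pos S q.1).1 ≤ x.1 ∧ x.1 ≤ (pos S q.2.1).1) ∧
      (pos S q.2.2.1).2 ≤ x.2 ∧ x.2 ≤ (pos S q.2.2.2).2 := by
  simp only [spanBox, box, Set.mem_prod, Set.mem_Icc]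

/-- The quadruple `q` spans a stabbing rectangle that contains the four endpoints. -/
structure Spans {n : ℕ} (S : Fin n → Segment) (q : ℕ × ℕ × ℕ × ℕ) : Prop where
  left : q.1 < n + n ∧ pos S q.1 ∈ spanBox S q
  right : q.2.1 < n + n ∧ pos S q.2.1 ∈ spanBox S q
  bottom : q.2.2.1 < n + n ∧ pos S q.2.2.1 ∈ spanBox S q
  top : q.2.2.2 < n + n ∧ pos S q.2.2.2 ∈ spanBox S q
  stabs : Stabs (spanBox S q) S

theorem Spans.isStabbingRectangle {n : ℕ} {S : Fin n → Segment} {q : ℕ × ℕ × ℕ × ℕ}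
    (h : Spans S q) : IsStabbingRectangle S (spanBox S q) := by
  refine ⟨⟨_, _, _, _, ?_, ?_, rfl⟩, h.stabs⟩
  · have := (mem_spanBox.mp h.left.2).1; exact this.1.trans this.2
  · have := (mem_spanBox.mp h.left.2).2; exact this.1.trans this.2

theorem Stabs.congr {n : ℕ} {S : Fin n → Segment} {R R' : Set Point} (h : Stabs R S)
    (hR : CombEquiv S R R') : Stabs R' S := by
  rw [stabs_iff] at *
  rw [combEquiv_iff] at hR
  intro e he
  rw [← hR e he, ← hR _ (partner_lt he)]
  exact h e he

/-- The bounding box of the endpoints in `R` lies in `R` and contains all of them. -/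
theorem IsStabbingRectangle.exists_spans {n : ℕ} (hn : 1 ≤ n) {S : Fin n → Segment}
    {R : Set Point} (h : IsStabbingRectangle S R) :
    ∃ q, Spans S q ∧ redPoints S (spanBox S q) = redPoints S R := by
  obtain ⟨⟨a, b, c, d, hab, hcd, rfl⟩, hs⟩ := h
  obtain ⟨l, r, bt, t, hl, hr, hb, ht, hall⟩ :=
    exists_extremes (fun e => (pos S e).1) (fun e => (pos S e).2) (hs.exists_mem hn)
  have key : CombEquiv S (spanBox S (l, r, bt, t)) (box a b c d) := by
    refine combEquiv_iff.mpr fun e he => ⟨fun h => ?_, fun h => ?_⟩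
    · rw [mem_spanBox] at h
      have h1 := hl.2; have h2 := hr.2; have h3 := hb.2; have h4 := ht.2
      simp only [box, Set.mem_prod, Set.mem_Icc] at *
      exact ⟨⟨h1.1.1.trans h.1.1, h.1.2.trans h2.1.2⟩, ⟨h3.2.1.trans h.2.1, h.2.2.trans h4.2.2⟩⟩
    · rw [mem_spanBox]
      have := hall e he h
      exact ⟨⟨this.1, this.2.1⟩, this.2.2⟩
  have k2 := combEquiv_iff.mp key
  exact ⟨(l, r, bt, t), ⟨⟨hl.1, (k2 l hl.1).mpr hl.2⟩, ⟨hr.1, (k2 r hr.1).mpr hr.2⟩,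
    ⟨hb.1, (k2 bt hb.1).mpr hb.2⟩, ⟨ht.1, (k2 t ht.1).mpr ht.2⟩, hs.congr key.symm⟩, key⟩

/-! ### The quadratic upper bound -/

section UpperBound

variable {n : ℕ} {S : Fin n → Segment}

theorem Spans.eq_of_subset {q q' : ℕ × ℕ × ℕ × ℕ} (h : Spans S q) (h' : Spans S q')
    (h1 : (pos S q'.1).1 ≤ (pos S q.1).1) (h2 : (pos S q.2.1).1 ≤ (pos S q'.2.1).1)
    (h3 : (pos S q'.2.2.1).2 ≤ (pos S q.2.2.1).2) (h4 : (pos S q.2.2.2).2 ≤ (pos S q'.2.2.2).2) :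
    redPoints S (spanBox S q) = redPoints S (spanBox S q') := by
  refine h.stabs.combEquiv_of_subset h'.stabs fun e he hm => ?_
  rw [mem_spanBox] at *
  exact ⟨⟨h1.trans hm.1.1, hm.1.2.trans h2⟩, ⟨h3.trans hm.2.1, hm.2.2.trans h4⟩⟩

/-- Some spanning quadruple of `Z` has the same left and right endpoints as `q`, and a higher
bottom side. -/
def CanRise (S : Fin n → Segment) (Z : Finset (ℕ × ℕ × ℕ × ℕ)) (q : ℕ × ℕ × ℕ × ℕ) : Prop :=
  ∃ q' ∈ Z, q'.1 = q.1 ∧ q'.2.1 = q.2.1 ∧ (pos S q.2.2.1).2 < (pos S q'.2.2.1).2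

/-- Write t', t₂ for the tops of `q'` and of its raised version, t for the top of `q`. The right
endpoint of `q'` is outside `q`, so its partner is in `q`; it is in neither of the other two
rectangles, which is possible only if it lies above t' and t₂. So t₂ < t. The bottom endpoint is
outside the raised rectangle, so its partner is inside it, at a height within the range of `q`. As
`q` does not contain this partner, it must lie to the right of `q`. -/
theorem partner_between {Z : Finset (ℕ × ℕ × ℕ × ℕ)} (hZ : ∀ q ∈ Z, Spans S q)
    (hinj : Set.InjOn (fun q => redPoints S (spanBox S q)) Z) {q q' : ℕ × ℕ × ℕ × ℕ}
    (hq : q ∈ Z) (hq' : q' ∈ Z) (hl : q.1 = q'.1) (hb : q.2.2.1 = q'.2.2.1)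
    (hlt : (pos S q.2.1).1 < (pos S q'.2.1).1) (hr : CanRise S Z q') :
    (pos S q.2.1).1 < (pos S (partner n q'.2.2.1)).1 ∧
      (pos S (partner n q'.2.2.1)).1 ≤ (pos S q'.2.1).1 := by
  obtain ⟨l, r, b, t⟩ := q
  obtain ⟨l', r', b', t'⟩ := q'
  simp only at hl hb hlt
  subst hl hb
  obtain ⟨⟨l2, r2, b2, t2⟩, hz, e1, e2, h3⟩ := hr
  simp only at e1 e2 h3
  subst e1 e2
  have A := hZ _ hq
  have A' := hZ _ hq'
  have A2 := hZ _ hz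
  -- Otherwise `q` would be contained in `q'`, and the two would be equivalent.
  have hd : (pos S t').2 < (pos S t).2 := by
    by_contra hc
    have := hinj hq hq' (A.eq_of_subset A' le_rfl hlt.le le_rfl (not_lt.mp hc))
    simp only [Prod.mk.injEq] at this
    rw [this.2.1] at hlt
    exact lt_irrefl _ hlt
  have sA := (stabs_iff _ _).mp A.stabs
  have sA' := (stabs_iff _ _).mp A'.stabs
  have sA2 := (stabs_iff _ _).mp A2.stabs
  have rl := A.left.1
  have rr := A'.right
  have rr2 := A2.right
  have rb := A.bottom
  have rb' := A'.bottom
  have rl' := A'.left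
  have rl2 := A2.left
  simp only at rl rr rr2 rb rb' rl' rl2
  have p1 : pos S (partner n r2) ∈ spanBox S (l2, r, b, t) :=
    (sA _ rr.1).mpr fun h => absurd (mem_spanBox.mp h).1.2 (not_le.mpr hlt)
  have p2 : pos S (partner n r2) ∉ spanBox S (l2, r2, b, t') := fun h => (sA' _ rr.1).mp h rr.2
  have p3 : pos S (partner n r2) ∉ spanBox S (l2, r2, b2, t2) := fun h => (sA2 _ rr.1).mp h rr2.2
  have p4 : pos S (partner n b) ∉ spanBox S (l2, r, b, t) := fun h => (sA _ rb.1).mp h rb.2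
  have p5 : pos S (partner n b) ∈ spanBox S (l2, r2, b2, t2) :=
    (sA2 _ rb.1).mpr fun h => absurd (mem_spanBox.mp h).2.1 (not_le.mpr h3)
  simp only [mem_spanBox] at p1 p2 p3 p4 p5 rl' rl2
  have y1 : (pos S t').2 < (pos S (partner n r2)).2 := by
    by_contra hc
    exact p2 ⟨⟨p1.1.1, p1.1.2.trans hlt.le⟩, p1.2.1, not_lt.mp hc⟩
  -- The left endpoint lies in both rectangles with right endpoint `r2`, so the raised bottom is not
  -- above the top of `q'`.
  have y2 : (pos S t2).2 < (pos S (partner n r2)).2 := by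
    by_contra hc
    exact p3 ⟨⟨p1.1.1, p1.1.2.trans hlt.le⟩, by linarith [rl'.2.2.2, rl2.2.2.1], not_lt.mp hc⟩
  refine ⟨?_, p5.1.2⟩
  by_contra hc
  exact p4 ⟨⟨p5.1.1, not_lt.mp hc⟩, by linarith, by linarith⟩

/-- Three injections into pairs of endpoints: `Z₁` by (left, right), `Z₃` and `Z₄` by (left,
bottom). -/
theorem card_le_of_spans {Z : Finset (ℕ × ℕ × ℕ × ℕ)} (hZ : ∀ q ∈ Z, Spans S q)
    (hinj : Set.InjOn (fun q => redPoints S (spanBox S q)) Z) : Z.card ≤ 12 * n ^ 2 := by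
  classical
  set G := Finset.range (n + n) ×ˢ Finset.range (n + n)
  have hG : G.card = 4 * n ^ 2 := by simp [G]; ring
  set Z₁ := Z.filter fun q => ¬ CanRise S Z q
  set Z₂ := Z.filter fun q => CanRise S Z q
  let W : ℕ × ℕ × ℕ × ℕ → Prop := fun q =>
    ∃ q' ∈ Z, q'.1 = q.1 ∧ q'.2.2.1 = q.2.2.1 ∧ (pos S q'.2.1).1 < (pos S q.2.1).1
  set Z₃ := Z₂.filter fun q => ¬ W q
  set Z₄ := Z₂.filter fun q => W q
  have c1 : Z₁.card ≤ G.card := by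
    refine Finset.card_le_card_of_injOn (fun q => (q.1, q.2.1)) ?_ ?_
    · intro q hq
      have := hZ q (Finset.mem_filter.mp hq).1
      simp [G, this.left.1, this.right.1]
    · rintro q hq q' hq' h
      simp only [Prod.mk.injEq] at h
      have m := Finset.mem_filter.mp hq
      have m' := Finset.mem_filter.mp hq'
      -- Neither of the two can rise, so their bottoms are at the same height and the rectangles are
      -- nested.
      have e : (pos S q.2.2.1).2 = (pos S q'.2.2.1).2 := by
        apply le_antisymm
        · by_contra hc
          exact m'.2 ⟨q, m.1, h.1, h.2, not_le.mp hc⟩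
        · by_contra hc
          exact m.2 ⟨q', m'.1, h.1.symm, h.2.symm, not_le.mp hc⟩
      rcases le_total (pos S q.2.2.2).2 (pos S q'.2.2.2).2 with ht | ht
      · exact hinj m.1 m'.1 ((hZ q m.1).eq_of_subset (hZ q' m'.1) (by rw [h.1]) (by rw [h.2])
          e.ge ht)
      · exact (hinj m'.1 m.1 ((hZ q' m'.1).eq_of_subset (hZ q m.1) (by rw [h.1]) (by rw [h.2])
          e.le ht)).symm
  have hmaps : ∀ q ∈ Z, (q.1, q.2.2.1) ∈ G := by
    intro q hq
    have := hZ q hq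
    simp [G, this.left.1, this.bottom.1]
  -- With three sides in common, the rectangles are nested whichever top is higher.
  have heq : ∀ q ∈ Z, ∀ q' ∈ Z, q.1 = q'.1 → q.2.2.1 = q'.2.2.1 →
      (pos S q.2.1).1 = (pos S q'.2.1).1 → q = q' := by
    intro q hq q' hq' h1 h2 h3
    rcases le_total (pos S q.2.2.2).2 (pos S q'.2.2.2).2 with ht | ht
    · exact hinj hq hq' ((hZ q hq).eq_of_subset (hZ q' hq') (by rw [h1]) h3.le (by rw [h2]) ht)
    · exact (hinj hq' hq ((hZ q' hq').eq_of_subset (hZ q hq) (by rw [h1]) h3.ge (by rw [h2])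
        ht)).symm
  have c3 : Z₃.card ≤ G.card := by
    refine Finset.card_le_card_of_injOn (fun q => (q.1, q.2.2.1)) ?_ ?_
    · intro q hq
      exact hmaps q (Finset.mem_filter.mp (Finset.mem_filter.mp hq).1).1
    · rintro q hq q' hq' h
      simp only [Prod.mk.injEq] at h
      have m := Finset.mem_filter.mp hq
      have m' := Finset.mem_filter.mp hq'
      have k := (Finset.mem_filter.mp m.1).1
      have k' := (Finset.mem_filter.mp m'.1).1
      refine heq q k q' k' h.1 h.2 (le_antisymm ?_ ?_)
      · by_contra hc
        exact m.2 ⟨q', k', h.1.symm, h.2.symm, not_le.mp hc⟩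
      · by_contra hc
        exact m'.2 ⟨q, k, h.1, h.2, not_le.mp hc⟩
  have c4 : Z₄.card ≤ G.card := by
    refine Finset.card_le_card_of_injOn (fun q => (q.1, q.2.2.1)) ?_ ?_
    · intro q hq
      exact hmaps q (Finset.mem_filter.mp (Finset.mem_filter.mp hq).1).1
    -- For right sides `q₀` < `q` < `q'`, the partner of the bottom endpoint would be both at most
    -- and beyond the right side of `q`.
    · have main : ∀ q ∈ Z₄, ∀ q' ∈ Z₄, q.1 = q'.1 → q.2.2.1 = q'.2.2.1 →
          ¬ (pos S q.2.1).1 < (pos S q'.2.1).1 := by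
        intro q hq q' hq' h1 h2 hlt
        have m := Finset.mem_filter.mp hq
        have m' := Finset.mem_filter.mp hq'
        have k := Finset.mem_filter.mp m.1
        have k' := Finset.mem_filter.mp m'.1
        obtain ⟨q₀, k₀, e1, e2, h0⟩ := m.2
        have i1 := partner_between hZ hinj k₀ k.1 e1 e2 h0 k.2
        have i2 := partner_between hZ hinj k.1 k'.1 h1 h2 hlt k'.2
        rw [← h2] at i2
        linarith [i1.2, i2.1]
      rintro q hq q' hq' h
      simp only [Prod.mk.injEq] at h
      have k := (Finset.mem_filter.mp (Finset.mem_filter.mp hq).1).1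
      have k' := (Finset.mem_filter.mp (Finset.mem_filter.mp hq').1).1
      exact heq q k q' k' h.1 h.2 (le_antisymm
        (not_lt.mp (main q' hq' q hq h.1.symm h.2.symm)) (not_lt.mp (main q hq q' hq' h.1 h.2)))
  have s1 : Z₂.card + Z₁.card = Z.card := Finset.card_filter_add_card_filter_not _
  have s2 : Z₄.card + Z₃.card = Z₂.card := Finset.card_filter_add_card_filter_not _
  omega

theorem stabberClasses_bound (hn : 1 ≤ n) (S : Fin n → Segment) :
    (stabberClasses S).Finite ∧ (stabberClasses S).ncard ≤ 12 * n ^ 2 := by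
  classical
  set Q := {q | Spans S q}
  have hQ : Q.Finite := by
    refine (Set.toFinite ((Finset.range (n + n) ×ˢ Finset.range (n + n) ×ˢ
      Finset.range (n + n) ×ˢ Finset.range (n + n) : Finset _) : Set (ℕ × ℕ × ℕ × ℕ))).subset ?_
    intro q hq
    simp [hq.left.1, hq.right.1, hq.bottom.1, hq.top.1]
  set f : ℕ × ℕ × ℕ × ℕ → Set Point := fun q => redPoints S (spanBox S q)
  have himg : stabberClasses S = f '' Q := by
    ext A
    constructor
    · rintro ⟨R, hR, rfl⟩
      obtain ⟨q, hq, h⟩ := hR.exists_spans hn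
      exact ⟨q, hq, h⟩
    · rintro ⟨q, hq, rfl⟩
      exact ⟨_, hq.isStabbingRectangle, rfl⟩
  -- `Q'` contains exactly one spanning quadruple for each class.
  obtain ⟨Q', hsub, hbij⟩ := Set.exists_subset_bijOn Q f
  have hQ' : Q'.Finite := hQ.subset hsub
  refine ⟨himg ▸ hQ.image f, ?_⟩
  rw [himg, ← hbij.image_eq, hbij.injOn.ncard_image, Set.ncard_eq_toFinset_card _ hQ']
  exact card_le_of_spans (S := S) (fun q hq => hsub (by simpa using hq))
    (by simpa using hbij.injOn)

end UpperBound

/-! ### The quadratic lower bound -/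

/-- Segment `i` of a family with quadratically many stabbing rectangles: for `i < n / 2` it can
only be crossed by the left or right side, otherwise only by the bottom or top side. -/
def crossSegment (n i : ℕ) : Segment :=
  if i < n / 2 then (((i : ℝ), (n + 1 : ℝ)), ((i + (3 * n + 3) : ℝ), (n + 2 : ℝ)))
  else (((n + 1 : ℝ), (i : ℝ)), ((n + 2 : ℝ), (i + (3 * n + 3) : ℝ)))

/-- The rectangles that stab the family of the segments `crossSegment n i`. -/
def crossBox (n u v : ℕ) : Set Point :=
  box u (u + (3 * n + 2) : ℝ) v (v + (3 * n + 2) : ℝ)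

/-- In its long direction a segment extends over 3n + 3, one more than the side 3n + 2 of the
square, so its first endpoint is lost exactly when the second is gained. In the other direction its
coordinates n + 1 and n + 2 lie within every square with u, v ≤ n. -/
theorem fst_mem_crossBox {n u v i : ℕ} (hu : u ≤ n) (hv : v ≤ n) (hi : i < n) :
    (crossSegment n i).1 ∈ crossBox n u v ↔ if i < n / 2 then u ≤ i else v ≤ i := by
  unfold crossSegment crossBox box
  have a : (u : ℝ) ≤ n := by exact_mod_cast hu
  have b : (v : ℝ) ≤ n := by exact_mod_cast hv
  have c : (i : ℝ) ≤ n := by exact_mod_cast hi.le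
  have p : (0 : ℝ) ≤ u := u.cast_nonneg
  have q : (0 : ℝ) ≤ v := v.cast_nonneg
  split_ifs
  · simp only [Set.mem_prod, Set.mem_Icc, Nat.cast_le]
    exact ⟨fun h => h.1.1, fun h => ⟨⟨h, by linarith⟩, by linarith, by linarith⟩⟩
  · simp only [Set.mem_prod, Set.mem_Icc, Nat.cast_le]
    exact ⟨fun h => h.2.1, fun h => ⟨⟨by linarith, by linarith⟩, h, by linarith⟩⟩

theorem snd_mem_crossBox {n u v i : ℕ} (hu : u ≤ n) (hv : v ≤ n) :
    (crossSegment n i).2 ∈ crossBox n u v ↔ if i < n / 2 then i < u else i < v := by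
  unfold crossSegment crossBox box
  have a : (u : ℝ) ≤ n := by exact_mod_cast hu
  have b : (v : ℝ) ≤ n := by exact_mod_cast hv
  have c : (0 : ℝ) ≤ i := i.cast_nonneg
  have p : (0 : ℝ) ≤ u := u.cast_nonneg
  have q : (0 : ℝ) ≤ v := v.cast_nonneg
  have e : ∀ w : ℕ, (i + (3 * n + 3) : ℝ) ≤ w + (3 * n + 2) ↔ i < w := by
    intro w
    rw [← Nat.add_one_le_iff]
    constructor
    · intro h
      have : ((i + 1 : ℕ) : ℝ) ≤ w := by push_cast; linarith
      exact_mod_cast this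
    · intro h
      have : ((i + 1 : ℕ) : ℝ) ≤ w := by exact_mod_cast h
      push_cast at this; linarith
  split_ifs
  · simp only [Set.mem_prod, Set.mem_Icc]
    rw [e]
    exact ⟨fun h => h.1.2, fun h => ⟨⟨by linarith, h⟩, by linarith, by linarith⟩⟩
  · simp only [Set.mem_prod, Set.mem_Icc]
    rw [e]
    exact ⟨fun h => h.2.2, fun h => ⟨⟨by linarith, by linarith⟩, by linarith, h⟩⟩

theorem crossSegment_ne (n i : ℕ) :
    (crossSegment n i).1.1 < (crossSegment n i).2.1 ∧
      (crossSegment n i).1.2 < (crossSegment n i).2.2 := by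
  unfold crossSegment
  have p : (0 : ℝ) ≤ n := n.cast_nonneg
  split_ifs <;> constructor <;> simp only <;> linarith

theorem crossSegment_injective (n : ℕ) :
    Function.Injective fun i : Fin n => s((crossSegment n i).1, (crossSegment n i).2) := by
  intro i j h
  have hi := crossSegment_ne n i
  have hj := crossSegment_ne n j
  rcases Sym2.eq_iff.mp h with ⟨h1, h2⟩ | ⟨h1, h2⟩
  · have a : (i : ℝ) < n := by exact_mod_cast i.2
    have b : (j : ℝ) < n := by exact_mod_cast j.2
    ext
    unfold crossSegment at h1
    split_ifs at h1 <;> simp only [Prod.mk.injEq] at h1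
    · exact_mod_cast h1.1
    · linarith [h1.1]
    · linarith [h1.1]
    · exact_mod_cast h1.2
  -- Exchanged endpoints are impossible: the first endpoint always has the smaller abscissa.
  · rw [h1, h2] at hi
    exact absurd hi.1 hj.1.not_gt

theorem crossSegment_ncard (n : ℕ) (hn : 1 ≤ n) :
    (n : ℝ) ^ 2 / 4 ≤ ((stabberClasses fun i : Fin n => crossSegment n i).ncard : ℝ) := by
  classical
  set S : Fin n → Segment := fun i => crossSegment n i
  set m := n / 2
  have hmn : m < n := by omega
  -- The shift u is a threshold among the indices below m, and v is one among the indices from m on,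
  -- so each pair (u, v) gives a different class.
  set G := Finset.range (m + 1) ×ˢ Finset.Icc m n
  set f : ℕ × ℕ → Set Point := fun p => redPoints S (crossBox n p.1 p.2)
  have hsub : f '' G ⊆ stabberClasses S := by
    rintro _ ⟨⟨u, v⟩, hp, rfl⟩
    simp only [G, Finset.coe_product, Set.mem_prod, Finset.mem_coe, Finset.mem_range,
      Finset.mem_Icc] at hp
    refine ⟨_, ⟨⟨_, _, _, _, ?_, ?_, rfl⟩, fun i => ?_⟩, rfl⟩
    · have : (0 : ℝ) ≤ n := n.cast_nonneg
      simp only; linarith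
    · have : (0 : ℝ) ≤ n := n.cast_nonneg
      simp only; linarith
    · rw [xor_iff_iff_not]
      have h1 := fst_mem_crossBox (n := n) (u := u) (v := v) (by omega) (by omega) i.2
      have h2 := snd_mem_crossBox (n := n) (u := u) (v := v) (i := i) (by omega) (by omega)
      rw [show (S i).1 = (crossSegment n i).1 from rfl,
        show (S i).2 = (crossSegment n i).2 from rfl]
      rw [show box u (u + (3 * n + 2) : ℝ) v (v + (3 * n + 2) : ℝ) = crossBox n u v from rfl]
      rw [h1, h2]
      split_ifs <;> omega
  have hinj : Set.InjOn f G := by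
    rintro ⟨u, v⟩ hp ⟨u', v'⟩ hp' h
    simp only [G, Finset.coe_product, Set.mem_prod, Finset.mem_coe, Finset.mem_range,
      Finset.mem_Icc] at hp hp'
    have h := combEquiv_iff.mp (show CombEquiv S (crossBox n u v) (crossBox n u' v') from h)
    have key : ∀ i < n, ((if i < n / 2 then u ≤ i else v ≤ i) ↔
        (if i < n / 2 then u' ≤ i else v' ≤ i)) := by
      intro i hi
      have := h i (by omega)
      rw [pos_of_lt S hi] at this
      simp only [S] at this
      rwa [fst_mem_crossBox (by omega) (by omega) hi, fst_mem_crossBox (by omega) (by omega) hi]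
        at this
    have e1 : u = u' := by
      by_contra hne
      have := key (min u u') (by omega)
      rw [if_pos (by omega), if_pos (by omega)] at this
      omega
    have e2 : v = v' := by
      by_contra hne
      have := key (min v v') (by omega)
      rw [if_neg (by omega), if_neg (by omega)] at this
      omega
    rw [e1, e2]
  have h1 := Set.ncard_le_ncard hsub (stabberClasses_bound hn S).1
  rw [hinj.ncard_image, Set.ncard_coe_finset] at h1
  have h2 : G.card = (m + 1) * (n + 1 - m) := by simp [G]
  rw [h2] at h1
  have h3 : (n : ℝ) ≤ 2 * ((m + 1 : ℕ) : ℝ) := by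
    have : n ≤ 2 * (m + 1) := by omega
    exact_mod_cast this
  have h4 : (n : ℝ) ≤ 2 * ((n + 1 - m : ℕ) : ℝ) := by
    have : n ≤ 2 * (n + 1 - m) := by omega
    exact_mod_cast this
  have h5 : (((m + 1) * (n + 1 - m) : ℕ) : ℝ) ≤ ((stabberClasses S).ncard : ℝ) := by
    exact_mod_cast h1
  rw [Nat.cast_mul] at h5
  have h6 := mul_le_mul h3 h4 n.cast_nonneg (by positivity)
  nlinarith

/-! ### Points in rank space -/

/-- The `2n` endpoints, sorted by `x` and by `y`: the ranks `1, …, 2n`, and the endpoints of given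
rank. -/
structure Ranked (n : ℕ) where
  X : ℕ → ℕ
  Y : ℕ → ℕ
  PX : ℕ → ℕ
  PY : ℕ → ℕ
  x_spec : ∀ e < n + n, 1 ≤ X e ∧ X e ≤ n + n ∧ PX (X e) = e
  y_spec : ∀ e < n + n, 1 ≤ Y e ∧ Y e ≤ n + n ∧ PY (Y e) = e
  px_spec : ∀ r, 1 ≤ r → r ≤ n + n → PX r < n + n ∧ X (PX r) = r
  py_spec : ∀ r, 1 ≤ r → r ≤ n + n → PY r < n + n ∧ Y (PY r) = r

namespace Ranked

variable {n : ℕ} (I : Ranked n)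

theorem x_inj {e f : ℕ} (he : e < n + n) (hf : f < n + n) (h : I.X e = I.X f) : e = f := by
  rw [← (I.x_spec e he).2.2, h, (I.x_spec f hf).2.2]

theorem y_inj {e f : ℕ} (he : e < n + n) (hf : f < n + n) (h : I.Y e = I.Y f) : e = f := by
  rw [← (I.y_spec e he).2.2, h, (I.y_spec f hf).2.2]

/-- Endpoint `e` lies in the half-open box `(A, B] × (C, D]` of rank space. -/
def InBox (A B C D e : ℕ) : Prop := (A < I.X e ∧ I.X e ≤ B) ∧ C < I.Y e ∧ I.Y e ≤ D

instance (A B C D : ℕ) : DecidablePred (I.InBox A B C D) := fun e => by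
  unfold InBox; infer_instance

/-- The number of endpoints in a box. -/
def cnt (A B C D : ℕ) : ℕ := ((Finset.range (n + n)).filter (I.InBox A B C D)).card

/-- The box contains exactly one endpoint of each segment. -/
def StabBox (A B C D : ℕ) : Prop :=
  ∀ e < n + n, (I.InBox A B C D (partner n e) ↔ ¬ I.InBox A B C D e)

/-- The box does not contain both endpoints of a segment. -/
def Free (A B C D : ℕ) : Prop :=
  ∀ e < n + n, ¬ (I.InBox A B C D e ∧ I.InBox A B C D (partner n e))

/-- `partner n` is an involution of the endpoint numbers. -/
theorem card_partner (A B C D : ℕ) :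
    ((Finset.range (n + n)).filter fun e => I.InBox A B C D (partner n e)).card =
      I.cnt A B C D := by
  refine Finset.card_nbij' (partner n) (partner n) ?_ ?_ ?_ ?_
  · intro e he
    simp only [Finset.coe_filter, Finset.mem_range, Set.mem_ofPred_eq] at *
    exact ⟨partner_lt he.1, he.2⟩
  · intro e he
    simp only [Finset.coe_filter, Finset.mem_range, Set.mem_ofPred_eq] at *
    exact ⟨partner_lt he.1, by rw [partner_partner he.1]; exact he.2⟩
  · intro e he
    simp only [Finset.coe_filter, Finset.mem_range, Set.mem_ofPred_eq] at he
    exact partner_partner he.1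
  · intro e he
    simp only [Finset.coe_filter, Finset.mem_range, Set.mem_ofPred_eq] at he
    exact partner_partner he.1

theorem StabBox.free {A B C D : ℕ} (h : I.StabBox A B C D) : I.Free A B C D :=
  fun e he hb => (h e he).mp hb.2 hb.1

theorem StabBox.cnt_eq {A B C D : ℕ} (h : I.StabBox A B C D) : I.cnt A B C D = n := by
  have h1 := Finset.card_filter_add_card_filter_not (s := Finset.range (n + n))
    (I.InBox A B C D)
  have h2 := I.card_partner A B C D
  rw [Finset.filter_congr (q := fun e => ¬ I.InBox A B C D e)
    (fun e he => h e (Finset.mem_range.mp he))] at h2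
  rw [h2, Finset.card_range] at h1
  change I.cnt A B C D + _ = _ at h1
  omega

theorem Free.disjoint {A B C D : ℕ} (h : I.Free A B C D) :
    Disjoint ((Finset.range (n + n)).filter (I.InBox A B C D))
      ((Finset.range (n + n)).filter fun e => I.InBox A B C D (partner n e)) := by
  rw [Finset.disjoint_left]
  intro e h1 h2
  simp only [Finset.mem_filter, Finset.mem_range] at h1 h2
  exact h e h1.1 ⟨h1.2, h2.2⟩

theorem Free.cnt_le {A B C D : ℕ} (h : I.Free A B C D) : I.cnt A B C D ≤ n := by
  have h1 := Finset.card_union_of_disjoint (Free.disjoint I h)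
  have h2 := Finset.card_le_card (Finset.union_subset
    (Finset.filter_subset (I.InBox A B C D) (Finset.range (n + n)))
    (Finset.filter_subset (fun e => I.InBox A B C D (partner n e)) (Finset.range (n + n))))
  rw [h1, I.card_partner, Finset.card_range] at h2
  change I.cnt A B C D + _ ≤ _ at h2
  omega

/-- The endpoints in a free box and their partners form two disjoint sets of n elements each, and so
exhaust the 2n endpoints. -/
theorem Free.stabBox {A B C D : ℕ} (h : I.Free A B C D) (hc : I.cnt A B C D = n) :
    I.StabBox A B C D := by
  have h1 := Finset.card_union_of_disjoint (Free.disjoint I h)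
  rw [I.card_partner] at h1
  change _ = I.cnt A B C D + _ at h1
  have h2 := Finset.eq_of_subset_of_card_le (Finset.union_subset
    (Finset.filter_subset (I.InBox A B C D) (Finset.range (n + n)))
    (Finset.filter_subset (fun e => I.InBox A B C D (partner n e)) (Finset.range (n + n))))
    (by rw [Finset.card_range, h1]; omega)
  intro e he
  have h3 : e ∈ Finset.range (n + n) := Finset.mem_range.mpr he
  rw [← h2, Finset.mem_union] at h3
  simp only [Finset.mem_filter, Finset.mem_range, he, true_and] at h3
  have := h e he
  tauto

theorem InBox.mono {A B C D A' B' C' D' e : ℕ} (h : I.InBox A B C D e) (hA : A' ≤ A)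
    (hB : B ≤ B') (hC : C' ≤ C) (hD : D ≤ D') : I.InBox A' B' C' D' e := by
  unfold InBox at *; omega

theorem Free.anti {A B C D A' B' C' D' : ℕ} (h : I.Free A' B' C' D') (hA : A' ≤ A)
    (hB : B ≤ B') (hC : C' ≤ C) (hD : D ≤ D') : I.Free A B C D :=
  fun e he hb => h e he ⟨hb.1.mono I hA hB hC hD, hb.2.mono I hA hB hC hD⟩

theorem cnt_mono {A B C D A' B' C' D' : ℕ} (hA : A' ≤ A)
    (hB : B ≤ B') (hC : C' ≤ C) (hD : D ≤ D') : I.cnt A B C D ≤ I.cnt A' B' C' D' :=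
  Finset.card_le_card fun e he => by
    simp only [Finset.mem_filter] at *
    exact ⟨he.1, he.2.mono I hA hB hC hD⟩

/-- The main tool for identifying boxes: if one box contains another and both have the same number
of endpoints, they have the same endpoints. -/
theorem inBox_iff_of_cnt_eq {A B C D A' B' C' D' : ℕ} (hA : A' ≤ A)
    (hB : B ≤ B') (hC : C' ≤ C) (hD : D ≤ D') (h : I.cnt A B C D = I.cnt A' B' C' D') {e : ℕ}
    (he : e < n + n) : I.InBox A' B' C' D' e ↔ I.InBox A B C D e := by
  refine ⟨fun hb => ?_, fun hb => hb.mono I hA hB hC hD⟩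
  have hsub : (Finset.range (n + n)).filter (I.InBox A B C D) ⊆
      (Finset.range (n + n)).filter (I.InBox A' B' C' D') := fun e he => by
    simp only [Finset.mem_filter] at *
    exact ⟨he.1, he.2.mono I hA hB hC hD⟩
  have := Finset.eq_of_subset_of_card_le hsub h.ge
  have hm : e ∈ (Finset.range (n + n)).filter (I.InBox A' B' C' D') := by
    simp [he, hb]
  rw [← this] at hm
  exact (Finset.mem_filter.mp hm).2

/-- The number of endpoints whose ranks are at most `A` and `C`. -/
def prefixCount (A C : ℕ) : ℕ :=
  ((Finset.range (n + n)).filter fun e => I.X e ≤ A ∧ I.Y e ≤ C).card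

theorem prefixCount_zero (C : ℕ) : I.prefixCount 0 C = 0 := by
  unfold prefixCount
  rw [Finset.card_eq_zero, Finset.filter_eq_empty_iff]
  intro e he
  have := I.x_spec e (Finset.mem_range.mp he)
  omega

/-- Exactly one endpoint has x-rank A + 1. This recurrence fills the table of counts row by row. -/
theorem prefixCount_succ {A : ℕ} (hA : A < n + n) (C : ℕ) :
    I.prefixCount (A + 1) C = I.prefixCount A C + if I.Y (I.PX (A + 1)) ≤ C then 1 else 0 := by
  unfold prefixCount
  obtain ⟨h1, h2⟩ := I.px_spec (A + 1) (by omega) hA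
  split_ifs with h
  · have : (Finset.range (n + n)).filter (fun e => I.X e ≤ A + 1 ∧ I.Y e ≤ C) =
        insert (I.PX (A + 1))
          ((Finset.range (n + n)).filter fun e => I.X e ≤ A ∧ I.Y e ≤ C) := by
      ext e
      simp only [Finset.mem_filter, Finset.mem_range, Finset.mem_insert]
      constructor
      · rintro ⟨he, hx, hy⟩
        by_cases hc : I.X e = A + 1
        · left; exact I.x_inj he h1 (hc.trans h2.symm)
        · right; exact ⟨he, by omega, hy⟩
      · rintro (rfl | ⟨he, hx, hy⟩)
        · exact ⟨h1, h2.le, h⟩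
        · exact ⟨he, by omega, hy⟩
    rw [this, Finset.card_insert_of_notMem]
    simp only [Finset.mem_filter, Finset.mem_range]
    omega
  · rw [add_zero]
    congr 1
    ext e
    simp only [Finset.mem_filter, Finset.mem_range]
    constructor
    · rintro ⟨he, hx, hy⟩
      refine ⟨he, ?_, hy⟩
      by_contra hc
      have : I.X e = A + 1 := by omega
      rw [I.x_inj he h1 (this.trans h2.symm)] at hy
      exact h hy
    · rintro ⟨he, hx, hy⟩
      exact ⟨he, by omega, hy⟩

/-- Inclusion and exclusion, free of subtraction. -/
theorem cnt_add {A B C D : ℕ} (hAB : A ≤ B) (hCD : C ≤ D) :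
    I.cnt A B C D + (I.prefixCount A D + I.prefixCount B C) =
      I.prefixCount B D + I.prefixCount A C := by
  simp only [cnt, prefixCount, Finset.card_filter, ← Finset.sum_add_distrib]
  refine Finset.sum_congr rfl fun e _ => ?_
  unfold InBox
  by_cases h1 : I.X e ≤ A <;> by_cases h2 : I.X e ≤ B <;> by_cases h3 : I.Y e ≤ C <;>
    by_cases h4 : I.Y e ≤ D <;> simp only [h1, h2, h3, h4, not_lt.mpr, lt_of_not_ge, and_true,
      and_false, if_true, if_false, not_false_eq_true] <;> omega

theorem cnt_eq_zero {A B C D : ℕ} (h : B ≤ A ∨ D ≤ C) : I.cnt A B C D = 0 := by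
  unfold cnt
  rw [Finset.card_eq_zero, Finset.filter_eq_empty_iff]
  intro e _ hb
  unfold InBox at hb
  omega

theorem prefixCount_le (A C : ℕ) : I.prefixCount A C ≤ n + n := by
  refine (Finset.card_filter_le _ _).trans ?_
  simp

/-! ### Tight boxes -/

/-- A stabbing box whose four sides are determined by endpoints that it contains. -/
structure Tight (x : ℕ × ℕ × ℕ × ℕ) : Prop where
  hA : x.1 < n + n
  hB : 1 ≤ x.2.1 ∧ x.2.1 ≤ n + n
  hC : x.2.2.1 < n + n
  hD : 1 ≤ x.2.2.2 ∧ x.2.2.2 ≤ n + n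
  stab : I.StabBox x.1 x.2.1 x.2.2.1 x.2.2.2
  left : I.InBox x.1 x.2.1 x.2.2.1 x.2.2.2 (I.PX (x.1 + 1))
  right : I.InBox x.1 x.2.1 x.2.2.1 x.2.2.2 (I.PX x.2.1)
  bottom : I.InBox x.1 x.2.1 x.2.2.1 x.2.2.2 (I.PY (x.2.2.1 + 1))
  top : I.InBox x.1 x.2.1 x.2.2.1 x.2.2.2 (I.PY x.2.2.2)

/-- Each side of `x` is witnessed by an endpoint in `x`, and `y` has to contain these four
witnesses. -/
theorem Tight.le_of_imp {x y : ℕ × ℕ × ℕ × ℕ} (hx : I.Tight x)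
    (h : ∀ e < n + n, I.InBox x.1 x.2.1 x.2.2.1 x.2.2.2 e →
      I.InBox y.1 y.2.1 y.2.2.1 y.2.2.2 e) :
    y.1 ≤ x.1 ∧ x.2.1 ≤ y.2.1 ∧ y.2.2.1 ≤ x.2.2.1 ∧ x.2.2.2 ≤ y.2.2.2 := by
  have a1 := I.px_spec (x.1 + 1) (by omega) hx.hA
  have a2 := I.px_spec x.2.1 hx.hB.1 hx.hB.2
  have a3 := I.py_spec (x.2.2.1 + 1) (by omega) hx.hC
  have a4 := I.py_spec x.2.2.2 hx.hD.1 hx.hD.2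
  have b1 := h _ a1.1 hx.left
  have b2 := h _ a2.1 hx.right
  have b3 := h _ a3.1 hx.bottom
  have b4 := h _ a4.1 hx.top
  unfold InBox at b1 b2 b3 b4
  omega

theorem Tight.ext {x y : ℕ × ℕ × ℕ × ℕ} (hx : I.Tight x) (hy : I.Tight y)
    (h : ∀ e < n + n, (I.InBox x.1 x.2.1 x.2.2.1 x.2.2.2 e ↔
      I.InBox y.1 y.2.1 y.2.2.1 y.2.2.2 e)) : x = y := by
  have h1 := hx.le_of_imp I fun e he => (h e he).mp
  have h2 := hy.le_of_imp I fun e he => (h e he).mpr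
  ext <;> omega

/-- Boxes that differ only in the top side are nested, and both contain n endpoints. For a given
left side, a table indexed by right and bottom sides therefore suffices to recognize duplicates. -/
theorem Tight.eq_of_three {x y : ℕ × ℕ × ℕ × ℕ} (hx : I.Tight x) (hy : I.Tight y)
    (h1 : x.1 = y.1) (h2 : x.2.1 = y.2.1) (h3 : x.2.2.1 = y.2.2.1) : x = y := by
  have cx := hx.stab.cnt_eq
  have cy := hy.stab.cnt_eq
  refine hx.ext I hy fun e he => ?_
  rw [h1, h2, h3] at cx ⊢
  rcases le_total x.2.2.2 y.2.2.2 with hle | hle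
  · exact (I.inBox_iff_of_cnt_eq le_rfl le_rfl le_rfl hle (cx.trans cy.symm) he).symm
  · exact I.inBox_iff_of_cnt_eq le_rfl le_rfl le_rfl hle (cy.trans cx.symm) he

/-! ### Inserted segments and free windows -/

/-- The lower rank of the segment of endpoint `e`. -/
def lo (e : ℕ) : ℕ := min (I.Y e) (I.Y (partner n e))

/-- The higher rank of the segment of endpoint `e`. -/
def hi (e : ℕ) : ℕ := max (I.Y e) (I.Y (partner n e))

/-- Endpoint `e` is the right endpoint of a segment between the ranks `A` and `b`. -/
def Ins (A b e : ℕ) : Prop :=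
  e < n + n ∧ A < I.X (partner n e) ∧ I.X (partner n e) < I.X e ∧ I.X e < b

/-- The open window `(u, v)` contains no segment between the ranks `A` and `b`. -/
def WFree (A b u v : ℕ) : Prop := ∀ e, I.Ins A b e → ¬ (u < I.lo e ∧ I.hi e < v)

theorem lo_spec {e : ℕ} (he : e < n + n) : 1 ≤ I.lo e ∧ I.lo e < I.hi e ∧ I.hi e ≤ n + n := by
  have h1 := I.y_spec e he
  have h2 := I.y_spec _ (partner_lt he)
  have h3 : I.Y e ≠ I.Y (partner n e) := fun h =>
    partner_ne he (I.y_inj he (partner_lt he) h).symm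
  unfold lo hi
  omega

/-- All y-ranks are distinct, so a lower end identifies its segment; this lets lower ends serve as
names of windows. -/
theorem lo_inj {e f : ℕ} (he : e < n + n) (hf : f < n + n) (h : I.lo e = I.lo f) :
    f = e ∨ f = partner n e := by
  unfold lo at h
  rcases min_choice (I.Y e) (I.Y (partner n e)) with h1 | h1 <;>
  rcases min_choice (I.Y f) (I.Y (partner n f)) with h2 | h2 <;> rw [h1, h2] at h
  · left; exact (I.y_inj he hf h).symm
  · right
    rw [I.y_inj he (partner_lt hf) h, partner_partner hf]
  · right; exact (I.y_inj (partner_lt he) hf h).symm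
  · left
    have := I.y_inj (partner_lt he) (partner_lt hf) h
    rw [← partner_partner he, this, partner_partner hf]

theorem lo_partner {e : ℕ} (he : e < n + n) : I.lo (partner n e) = I.lo e := by
  unfold lo; rw [partner_partner he, min_comm]

theorem hi_partner {e : ℕ} (he : e < n + n) : I.hi (partner n e) = I.hi e := by
  unfold hi; rw [partner_partner he, max_comm]

theorem hi_eq_of_lo_eq {e f : ℕ} (he : e < n + n) (hf : f < n + n) (h : I.lo e = I.lo f) :
    I.hi e = I.hi f := by
  rcases I.lo_inj he hf h with rfl | rfl
  · rfl
  · rw [I.hi_partner he]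

theorem hi_ne {e f : ℕ} (he : e < n + n) (hf : f < n + n) (h : I.hi e = I.hi f) :
    f = e ∨ f = partner n e := by
  unfold hi at h
  rcases max_choice (I.Y e) (I.Y (partner n e)) with h1 | h1 <;>
  rcases max_choice (I.Y f) (I.Y (partner n f)) with h2 | h2 <;> rw [h1, h2] at h
  · left; exact (I.y_inj he hf h).symm
  · right
    rw [I.y_inj he (partner_lt hf) h, partner_partner hf]
  · right; exact (I.y_inj (partner_lt he) hf h).symm
  · left
    have := I.y_inj (partner_lt he) (partner_lt hf) h
    rw [← partner_partner he, this, partner_partner hf]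

/-- Windows are open and boxes are half-open, so the right and upper bounds shift by one. Each
segment is represented in `Ins` by its right endpoint, whence the case distinction. -/
theorem wfree_iff_free (A b u v : ℕ) : I.WFree A b u v ↔ I.Free A (b - 1) u (v - 1) := by
  constructor
  · intro h e he hb
    have h1 := I.x_spec e he
    have h2 := I.x_spec _ (partner_lt he)
    have h3 : I.X e ≠ I.X (partner n e) := fun h =>
      partner_ne he (I.x_inj he (partner_lt he) h).symm
    unfold InBox at hb
    rcases lt_or_gt_of_ne h3 with h4 | h4
    · refine h (partner n e) ⟨partner_lt he, ?_⟩ ⟨?_, ?_⟩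
      · rw [partner_partner he]; omega
      · rw [I.lo_partner he]; unfold lo; omega
      · rw [I.hi_partner he]; unfold hi; omega
    · exact h e ⟨he, by omega⟩ ⟨by unfold lo; omega, by unfold hi; omega⟩
  · rintro h e ⟨he, hi⟩ hb
    unfold lo Ranked.hi at hb
    exact h e he (by unfold InBox; omega)

/-- `f` is the highest lower end of the segments between `A` and `b` whose upper end is
below `h`. -/
def FSpec (A b h f : ℕ) : Prop :=
  (∀ t, I.Ins A b t → I.hi t < h → I.lo t ≤ f) ∧
    (f = 0 ∨ ∃ t, I.Ins A b t ∧ I.hi t < h ∧ I.lo t = f)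

/-- The entry for a window with lower end `u` in the table of upper ends. -/
structure IsUpper (HW : ℕ → ℕ) : Prop where
  last : HW (n + n + 1) = n + n + 1
  lo : ∀ e < n + n, HW (I.lo e) = I.hi e

/-- The finite set `K` with the successor function `nxt` represents all maximal windows that
contain no segment between `A` and `b`: the windows `(u, HW (nxt u))` for `u ∈ K`. -/
structure Chain (HW : ℕ → ℕ) (A b : ℕ) (nxt : ℕ → ℕ) (K : Finset ℕ) : Prop where
  zero_mem : 0 ∈ K
  le : ∀ u ∈ K, u ≤ n + n
  lt_nxt : ∀ u ∈ K, u < nxt u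
  nxt_mem : ∀ u ∈ K, nxt u ∈ K ∨ nxt u = n + n + 1
  gap : ∀ u ∈ K, ∀ v ∈ K, u < v → nxt u ≤ v
  src : ∀ u ∈ K, u ≠ 0 → ∃ e, I.Ins A b e ∧ I.lo e = u
  mono : ∀ u ∈ K, ∀ v ∈ K, u < v → HW (nxt u) < HW (nxt v)
  free : ∀ u ∈ K, I.WFree A b u (HW (nxt u))
  cover : ∀ u v, u < v → v ≤ n + n + 1 → I.WFree A b u v → ∃ w ∈ K, w ≤ u ∧ v ≤ HW (nxt w)

theorem Ins.mono {A b b' e : ℕ} (h : I.Ins A b e) (hb : b ≤ b') : I.Ins A b' e :=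
  ⟨h.1, h.2.1, h.2.2.1, h.2.2.2.trans_le hb⟩

theorem WFree.anti {A b u v u' v' : ℕ} (h : I.WFree A b u v) (hu : u ≤ u') (hv : v' ≤ v) :
    I.WFree A b u' v' := fun e he hc => h e he ⟨by omega, by omega⟩

/-- A segment between A and b needs two ranks strictly between them, so there is none, and the
single window is everything. -/
theorem Chain.init {HW : ℕ → ℕ} (hHW : I.IsUpper HW) {A b : ℕ} (hb : b ≤ A + 2)
    {nxt : ℕ → ℕ} (h0 : nxt 0 = n + n + 1) : I.Chain HW A b nxt {0} := by
  have hins : ∀ e, ¬ I.Ins A b e := fun e h => by unfold Ins at h; omega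
  constructor <;> simp only [Finset.mem_singleton, forall_eq]
  · omega
  · omega
  · right; exact h0
  · omega
  · omega
  · omega
  · exact fun e he => absurd he (hins e)
  · intro u v huv hv _
    exact ⟨0, rfl, by omega, by rw [h0, hHW.last]; exact hv⟩

theorem ins_succ_iff {A b t : ℕ} :
    I.Ins A (b + 1) t ↔ I.Ins A b t ∨ (I.Ins A (b + 1) t ∧ I.X t = b) := by
  unfold Ins
  constructor
  · rintro ⟨h1, h2, h3, h4⟩
    by_cases h : I.X t = b
    · exact Or.inr ⟨⟨h1, h2, h3, h4⟩, h⟩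
    · exact Or.inl ⟨h1, h2, h3, by omega⟩
  · rintro (⟨h1, h2, h3, h4⟩ | ⟨h, _⟩)
    · exact ⟨h1, h2, h3, by omega⟩
    · exact h

theorem Chain.congr {HW : ℕ → ℕ} {A b b' : ℕ} {nxt : ℕ → ℕ} {K : Finset ℕ}
    (h : I.Chain HW A b nxt K) (hins : ∀ t, I.Ins A b' t ↔ I.Ins A b t) :
    I.Chain HW A b' nxt K := by
  have hw : ∀ u v, I.WFree A b' u v ↔ I.WFree A b u v := fun u v => by
    unfold WFree; simp only [hins]
  constructor
  · exact h.zero_mem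
  · exact h.le
  · exact h.lt_nxt
  · exact h.nxt_mem
  · exact h.gap
  · simp only [hins]; exact h.src
  · exact h.mono
  · simp only [hw]; exact h.free
  · simp only [hw]; exact h.cover

/-! ### Insertion of one segment into the chain of maximal free windows. -/

section Insert

variable {HW : ℕ → ℕ} {A b : ℕ} {nxt : ℕ → ℕ} {K : Finset ℕ} {e f : ℕ}

theorem ins_insert (he : I.Ins A (b + 1) e) (hb : I.X e = b) (t : ℕ) :
    I.Ins A (b + 1) t ↔ I.Ins A b t ∨ t = e := by
  rw [ins_succ_iff]
  constructor
  · rintro (h | ⟨h1, h2⟩)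
    · exact Or.inl h
    · exact Or.inr (I.x_inj h1.1 he.1 (h2.trans hb.symm))
  · rintro (h | rfl)
    · exact Or.inl h
    · exact Or.inr ⟨he, hb⟩

theorem wfree_insert (he : I.Ins A (b + 1) e) (hb : I.X e = b) (u v : ℕ) :
    I.WFree A (b + 1) u v ↔ I.WFree A b u v ∧ ¬ (u < I.lo e ∧ I.hi e < v) := by
  unfold WFree
  simp only [I.ins_insert he hb]
  constructor
  · exact fun h => ⟨fun t ht => h t (Or.inl ht), h e (Or.inr rfl)⟩
  · rintro ⟨h1, h2⟩ t (ht | rfl)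
    · exact h1 t ht
    · exact h2

theorem ins_ne (hb : I.X e = b) {t : ℕ} (he : I.Ins A (b + 1) e) (ht : I.Ins A b t) :
    t ≠ e ∧ t ≠ partner n e := by
  unfold Ins at *
  constructor
  · rintro rfl; omega
  · rintro rfl
    rw [partner_partner he.1] at ht
    omega

theorem FSpec.ne_lo (he : I.Ins A (b + 1) e) (hb : I.X e = b) (hf : I.FSpec A b (I.hi e) f) :
    f ≠ I.lo e := by
  rcases hf.2 with rfl | ⟨t, ht, _, rfl⟩
  · have := I.lo_spec he.1; omega
  · intro h
    have h1 := I.ins_ne hb he ht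
    rcases I.lo_inj he.1 ht.1 h.symm with h2 | h2
    · exact h1.1 h2
    · exact h1.2 h2

/-- The segment `t` that defines `f` has its y-interval inside that of `e`, so every window that
avoids `t` avoids `e` already. -/
theorem Chain.insert_of_lt (h : I.Chain HW A b nxt K) (he : I.Ins A (b + 1) e) (hb : I.X e = b)
    (hf : I.FSpec A b (I.hi e) f) (hlt : I.lo e < f) : I.Chain HW A (b + 1) nxt K := by
  obtain ⟨t, ht, ht1, rfl⟩ := hf.2.resolve_left (by omega)
  have hw : ∀ u v, I.WFree A (b + 1) u v ↔ I.WFree A b u v := fun u v => by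
    rw [I.wfree_insert he hb]
    refine ⟨fun h => h.1, fun h => ⟨h, fun hc => h t ht ⟨by omega, by omega⟩⟩⟩
  constructor
  · exact h.zero_mem
  · exact h.le
  · exact h.lt_nxt
  · exact h.nxt_mem
  · exact h.gap
  · intro u hu h0
    obtain ⟨t, ht, hl⟩ := h.src u hu h0
    exact ⟨t, ht.mono I (by omega), hl⟩
  · exact h.mono
  · simp only [hw]; exact h.free
  · simp only [hw]; exact h.cover

theorem FSpec.wfree (hf : I.FSpec A b (I.hi e) f) : I.WFree A b f (I.hi e) := by
  intro t ht hc
  have := hf.1 t ht hc.2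
  omega

/-- The window (f, hi e) is free, hence part of a maximal one; a maximal window starting below `f`
would contain the segment that defines `f`. -/
theorem Chain.mem_of_fspec (h : I.Chain HW A b nxt K) (he : I.Ins A (b + 1) e)
    (hf : I.FSpec A b (I.hi e) f) (hlt : f < I.lo e) : f ∈ K ∧ I.hi e ≤ HW (nxt f) := by
  have hs := I.lo_spec he.1
  obtain ⟨w, hw, h1, h2⟩ := h.cover f (I.hi e) (by omega) (by omega) (hf.wfree I)
  have : w = f := by
    by_contra hne
    rcases hf.2 with rfl | ⟨t, ht, ht1, rfl⟩
    · omega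
    · exact h.free w hw t ht ⟨by omega, by omega⟩
  exact this ▸ ⟨hw, h2⟩

/-- Starting below `f`, the window would contain the segment that defines `f`. So every window
destroyed by `e` starts at `f` or later. -/
theorem FSpec.le_of_window (h : I.Chain HW A b nxt K) (hf : I.FSpec A b (I.hi e) f) {u : ℕ}
    (hu : u ∈ K) (h2 : I.hi e < HW (nxt u)) : f ≤ u := by
  by_contra hne
  rcases hf.2 with rfl | ⟨t, ht, ht1, rfl⟩
  · omega
  · exact h.free u hu t ht ⟨by omega, by omega⟩

/-- The destroyed windows are those with lower end in [f, lo e), a run of the list followed by `z`.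
They are replaced by (f, hi e) and (lo e, HW z). As the upper end of a window is read off its
successor, the two link updates f → lo e → z produce both new windows. -/
theorem Chain.insert_segment (hHW : I.IsUpper HW) (h : I.Chain HW A b nxt K)
    (he : I.Ins A (b + 1) e) (hb : I.X e = b) (hf : I.FSpec A b (I.hi e) f) (hlt : f < I.lo e)
    {z : ℕ} (hz : z ∈ K ∨ z = n + n + 1) (hlz : I.lo e < z)
    (hgap : ∀ u ∈ K, f ≤ u → u < z → u < I.lo e) :
    I.Chain HW A (b + 1) (Function.update (Function.update nxt f (I.lo e)) (I.lo e) z)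
      (insert (I.lo e) (K.filter fun u => ¬ (f < u ∧ u < I.lo e))) := by
  have hs := I.lo_spec he.1
  obtain ⟨hfK, hfh⟩ := h.mem_of_fspec I he hf hlt
  have hHWlo : HW (I.lo e) = I.hi e := hHW.lo e he.1
  set nxt' := Function.update (Function.update nxt f (I.lo e)) (I.lo e) z with hn
  have n1 : nxt' (I.lo e) = z := by simp [hn]
  have n2 : nxt' f = I.lo e := by simp [hn, hlt.ne]
  have n3 : ∀ u, u ≠ f → u ≠ I.lo e → nxt' u = nxt u := fun u h1 h2 => by
    simp [hn, h1, h2]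
  have hnK : I.lo e ∉ K := by
    intro hk
    obtain ⟨t, ht, htl⟩ := h.src _ hk (by omega)
    have h1 := I.ins_ne hb he ht
    rcases I.lo_inj he.1 ht.1 htl.symm with h2 | h2
    · exact h1.1 h2
    · exact h1.2 h2
  -- the last removed window
  have hlast : ∃ w ∈ K, f ≤ w ∧ w < I.lo e ∧ nxt w = z := by
    set T := K.filter fun u => f ≤ u ∧ u < I.lo e
    have hT : T.Nonempty := ⟨f, by simp [T, hfK, hlt]⟩
    have hm := T.max'_mem hT
    set w := T.max' hT
    simp only [T, Finset.mem_filter] at hm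
    refine ⟨w, hm.1, hm.2.1, hm.2.2, ?_⟩
    have hwz : w < z := by omega
    have hle : nxt w ≤ z := by
      rcases hz with hz | rfl
      · exact h.gap w hm.1 z hz hwz
      · rcases h.nxt_mem w hm.1 with h1 | h1
        · have := h.le _ h1; omega
        · omega
    by_contra hne
    rcases h.nxt_mem w hm.1 with h1 | h1
    · have hwn := h.lt_nxt w hm.1
      have h2 := hgap _ h1 (by omega) (by omega)
      have : nxt w ∈ T := by simp only [T, Finset.mem_filter]; exact ⟨h1, by omega, h2⟩
      have := T.le_max' _ this
      omega
    · rcases hz with hz | hz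
      · have := h.le _ hz; omega
      · omega
  obtain ⟨w, hwK, hfw, hwl, hwz⟩ := hlast
  -- The lower ends after the insertion: the new one, `f`, and the old ones before `f` and from `z`
  -- on.
  have memK : ∀ u, u ∈ insert (I.lo e) (K.filter fun u => ¬ (f < u ∧ u < I.lo e)) ↔
      u = I.lo e ∨ u = f ∨ (u ∈ K ∧ u < f) ∨ (u ∈ K ∧ z ≤ u) := by
    intro u
    simp only [Finset.mem_insert, Finset.mem_filter]
    constructor
    · rintro (h1 | ⟨h1, h2⟩)
      · exact Or.inl h1
      · by_cases h3 : u = f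
        · exact Or.inr (Or.inl h3)
        · by_cases h4 : u < f
          · exact Or.inr (Or.inr (Or.inl ⟨h1, h4⟩))
          · refine Or.inr (Or.inr (Or.inr ⟨h1, ?_⟩))
            by_contra h5
            have := hgap u h1 (by omega) (by omega)
            omega
    · rintro (h1 | rfl | h1 | h1)
      · exact Or.inl h1
      · exact Or.inr ⟨hfK, by omega⟩
      · exact Or.inr ⟨h1.1, by omega⟩
      · exact Or.inr ⟨h1.1, by omega⟩
  -- The window at `f` reaches at least to hi e, and strictly beyond it since upper ends of
  -- different segments differ; later windows reach higher still.
  have hzh : I.hi e < HW z := by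
    have h1 : HW (nxt f) ≤ HW z := by
      rw [← hwz]
      rcases hfw.eq_or_lt with h1 | h1
      · rw [h1]
      · exact (h.mono f hfK w hwK h1).le
    have h2 : I.hi e ≠ HW (nxt f) := by
      intro hc
      rcases h.nxt_mem f hfK with h3 | h3
      · obtain ⟨t, ht, htl⟩ := h.src _ h3 (by have := h.lt_nxt f hfK; omega)
        rw [← htl, hHW.lo t ht.1] at hc
        have h4 := I.ins_ne hb he ht
        rcases I.hi_ne he.1 ht.1 hc with h5 | h5
        · exact h4.1 h5
        · exact h4.2 h5
      · rw [h3, hHW.last] at hc; omega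
    omega
  -- A window starting before `f` cannot contain the segment with lower end `f`, whose upper end is
  -- below hi e.
  have hlow : ∀ u ∈ K, u < f → HW (nxt u) < I.hi e := by
    intro u hu huf
    rcases hf.2 with rfl | ⟨t, ht, ht1, ht2⟩
    · omega
    · have h1 := h.gap u hu f hfK huf
      rcases h1.eq_or_lt with h2 | h2
      · rw [h2, ← ht2, hHW.lo t ht.1]; exact ht1
      · rcases h.nxt_mem u hu with h3 | h3
        · by_contra hc
          exact h.free u hu t ht ⟨by omega, by omega⟩
        · have := h.le f hfK; omega
  constructor
  · rw [memK]
    rcases Nat.eq_zero_or_pos f with h0 | h0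
    · exact Or.inr (Or.inl h0.symm)
    · exact Or.inr (Or.inr (Or.inl ⟨h.zero_mem, h0⟩))
  · intro u hu
    rw [memK] at hu
    rcases hu with rfl | rfl | hu | hu
    · omega
    · omega
    · exact h.le u hu.1
    · exact h.le u hu.1
  · intro u hu
    rw [memK] at hu
    rcases hu with rfl | rfl | hu | hu
    · omega
    · omega
    · rw [n3 u (by omega) (by omega)]; exact h.lt_nxt u hu.1
    · rw [n3 u (by omega) (by omega)]; exact h.lt_nxt u hu.1
  · intro u hu
    rw [memK] at hu
    rcases hu with rfl | rfl | hu | hu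
    · rw [n1, memK]
      rcases hz with hz | hz
      · exact Or.inl (Or.inr (Or.inr (Or.inr ⟨hz, le_rfl⟩)))
      · exact Or.inr hz
    · rw [n2, memK]; exact Or.inl (Or.inl rfl)
    · rw [n3 u (by omega) (by omega), memK]
      left; right
      have h1 := h.gap u hu.1 f hfK hu.2
      rcases h1.eq_or_lt with h2 | h2
      · exact Or.inl h2
      · rcases h.nxt_mem u hu.1 with h3 | h3
        · exact Or.inr (Or.inl ⟨h3, h2⟩)
        · have := h.le f hfK; omega
    · rw [n3 u (by omega) (by omega), memK]
      have := h.lt_nxt u hu.1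
      rcases h.nxt_mem u hu.1 with h3 | h3
      · exact Or.inl (Or.inr (Or.inr (Or.inr ⟨h3, by omega⟩)))
      · exact Or.inr h3
  · intro u hu v hv huv
    rw [memK] at hu hv
    rcases hu with rfl | rfl | hu | hu <;> rcases hv with rfl | rfl | hv | hv <;>
      try rw [n1]
    all_goals try rw [n2]
    all_goals try omega
    · rw [n3 u (by omega) (by omega)]; have := h.gap u hu.1 f hfK hu.2; omega
    · rw [n3 u (by omega) (by omega)]; have := h.gap u hu.1 v hfK huv; omega
    · rw [n3 u (by omega) (by omega)]; exact h.gap u hu.1 v hv.1 huv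
    · rw [n3 u (by omega) (by omega)]; exact h.gap u hu.1 v hv.1 huv
    · rw [n3 u (by omega) (by omega)]; exact h.gap u hu.1 v hv.1 huv
  · intro u hu h0
    rw [memK] at hu
    have key : u ∈ K → ∃ e', I.Ins A (b + 1) e' ∧ I.lo e' = u := fun hu => by
      obtain ⟨t, ht, hl⟩ := h.src u hu h0
      exact ⟨t, ht.mono I (by omega), hl⟩
    rcases hu with rfl | rfl | hu | hu
    · exact ⟨e, he, rfl⟩
    · exact key hfK
    · exact key hu.1
    · exact key hu.1
  · intro u hu v hv huv
    have hge : ∀ x ∈ K, z ≤ x → HW z < HW (nxt x) := fun x hx hzx => by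
      rw [← hwz]; exact h.mono w hwK x hx (by omega)
    rw [memK] at hu hv
    rcases hu with rfl | rfl | hu | hu <;> rcases hv with rfl | rfl | hv | hv <;>
      first
        | omega
        | skip
    · rw [n1, n3 v (by omega) (by omega)]; exact hge v hv.1 hv.2
    · rw [n2, n1, hHWlo]; exact hzh
    · rw [n2, n3 v (by omega) (by omega), hHWlo]; exact hzh.trans (hge v hv.1 hv.2)
    · rw [n1, n3 u (by omega) (by omega)]; exact (hlow u hu.1 hu.2).trans hzh
    · rw [n2, n3 u (by omega) (by omega), hHWlo]; exact hlow u hu.1 hu.2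
    · rw [n3 u (by omega) (by omega), n3 v (by omega) (by omega)]; exact h.mono u hu.1 v hv.1 huv
    · rw [n3 u (by omega) (by omega), n3 v (by omega) (by omega)]; exact h.mono u hu.1 v hv.1 huv
    · rw [n3 u (by omega) (by omega), n3 v (by omega) (by omega)]; exact h.mono u hu.1 v hv.1 huv
  · intro u hu
    rw [memK] at hu
    rw [I.wfree_insert he hb]
    rcases hu with rfl | rfl | hu | hu
    · rw [n1]
      refine ⟨?_, by omega⟩
      rw [← hwz]
      exact (h.free w hwK).anti I hwl.le le_rfl
    · rw [n2, hHWlo]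
      exact ⟨hf.wfree I, by omega⟩
    · rw [n3 u (by omega) (by omega)]
      have := hlow u hu.1 hu.2
      exact ⟨h.free u hu.1, by omega⟩
    · rw [n3 u (by omega) (by omega)]
      exact ⟨h.free u hu.1, by omega⟩
  · intro u v huv hv hfree
    rw [I.wfree_insert he hb] at hfree
    obtain ⟨x, hx, hxu, hxv⟩ := h.cover u v huv hv hfree.1
    -- The old window at `x` survives unless f ≤ x < z. In that case (u, v) does not contain the new
    -- segment, so either v ≤ hi e and the window at `f` covers it, or lo e ≤ u and the window at lo
    -- e does.
    by_cases hxf : x < f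
    · exact ⟨x, (memK x).mpr (Or.inr (Or.inr (Or.inl ⟨hx, hxf⟩))), hxu, by
        rw [n3 x (by omega) (by omega)]; exact hxv⟩
    · by_cases hxz : z ≤ x
      · exact ⟨x, (memK x).mpr (Or.inr (Or.inr (Or.inr ⟨hx, hxz⟩))), hxu, by
          rw [n3 x (by omega) (by omega)]; exact hxv⟩
      · by_cases hvh : v ≤ I.hi e
        · exact ⟨f, (memK f).mpr (Or.inr (Or.inl rfl)), by omega, by rw [n2, hHWlo]; exact hvh⟩
        · refine ⟨I.lo e, (memK _).mpr (Or.inl rfl), by omega, ?_⟩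
          rw [n1]
          have hxl := hgap x hx (by omega) (by omega)
          have hxw : HW (nxt x) ≤ HW z := by
            have hle : x ≤ w := by
              by_contra hc
              have := h.gap w hwK x hx (by omega)
              omega
            rw [← hwz]
            rcases hle.eq_or_lt with h1 | h1
            · rw [h1]
            · exact (h.mono x hx w hwK h1).le
          omega

end Insert

end Ranked

/-! ### Ranks of real keys -/

section Rank

variable (v : ℕ → ℝ) (N : ℕ)

/-- The number of keys that are smaller than key `e`. -/
noncomputable def countLt (e : ℕ) : ℕ := by
  classical exact ((Finset.range N).filter fun j => v j < v e).card

/-- The number of keys that are not larger than key `e`. -/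
noncomputable def countLe (e : ℕ) : ℕ := by
  classical exact ((Finset.range N).filter fun j => ¬ v e < v j).card

/-- The rank of key `e`, from `1` to `N`; equal keys are ordered by their numbers. -/
noncomputable def rank (e : ℕ) : ℕ := by
  classical exact ((Finset.range N).filter fun j => v j < v e ∨ (¬ v e < v j ∧ j ≤ e)).card

variable {v N}

/-- The set counted for `e` is contained in the set counted for `f`, which in addition contains `f`
itself. -/
theorem rank_lt {e f : ℕ} (hf : f < N) (h : v e < v f ∨ (v e = v f ∧ e < f)) :
    rank v N e < rank v N f := by
  classical
  refine Finset.card_lt_card (Finset.ssubset_iff_subset_ne.mpr ⟨?_, ?_⟩)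
  · intro j
    simp only [Finset.mem_filter, Finset.mem_range, not_lt]
    rintro ⟨hj, h1⟩
    refine ⟨hj, ?_⟩
    rcases h with h | h <;> rcases h1 with h1 | h1
    · exact Or.inl (h1.trans h)
    · exact Or.inl (h1.1.trans_lt h)
    · exact Or.inl (h1.trans_eq h.1)
    · exact Or.inr ⟨h1.1.trans_eq h.1, by omega⟩
  · intro heq
    have hm : f ∈ (Finset.range N).filter fun j => v j < v f ∨ (¬ v f < v j ∧ j ≤ f) := by
      simp [hf]
    rw [← heq] at hm
    simp only [Finset.mem_filter, not_lt] at hm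
    rcases h with h | h <;> rcases hm.2 with h1 | h1
    · exact lt_asymm h h1
    · exact absurd h1.1 (not_le.mpr h)
    · exact h1.ne h.1.symm
    · omega

theorem rank_pos {e : ℕ} (he : e < N) : 1 ≤ rank v N e := by
  classical
  refine Finset.card_pos.mpr ⟨e, ?_⟩
  simp [he]

theorem rank_le (e : ℕ) : rank v N e ≤ N := by
  classical
  exact (Finset.card_filter_le _ _).trans (by simp)

theorem rank_inj {e f : ℕ} (he : e < N) (hf : f < N) (h : rank v N e = rank v N f) : e = f := by
  by_contra hne
  rcases lt_trichotomy (v e) (v f) with h1 | h1 | h1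
  · exact (rank_lt hf (Or.inl h1)).ne h
  · rcases lt_or_gt_of_ne hne with h2 | h2
    · exact (rank_lt hf (Or.inr ⟨h1, h2⟩)).ne h
    · exact (rank_lt he (Or.inr ⟨h1.symm, h2⟩)).ne' h
  · exact (rank_lt he (Or.inl h1)).ne' h

theorem exists_rank_eq {r : ℕ} (h1 : 1 ≤ r) (h2 : r ≤ N) : ∃ e < N, rank v N e = r := by
  have := Finset.surjOn_of_injOn_of_card_le (s := Finset.range N) (t := Finset.Icc 1 N) (rank v N)
    (fun e he => by
      simp only [Finset.coe_range, Set.mem_Iio, Finset.coe_Icc, Set.mem_Icc] at *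
      exact ⟨rank_pos he, rank_le e⟩)
    (fun e he f hf h => rank_inj (by simpa using he) (by simpa using hf) h) (by simp)
  obtain ⟨e, he, h⟩ := this (by simpa using ⟨h1, h2⟩ : r ∈ (Finset.Icc 1 N : Set ℕ))
  exact ⟨e, by simpa using he, h⟩

theorem le_of_rank_le {e f : ℕ} (he : e < N) (h : rank v N e ≤ rank v N f) : v e ≤ v f := by
  by_contra hc
  exact absurd (rank_lt he (Or.inl (not_le.mp hc))) (not_lt.mpr h)

/-- Ties occupy consecutive ranks. The bounds `countLe` and `countLt` (next lemma but for the lower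
side) round a side of a box outwards over all ties, which turns closed intervals of coordinates into
half-open intervals of ranks. -/
theorem rank_le_countLe {e f : ℕ} (he : e < N) : rank v N e ≤ countLe v N f ↔ v e ≤ v f := by
  classical
  constructor
  · intro h
    by_contra hc
    refine absurd h (not_le.mpr (Finset.card_lt_card (Finset.ssubset_iff_subset_ne.mpr ⟨?_, ?_⟩)))
    · intro j
      simp only [Finset.mem_filter, not_lt]
      exact fun hj => ⟨hj.1, Or.inl (by linarith [hj.2])⟩
    · intro heq
      have hm : e ∈ (Finset.range N).filter fun j => v j < v e ∨ (¬ v e < v j ∧ j ≤ e) := by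
        simp [he]
      rw [← heq] at hm
      simp only [Finset.mem_filter, not_lt] at hm
      exact hc hm.2
  · intro h
    refine Finset.card_le_card fun j => ?_
    simp only [Finset.mem_filter, not_lt]
    rintro ⟨hj, h1 | h1⟩
    · exact ⟨hj, h1.le.trans h⟩
    · exact ⟨hj, h1.1.trans h⟩

theorem countLt_lt_rank {e f : ℕ} (he : e < N) : countLt v N f < rank v N e ↔ v f ≤ v e := by
  classical
  constructor
  · intro h
    by_contra hc
    refine absurd h (not_lt.mpr (Finset.card_le_card ?_))
    intro j
    simp only [Finset.mem_filter, not_lt]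
    rintro ⟨hj, h1 | h1⟩
    · exact ⟨hj, by linarith⟩
    · exact ⟨hj, by linarith [h1.1]⟩
  · intro h
    refine Finset.card_lt_card (Finset.ssubset_iff_subset_ne.mpr ⟨?_, ?_⟩)
    · intro j
      simp only [Finset.mem_filter, not_lt]
      exact fun hj => ⟨hj.1, Or.inl (by linarith [hj.2])⟩
    · intro heq
      have hm : e ∈ (Finset.range N).filter fun j => v j < v e ∨ (¬ v e < v j ∧ j ≤ e) := by
        simp [he]
      rw [← heq] at hm
      simp only [Finset.mem_filter] at hm
      linarith [hm.2]

variable (v N) in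
/-- The key of a given rank. -/
noncomputable def unrank (r : ℕ) : ℕ := by
  classical exact if h : ∃ e < N, rank v N e = r then h.choose else 0

theorem unrank_spec {r : ℕ} (h1 : 1 ≤ r) (h2 : r ≤ N) :
    unrank v N r < N ∧ rank v N (unrank v N r) = r := by
  have h := exists_rank_eq (v := v) h1 h2
  rw [unrank, dif_pos h]
  exact h.choose_spec

theorem unrank_rank {e : ℕ} (he : e < N) : unrank v N (rank v N e) = e :=
  have h := unrank_spec (v := v) (rank_pos he) (rank_le e)
  rank_inj h.1 he h.2

end Rank

/-! ### Segments in rank space -/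

section OfSegments

variable {n : ℕ} (S : Fin n → Segment)

/-- The `x`-coordinate of endpoint number `e`. -/
noncomputable def xkey (e : ℕ) : ℝ := (pos S e).1

/-- The `y`-coordinate of endpoint number `e`. -/
noncomputable def ykey (e : ℕ) : ℝ := (pos S e).2

/-- The endpoints of `S`, sorted. -/
noncomputable def ranked : Ranked n where
  X := rank (xkey S) (n + n)
  Y := rank (ykey S) (n + n)
  PX := unrank (xkey S) (n + n)
  PY := unrank (ykey S) (n + n)
  x_spec e he := ⟨rank_pos he, rank_le e, unrank_rank he⟩
  y_spec e he := ⟨rank_pos he, rank_le e, unrank_rank he⟩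
  px_spec _ h1 h2 := unrank_spec h1 h2
  py_spec _ h1 h2 := unrank_spec h1 h2

/-- The endpoints on the sides of a tight box. -/
def Ranked.quad (I : Ranked n) (x : ℕ × ℕ × ℕ × ℕ) : ℕ × ℕ × ℕ × ℕ :=
  (I.PX (x.1 + 1), I.PX x.2.1, I.PY (x.2.2.1 + 1), I.PY x.2.2.2)

/-- The number of endpoints in the rectangle spanned by four endpoints. -/
noncomputable def spanCount (q : ℕ × ℕ × ℕ × ℕ) : ℕ :=
  (ranked S).cnt (countLt (xkey S) (n + n) q.1) (countLe (xkey S) (n + n) q.2.1)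
    (countLt (ykey S) (n + n) q.2.2.1) (countLe (ykey S) (n + n) q.2.2.2)

/-- A tight box that corresponds to a rectangle of the plane. -/
def Good (x : ℕ × ℕ × ℕ × ℕ) : Prop :=
  (ranked S).Tight x ∧ spanCount S ((ranked S).quad x) = n

variable {S}

theorem mem_spanBox_iff_inBox {q : ℕ × ℕ × ℕ × ℕ} {e : ℕ} (he : e < n + n) :
    pos S e ∈ spanBox S q ↔ (ranked S).InBox (countLt (xkey S) (n + n) q.1)
      (countLe (xkey S) (n + n) q.2.1) (countLt (ykey S) (n + n) q.2.2.1)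
      (countLe (ykey S) (n + n) q.2.2.2) e := by
  rw [mem_spanBox]
  unfold Ranked.InBox ranked
  simp only [countLt_lt_rank he, rank_le_countLe he]
  rfl

/-- Rounding outwards over ties can only enlarge the tight box; as the enlarged box still has n
endpoints, nothing was added. -/
theorem Good.mem_spanBox {x : ℕ × ℕ × ℕ × ℕ} (h : Good S x) {e : ℕ} (he : e < n + n) :
    pos S e ∈ spanBox S ((ranked S).quad x) ↔
      (ranked S).InBox x.1 x.2.1 x.2.2.1 x.2.2.2 e := by
  rw [mem_spanBox_iff_inBox he]
  obtain ⟨ht, hc⟩ := h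
  have a1 := (ranked S).px_spec (x.1 + 1) (by omega) ht.hA
  have a2 := (ranked S).px_spec x.2.1 ht.hB.1 ht.hB.2
  have a3 := (ranked S).py_spec (x.2.2.1 + 1) (by omega) ht.hC
  have a4 := (ranked S).py_spec x.2.2.2 ht.hD.1 ht.hD.2
  refine (ranked S).inBox_iff_of_cnt_eq ?_ ?_ ?_ ?_ (ht.stab.cnt_eq.trans hc.symm) he
  · have := (countLt_lt_rank (v := xkey S) a1.1).mpr le_rfl
    change _ < (ranked S).X _ at this
    rw [a1.2] at this
    exact Nat.lt_succ_iff.mp this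
  · have := (rank_le_countLe (v := xkey S) a2.1).mpr le_rfl
    change (ranked S).X _ ≤ _ at this
    rwa [a2.2] at this
  · have := (countLt_lt_rank (v := ykey S) a3.1).mpr le_rfl
    change _ < (ranked S).Y _ at this
    rw [a3.2] at this
    exact Nat.lt_succ_iff.mp this
  · have := (rank_le_countLe (v := ykey S) a4.1).mpr le_rfl
    change (ranked S).Y _ ≤ _ at this
    rwa [a4.2] at this

theorem Good.spans {x : ℕ × ℕ × ℕ × ℕ} (h : Good S x) : Spans S ((ranked S).quad x) := by
  have ht := h.1
  have a1 := (ranked S).px_spec (x.1 + 1) (by omega) ht.hA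
  have a2 := (ranked S).px_spec x.2.1 ht.hB.1 ht.hB.2
  have a3 := (ranked S).py_spec (x.2.2.1 + 1) (by omega) ht.hC
  have a4 := (ranked S).py_spec x.2.2.2 ht.hD.1 ht.hD.2
  refine ⟨⟨a1.1, (h.mem_spanBox a1.1).mpr ht.left⟩, ⟨a2.1, (h.mem_spanBox a2.1).mpr ht.right⟩,
    ⟨a3.1, (h.mem_spanBox a3.1).mpr ht.bottom⟩, ⟨a4.1, (h.mem_spanBox a4.1).mpr ht.top⟩, ?_⟩
  rw [stabs_iff]
  intro e he
  rw [h.mem_spanBox he, h.mem_spanBox (partner_lt he)]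
  exact ht.stab e he

theorem Represents.eq_spanBox {q : ℕ × ℕ × ℕ × ℕ} {R : Set Point} (h : Represents S q R) :
    R = spanBox S q := by
  obtain ⟨l, r, b, t, rfl, hR, -⟩ := h
  rw [hR]
  simp only [spanBox, pos_coe]

theorem Spans.represents {q : ℕ × ℕ × ℕ × ℕ} (h : Spans S q) : Represents S q (spanBox S q) := by
  obtain ⟨l, r, b, t⟩ := q
  obtain ⟨hl, hr, hb, ht, -⟩ := h
  simp only at hl hr hb ht
  have p : ∀ e (he : e < n + n), endpoint S ⟨e, he⟩ = pos S e := fun e he =>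
    (pos_coe S ⟨e, he⟩).symm
  refine ⟨⟨l, hl.1⟩, ⟨r, hr.1⟩, ⟨b, hb.1⟩, ⟨t, ht.1⟩, rfl, ?_, ?_, ?_, ?_, ?_⟩ <;>
    simp only [p, hl.2, hr.2, hb.2, ht.2]
  rfl

/-- Take the bounding box in rank space of the endpoints in `R`. Ranks refine the order of
coordinates, so it lies in the rectangle spanned by the same four endpoints, which contains no
endpoint outside `R`. -/
theorem IsStabbingRectangle.exists_good (hn : 1 ≤ n) {R : Set Point}
    (h : IsStabbingRectangle S R) :
    ∃ x, Good S x ∧ CombEquiv S R (spanBox S ((ranked S).quad x)) := by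
  obtain ⟨⟨a, b, c, d, hab, hcd, rfl⟩, hs⟩ := h
  obtain ⟨l, r, bt, t, hl, hr, hb, ht, hall⟩ :=
    exists_extremes (ranked S).X (ranked S).Y (hs.exists_mem hn)
  have ltN := fun e he => (ranked S).x_spec e he
  have ltM := fun e he => (ranked S).y_spec e he
  have hx : ∀ e < n + n, ∀ f, (ranked S).X e ≤ (ranked S).X f → (pos S e).1 ≤ (pos S f).1 :=
    fun e he f h => le_of_rank_le (v := xkey S) he h
  have hy : ∀ e < n + n, ∀ f, (ranked S).Y e ≤ (ranked S).Y f → (pos S e).2 ≤ (pos S f).2 :=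
    fun e he f h => le_of_rank_le (v := ykey S) he h
  set x : ℕ × ℕ × ℕ × ℕ :=
    ((ranked S).X l - 1, (ranked S).X r, (ranked S).Y bt - 1, (ranked S).Y t) with hxdef
  have l1 := ltN l hl.1
  have r1 := ltN r hr.1
  have b1 := ltM bt hb.1
  have t1 := ltM t ht.1
  have hq : (ranked S).quad x = (l, r, bt, t) := by
    simp only [Ranked.quad, hxdef, Nat.sub_add_cancel l1.1, Nat.sub_add_cancel b1.1, l1.2.2,
      r1.2.2, b1.2.2, t1.2.2]
  have hcorner : ∀ e, ((pos S l).1 ≤ (pos S e).1 ∧ (pos S e).1 ≤ (pos S r).1) ∧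
      (pos S bt).2 ≤ (pos S e).2 ∧ (pos S e).2 ≤ (pos S t).2 → pos S e ∈ box a b c d := by
    intro e he
    have h1 := hl.2; have h2 := hr.2; have h3 := hb.2; have h4 := ht.2
    simp only [box, Set.mem_prod, Set.mem_Icc] at *
    exact ⟨⟨h1.1.1.trans he.1.1, he.1.2.trans h2.1.2⟩, ⟨h3.2.1.trans he.2.1, he.2.2.trans h4.2.2⟩⟩
  have hbox : ∀ e < n + n, ((ranked S).InBox x.1 x.2.1 x.2.2.1 x.2.2.2 e ↔
      pos S e ∈ box a b c d) := by
    intro e he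
    constructor
    · intro h
      simp only [Ranked.InBox, hxdef] at h
      exact hcorner e ⟨⟨hx l hl.1 e (by omega), hx e he r (by omega)⟩, hy bt hb.1 e (by omega),
        hy e he t (by omega)⟩
    · intro h
      have := hall e he h
      simp only [Ranked.InBox, hxdef]
      omega
  have hspan : CombEquiv S (box a b c d) (spanBox S ((ranked S).quad x)) := by
    refine combEquiv_iff.mpr fun e he => ?_
    rw [hq, mem_spanBox]
    constructor
    · intro h
      have h1 := hall e he h
      exact ⟨⟨hx l hl.1 e h1.1, hx e he r h1.2.1⟩, hy bt hb.1 e h1.2.2.1, hy e he t h1.2.2.2⟩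
    · exact hcorner e
  refine ⟨x, ⟨⟨?_, ?_, ?_, ?_, ?_, ?_, ?_, ?_, ?_⟩, ?_⟩, hspan⟩
  · simp only [hxdef]; omega
  · exact ⟨r1.1, r1.2.1⟩
  · simp only [hxdef]; omega
  · exact ⟨t1.1, t1.2.1⟩
  · intro e he
    rw [hbox e he, hbox _ (partner_lt he)]
    exact (stabs_iff _ _).mp hs e he
  · have e1 : (ranked S).PX (x.1 + 1) = l := congrArg Prod.fst hq
    rw [e1, hbox l hl.1]; exact hl.2
  · rw [show (ranked S).PX x.2.1 = r from r1.2.2, hbox r hr.1]; exact hr.2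
  · have e1 : (ranked S).PY (x.2.2.1 + 1) = bt := congrArg (fun q => q.2.2.1) hq
    rw [e1, hbox bt hb.1]; exact hb.2
  · rw [show (ranked S).PY x.2.2.2 = t from t1.2.2, hbox t ht.1]; exact ht.2
  · refine Ranked.StabBox.cnt_eq _ fun e he => ?_
    rw [← mem_spanBox_iff_inBox he, ← mem_spanBox_iff_inBox (partner_lt he)]
    exact (stabs_iff _ _).mp (hs.congr hspan) e he

/-- Reduces the specification of the output to a list without repetitions of the good boxes;
different tight boxes contain different endpoints by `Tight.ext`. -/
theorem reportsAll_of_good (hn : 1 ≤ n) {K : List (ℕ × ℕ × ℕ × ℕ)} (hnd : K.Nodup)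
    (hK : ∀ x, x ∈ K ↔ Good S x) : ReportsAll S (K.map (ranked S).quad) := by
  refine ⟨?_, ?_, ?_⟩
  · intro q hq
    obtain ⟨x, hx, rfl⟩ := List.mem_map.mp hq
    have := ((hK x).mp hx).spans
    exact ⟨_, this.represents, this.isStabbingRectangle⟩
  · rw [List.pairwise_map]
    refine List.Pairwise.imp_of_mem ?_ hnd
    intro x y hx hy hne R R' hR hR' hcomb
    rw [hR.eq_spanBox, hR'.eq_spanBox, combEquiv_iff] at hcomb
    have gx := (hK x).mp hx
    have gy := (hK y).mp hy
    refine hne (gx.1.ext _ gy.1 fun e he => ?_)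
    rw [← gx.mem_spanBox he, ← gy.mem_spanBox he]
    exact hcomb e he
  · intro R hR
    obtain ⟨x, hx, hcomb⟩ := hR.exists_good hn
    exact ⟨_, List.mem_map.mpr ⟨x, (hK x).mpr hx, rfl⟩, _, hx.spans.represents, hcomb⟩

end OfSegments

/-! ### Total correctness with time bounds -/

section Logic

variable {m : ℕ} (P : Fin m → Point) (B : ℕ)

/-- Started in `s`, the program `c` halts within time `T`, in a state that satisfies `Q`. -/
def Runs (c : Program) (s : State) (T : ℕ) (Q : State → Prop) : Prop :=
  ∃ s' t, Exec P B c s s' t ∧ t ≤ T ∧ Q s'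

variable {P B}

theorem Runs.mono {c : Program} {s : State} {T T' : ℕ} {Q Q' : State → Prop}
    (h : Runs P B c s T Q) (hT : T ≤ T') (hQ : ∀ s', Q s' → Q' s') : Runs P B c s T' Q' := by
  obtain ⟨s', t, h1, h2, h3⟩ := h
  exact ⟨s', t, h1, h2.trans hT, hQ s' h3⟩

theorem Runs.of_le {c : Program} {s : State} {T T' : ℕ} {Q : State → Prop}
    (h : Runs P B c s T Q) (hT : T ≤ T') : Runs P B c s T' Q :=
  h.mono hT fun _ h => h

theorem Runs.imp {c : Program} {s : State} {T : ℕ} {Q Q' : State → Prop}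
    (h : Runs P B c s T Q) (hQ : ∀ s', Q s' → Q' s') : Runs P B c s T Q' :=
  h.mono le_rfl hQ

theorem runs_skip {s : State} {Q : State → Prop} (h : Q s) : Runs P B Program.skip s 1 Q :=
  ⟨s, 1, Exec.skip s, le_rfl, h⟩

theorem runs_assign {s : State} {x : ℕ} {e : Expr} {Q : State → Prop} (he : e.Fits B s)
    (h : Q (s.setReg x (e.eval s))) : Runs P B (Program.assign x e) s (e.cost + 1) Q :=
  ⟨_, _, Exec.assign s x e he, le_rfl, h⟩

theorem runs_store {s : State} {a : ℕ} {i e : Expr} {Q : State → Prop} (hi : i.Fits B s)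
    (he : e.Fits B s) (h : Q (s.setArr a (i.eval s) (e.eval s))) :
    Runs P B (Program.store a i e) s (i.cost + e.cost + 1) Q :=
  ⟨_, _, Exec.store s a i e hi he, le_rfl, h⟩

theorem runs_report {s : State} {l r b t : Expr} {Q : State → Prop} (hl : l.Fits B s)
    (hr : r.Fits B s) (hb : b.Fits B s) (ht : t.Fits B s)
    (h : Q (s.report (l.eval s) (r.eval s) (b.eval s) (t.eval s))) :
    Runs P B (Program.report l r b t) s (l.cost + r.cost + b.cost + t.cost + 1) Q :=
  ⟨_, _, Exec.report s l r b t hl hr hb ht, le_rfl, h⟩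

theorem runs_seq {c d : Program} {s : State} {T₁ T₂ : ℕ} {Q : State → Prop}
    (h : Runs P B c s T₁ fun s₁ => Runs P B d s₁ T₂ Q) :
    Runs P B (Program.seq c d) s (T₁ + T₂) Q := by
  obtain ⟨s₁, t₁, h1, h2, s₂, t₂, h3, h4, h5⟩ := h
  exact ⟨s₂, t₁ + t₂, Exec.seq c d s s₁ s₂ t₁ t₂ h1 h3, by omega, h5⟩

theorem runs_cond {p : Test} {c d : Program} {s : State} {T₁ T₂ : ℕ} {Q : State → Prop}
    (hf : p.Fits B s) (hc : p.Holds P s → Runs P B c s T₁ Q)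
    (hd : ¬ p.Holds P s → Runs P B d s T₂ Q) :
    Runs P B (Program.cond p c d) s (p.cost + T₁ + T₂) Q := by
  by_cases hp : p.Holds P s
  · obtain ⟨s₁, t₁, h1, h2, h3⟩ := hc hp
    exact ⟨s₁, _, Exec.cond_true p c d s s₁ t₁ hf hp h1, by omega, h3⟩
  · obtain ⟨s₁, t₁, h1, h2, h3⟩ := hd hp
    exact ⟨s₁, _, Exec.cond_false p c d s s₁ t₁ hf hp h1, by omega, h3⟩

/-- The rule for loops; `φ` is the time that is left. -/
theorem runs_loop {p : Test} {c : Program} (Inv : ℕ → State → Prop) {Q : State → Prop}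
    (h : ∀ φ s, Inv φ s → p.Fits B s ∧ p.cost ≤ φ ∧ (¬ p.Holds P s → Q s) ∧
      (p.Holds P s → ∃ T, Runs P B c s T fun s' => ∃ φ', Inv φ' s' ∧ p.cost + T + φ' ≤ φ)) :
    ∀ φ s, Inv φ s → 0 < p.cost → Runs P B (Program.loop p c) s φ Q := by
  intro φ
  -- Every test costs time, so the remaining time decreases strictly and also proves termination.
  induction φ using Nat.strong_induction_on with
  | _ φ ih =>
    intro s hs hpos
    obtain ⟨hf, hφ, hn, hy⟩ := h φ s hs
    by_cases hp : p.Holds P s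
    · obtain ⟨T, s₁, t₁, h1, h2, φ', h3, h4⟩ := hy hp
      obtain ⟨s₂, t₂, h5, h6, h7⟩ := ih φ' (by omega) s₁ h3 hpos
      exact ⟨s₂, _, Exec.loop_true p c s s₁ s₂ t₁ t₂ hf hp h1 h5, by omega, h7⟩
    · exact ⟨s, _, Exec.loop_false p c s hf hp, hφ, hn hp⟩

/-! ### States -/

@[simp] theorem setReg_reg (s : State) (x v y : ℕ) :
    (s.setReg x v).reg y = if y = x then v else s.reg y := by
  simp [State.setReg, Function.update_apply]

@[simp] theorem setReg_arr (s : State) (x v : ℕ) : (s.setReg x v).arr = s.arr := rfl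

@[simp] theorem setReg_out (s : State) (x v : ℕ) : (s.setReg x v).out = s.out := rfl

@[simp] theorem setArr_reg (s : State) (a i v : ℕ) : (s.setArr a i v).reg = s.reg := rfl

@[simp] theorem setArr_arr (s : State) (a i v b j : ℕ) :
    (s.setArr a i v).arr b j = if b = a ∧ j = i then v else s.arr b j := by
  unfold State.setArr
  by_cases h : b = a
  · subst h; simp [Function.update_apply]
  · simp [h]

@[simp] theorem setArr_out (s : State) (a i v : ℕ) : (s.setArr a i v).out = s.out := rfl

@[simp] theorem report_out (s : State) (l r b t : ℕ) :
    (s.report l r b t).out = s.out ++ [(l, r, b, t)] := rfl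

/-! ### Counting loops -/

/-- Repeat `c`, counting register `x` upwards as long as it is less than register `y`. -/
def countUp (x y : ℕ) (c : Program) : Program :=
  .loop (.lt (.reg x) (.reg y)) (.seq c (.assign x (.add (.reg x) (.const 1))))

/-- The rule for counting loops; `φ` is the time that is left for the loop body. -/
theorem runs_countUp {x y : ℕ} {c : Program} {L : ℕ} (hL : L ≤ B) (hB : 1 ≤ B)
    (Inv : ℕ → ℕ → State → Prop)
    (hI : ∀ i φ s, Inv i φ s → s.reg x = i ∧ s.reg y = L)
    (h : ∀ i φ s, i < L → Inv i φ s → ∃ T, Runs P B c s T fun s' => s'.reg x = i ∧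
      ∃ φ', T + φ' ≤ φ ∧ Inv (i + 1) φ' (s'.setReg x (i + 1)))
    {i φ : ℕ} {s : State} (hi : i ≤ L) (hs : Inv i φ s) :
    Runs P B (countUp x y c) s (φ + 7 * (L - i) + 3) fun s' => ∃ φ', Inv L φ' s' := by
  refine runs_loop (fun ψ s => ∃ i φ, i ≤ L ∧ Inv i φ s ∧ ψ = φ + 7 * (L - i) + 3) ?_ _ _
    ⟨i, φ, hi, hs, rfl⟩ (by simp [Test.cost])
  rintro ψ s ⟨i, φ, hi, hs, rfl⟩
  obtain ⟨h1, h2⟩ := hI i φ s hs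
  refine ⟨?_, ?_, ?_, ?_⟩
  · simp only [Test.Fits, Expr.Fits]; omega
  · simp [Test.cost, Expr.cost]
  · intro hp
    simp only [Test.Holds, Expr.eval] at hp
    have : i = L := by omega
    exact ⟨φ, this ▸ hs⟩
  · intro hp
    simp only [Test.Holds, Expr.eval] at hp
    have hlt : i < L := by omega
    obtain ⟨T, hT⟩ := h i φ s hlt hs
    refine ⟨T + 4, runs_seq (T₂ := 4) (hT.imp ?_)⟩
    rintro s' ⟨hx, φ', hφ, hI'⟩
    refine (runs_assign ?_ ?_).of_le (le_refl 4)
    · simp only [Expr.Fits, Expr.eval]; omega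
    · simp only [Expr.eval, hx]
      refine ⟨_, ⟨i + 1, φ', hlt, hI', rfl⟩, ?_⟩
      simp only [Test.cost, Expr.cost]; omega

/-- The rule for counting loops whose body takes bounded time. -/
theorem runs_countUp_const {x y : ℕ} {c : Program} {L : ℕ} (hL : L ≤ B) (hB : 1 ≤ B) (T : ℕ)
    (Inv : ℕ → State → Prop) (hI : ∀ i s, Inv i s → s.reg x = i ∧ s.reg y = L)
    (h : ∀ i s, i < L → Inv i s → Runs P B c s T fun s' => s'.reg x = i ∧
      Inv (i + 1) (s'.setReg x (i + 1)))
    {i : ℕ} {s : State} (hi : i ≤ L) (hs : Inv i s) :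
    Runs P B (countUp x y c) s ((T + 7) * (L - i) + 3) (Inv L) := by
  refine (runs_countUp hL hB (fun i φ s => Inv i s ∧ φ = T * (L - i))
    (fun i φ s h => hI i s h.1) ?_ hi ⟨hs, rfl⟩).mono (by ring_nf; omega)
    fun s' ⟨_, h⟩ => h.1
  rintro i φ s hlt ⟨hs, rfl⟩
  refine ⟨T, (h i s hlt hs).imp fun s' h' => ⟨h'.1, T * (L - (i + 1)), ?_, h'.2, rfl⟩⟩
  have : L - i = (L - (i + 1)) + 1 := by omega
  rw [this, Nat.mul_succ]; omega

/-! ### Binary search -/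

/-- Binary search between the registers `u` and `v`, with `w` for the middle. -/
def bisect (u v w : ℕ) (p : Test) : Program :=
  .loop (.lt (.add (.reg u) (.const 1)) (.reg v))
    (.seq (.assign w (.div (.add (.reg u) (.reg v)) (.const 2)))
      (.cond p (.assign v (.reg w)) (.assign u (.reg w))))

/-- `V` need not be monotone: the invariant is that it fails at the lower end and holds at the upper
end, and the search stops at two neighbours where it changes. One round costs 5 for the loop test, 6
for the middle and p.cost + 4 for the branch. -/
theorem runs_bisect {u v w : ℕ} {p : Test} (huv : u ≠ v) (huw : u ≠ w) (hvw : v ≠ w) {s : State}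
    {V : ℕ → Prop} (hB : 2 ≤ B) (hv : 2 * s.reg v ≤ B)
    (hp : ∀ s' : State, s'.arr = s.arr → (∀ x, x ≠ u → x ≠ v → x ≠ w → s'.reg x = s.reg x) →
      s.reg u ≤ s'.reg w → s'.reg w ≤ s.reg v →
      p.Fits B s' ∧ (p.Holds P s' ↔ V (s'.reg w)))
    (hlt : s.reg u < s.reg v) (h0 : ¬ V (s.reg u)) (h1 : V (s.reg v)) :
    Runs P B (bisect u v w p) s ((p.cost + 15) * Nat.clog 2 (s.reg v - s.reg u) + 5) fun s' =>
      s'.arr = s.arr ∧ s'.out = s.out ∧ (∀ x, x ≠ u → x ≠ v → x ≠ w → s'.reg x = s.reg x) ∧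
      s.reg u ≤ s'.reg u ∧ s'.reg v ≤ s.reg v ∧ s'.reg u + 1 = s'.reg v ∧
      ¬ V (s'.reg u) ∧ V (s'.reg v) := by
  refine runs_loop (fun φ s' => (s'.arr = s.arr ∧ s'.out = s.out ∧
    (∀ x, x ≠ u → x ≠ v → x ≠ w → s'.reg x = s.reg x) ∧
      s.reg u ≤ s'.reg u ∧ s'.reg v ≤ s.reg v ∧ s'.reg u < s'.reg v ∧
      ¬ V (s'.reg u) ∧ V (s'.reg v)) ∧
      φ = (p.cost + 15) * Nat.clog 2 (s'.reg v - s'.reg u) + 5) ?_ _ _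
    ⟨⟨rfl, rfl, fun _ _ _ _ => rfl, le_rfl, le_rfl, hlt, h0, h1⟩, rfl⟩ (by simp [Test.cost])
  rintro φ s' ⟨⟨i1, i2, i3, i4, i5, i6, i7, i8⟩, rfl⟩
  refine ⟨?_, ?_, ?_, ?_⟩
  · simp only [Test.Fits, Expr.Fits, Expr.eval]; omega
  · simp [Test.cost, Expr.cost]
  · intro hn
    simp only [Test.Holds, Expr.eval] at hn
    exact ⟨i1, i2, i3, i4, i5, by omega, i7, i8⟩
  · intro hy
    simp only [Test.Holds, Expr.eval] at hy
    -- Both halves have length at most ⌈length / 2⌉, which is the recursion of `Nat.clog`.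
    have key : ∀ d, d ≤ (s'.reg v - s'.reg u + 1) / 2 →
        Nat.clog 2 d + 1 ≤ Nat.clog 2 (s'.reg v - s'.reg u) := by
      intro d hd
      rw [Nat.clog_of_two_le (n := s'.reg v - s'.reg u) one_lt_two (by omega)]
      exact Nat.add_le_add_right (Nat.clog_mono_right 2 hd) 1
    have key2 : ∀ d, d ≤ (s'.reg v - s'.reg u + 1) / 2 →
        5 + (6 + (p.cost + 2 + 2)) + ((p.cost + 15) * Nat.clog 2 d + 5) ≤
          (p.cost + 15) * Nat.clog 2 (s'.reg v - s'.reg u) + 5 := by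
      intro d hd
      have := Nat.mul_le_mul_left (p.cost + 15) (key d hd)
      rw [Nat.mul_succ] at this
      omega
    refine ⟨6 + (p.cost + 2 + 2), runs_seq (T₁ := 6) (T₂ := p.cost + 2 + 2)
      ((runs_assign ?_ ?_).of_le (le_refl 6))⟩
    · simp only [Expr.Fits, Expr.eval]; omega
    · simp only [Expr.eval]
      set c := (s'.reg u + s'.reg v) / 2 with hc
      obtain ⟨q1, q2⟩ := hp (s'.setReg w c) (by simpa using i1)
        (fun x h1 h2 h3 => by simp [h3, i3 x h1 h2 h3])
        (by simp only [setReg_reg, if_true]; omega) (by simp only [setReg_reg, if_true]; omega)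
      simp only [setReg_reg, if_true] at q2
      refine runs_cond q1 (fun hV => ?_) (fun hV => ?_)
      · refine runs_assign ?_ ⟨_, ⟨⟨?_, ?_, ?_, ?_, ?_, ?_, ?_, ?_⟩, rfl⟩, ?_⟩
        · simp only [Expr.Fits, setReg_reg, if_true]; omega
        · simpa using i1
        · simpa using i2
        · intro x h1 h2 h3; simp [h2, h3, i3 x h1 h2 h3]
        · simp [huv, huw, i4]
        · simp only [setReg_reg, Expr.eval, if_true]; omega
        · simp only [setReg_reg, Expr.eval, if_true, huv, huw, if_false]; omega
        · simpa [huv, huw] using i7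
        · simpa [Expr.eval] using q2.mp hV
        · simp only [setReg_reg, Expr.eval, if_true, huv, huw, if_false, Test.cost, Expr.cost]
          exact key2 _ (by omega)
      · refine runs_assign ?_ ⟨_, ⟨⟨?_, ?_, ?_, ?_, ?_, ?_, ?_, ?_⟩, rfl⟩, ?_⟩
        · simp only [Expr.Fits, setReg_reg, if_true]; omega
        · simpa using i1
        · simpa using i2
        · intro x h1 h2 h3; simp [h1, h3, i3 x h1 h2 h3]
        · simp only [setReg_reg, Expr.eval, if_true]; omega
        · simp [huv.symm, hvw, i5]
        · simp only [setReg_reg, Expr.eval, if_true, huv.symm, hvw, if_false]; omega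
        · simpa [Expr.eval] using fun h => hV (q2.mpr h)
        · simpa [huv.symm, hvw] using i8
        · simp only [setReg_reg, Expr.eval, if_true, huv.symm, hvw, if_false, Test.cost, Expr.cost]
          exact key2 _ (by omega)

end Logic

/-! ### Values of expressions and tests -/

section Values

variable {m : ℕ} {P : Fin m → Point} {B : ℕ} {s : State}

/-- The expression `e` can be evaluated in the state `s`, with value `v`. -/
def Val (B : ℕ) (s : State) (e : Expr) (v : ℕ) : Prop := e.Fits B s ∧ e.eval s = v

/-- The test `p` can be evaluated in the state `s`, and expresses `Q`. -/
def Tests (P : Fin m → Point) (B : ℕ) (s : State) (p : Test) (Q : Prop) : Prop :=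
  p.Fits B s ∧ (p.Holds P s ↔ Q)

theorem Val.const {k : ℕ} (h : k ≤ B) : Val B s (.const k) k := ⟨h, rfl⟩

theorem Val.reg {x v : ℕ} (h : s.reg x = v) (hv : v ≤ B) : Val B s (.reg x) v :=
  ⟨h.le.trans hv, h⟩

theorem Val.cell {a v w : ℕ} {i : Expr} (hi : Val B s i v) (h : s.arr a v = w) (hw : w ≤ B) :
    Val B s (.cell a i) w := by
  obtain ⟨h1, rfl⟩ := hi
  exact ⟨⟨h1, h.le.trans hw⟩, h⟩

theorem Val.add {e f : Expr} {a b : ℕ} (he : Val B s e a) (hf : Val B s f b) (h : a + b ≤ B) :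
    Val B s (.add e f) (a + b) := by
  obtain ⟨h1, rfl⟩ := he
  obtain ⟨h2, rfl⟩ := hf
  exact ⟨⟨h1, h2, h⟩, rfl⟩

theorem Val.sub {e f : Expr} {a b : ℕ} (he : Val B s e a) (hf : Val B s f b) :
    Val B s (.sub e f) (a - b) := by
  obtain ⟨h1, rfl⟩ := he
  obtain ⟨h2, rfl⟩ := hf
  exact ⟨⟨h1, h2⟩, rfl⟩

theorem Val.mul {e f : Expr} {a b : ℕ} (he : Val B s e a) (hf : Val B s f b) (h : a * b ≤ B) :
    Val B s (.mul e f) (a * b) := by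
  obtain ⟨h1, rfl⟩ := he
  obtain ⟨h2, rfl⟩ := hf
  exact ⟨⟨h1, h2, h⟩, rfl⟩

theorem Val.cast {e : Expr} {v w : ℕ} (h : Val B s e v) (hv : v = w) : Val B s e w := hv ▸ h

theorem Tests.eq {e f : Expr} {a b : ℕ} (he : Val B s e a) (hf : Val B s f b) :
    Tests P B s (.eq e f) (a = b) := by
  obtain ⟨h1, rfl⟩ := he
  obtain ⟨h2, rfl⟩ := hf
  exact ⟨⟨h1, h2⟩, Iff.rfl⟩

theorem Tests.lt {e f : Expr} {a b : ℕ} (he : Val B s e a) (hf : Val B s f b) :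
    Tests P B s (.lt e f) (a < b) := by
  obtain ⟨h1, rfl⟩ := he
  obtain ⟨h2, rfl⟩ := hf
  exact ⟨⟨h1, h2⟩, Iff.rfl⟩

theorem Tests.not {p : Test} {Q : Prop} (h : Tests P B s p Q) : Tests P B s (.not p) (¬ Q) :=
  ⟨h.1, not_congr h.2⟩

theorem Tests.and {p q : Test} {Q R : Prop} (h : Tests P B s p Q) (h' : Tests P B s q R) :
    Tests P B s (.and p q) (Q ∧ R) :=
  ⟨⟨h.1, h'.1⟩, and_congr h.2 h'.2⟩

theorem Val.runs_assign {x v : ℕ} {e : Expr} {Q : State → Prop} (he : Val B s e v)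
    (h : Q (s.setReg x v)) : Runs P B (.assign x e) s (e.cost + 1) Q := by
  obtain ⟨h1, rfl⟩ := he
  exact Stab.runs_assign h1 h

theorem Val.runs_store {a v w : ℕ} {i e : Expr} {Q : State → Prop} (hi : Val B s i v)
    (he : Val B s e w) (h : Q (s.setArr a v w)) :
    Runs P B (.store a i e) s (i.cost + e.cost + 1) Q := by
  obtain ⟨h1, rfl⟩ := hi
  obtain ⟨h2, rfl⟩ := he
  exact Stab.runs_store h1 h2 h

theorem Tests.runs_cond {p : Test} {R : Prop} {c d : Program} {T₁ T₂ : ℕ} {Q : State → Prop}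
    (h : Tests P B s p R) (hc : R → Runs P B c s T₁ Q) (hd : ¬ R → Runs P B d s T₂ Q) :
    Runs P B (.cond p c d) s (p.cost + T₁ + T₂) Q :=
  Stab.runs_cond h.1 (fun hp => hc (h.2.mp hp)) (fun hp => hd fun hr => hp (h.2.mpr hr))

end Values

/-! ### Tables -/

section Tables

variable {n : ℕ} (S : Fin n → Segment)

/-- Words are large enough for the indices of square tables. -/
structure WordBound (n B : ℕ) : Prop where
  pos : 1 ≤ n
  small : 4 * (n + n + 2) ≤ B
  square : (n + n + 2) * (n + n + 2) ≤ B

/-- The sizes and the tables about the input are in place: registers `0`, `1`, `2` and arrays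
`0, …, 12`. -/
structure Ready (s : State) : Prop where
  n_eq : s.reg 0 = n
  size : s.reg 1 = n + n
  width : s.reg 2 = n + n + 1
  xlt : ∀ e < n + n, s.arr 0 e = countLt (xkey S) (n + n) e
  xle : ∀ e < n + n, s.arr 1 e = countLe (xkey S) (n + n) e
  x : ∀ e < n + n, s.arr 2 e = (ranked S).X e
  px : ∀ r, 1 ≤ r → r ≤ n + n → s.arr 3 r = (ranked S).PX r
  ylt : ∀ e < n + n, s.arr 4 e = countLt (ykey S) (n + n) e
  yle : ∀ e < n + n, s.arr 5 e = countLe (ykey S) (n + n) e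
  y : ∀ e < n + n, s.arr 6 e = (ranked S).Y e
  py : ∀ r, 1 ≤ r → r ≤ n + n → s.arr 7 r = (ranked S).PY r
  lo : ∀ e < n + n, s.arr 8 e = (ranked S).lo e
  hi : ∀ e < n + n, s.arr 9 e = (ranked S).hi e
  upper : (ranked S).IsUpper (s.arr 10)
  count : ∀ A ≤ n + n, ∀ C ≤ n + n, s.arr 11 (A * (n + n + 1) + C) = (ranked S).prefixCount A C
  partner : ∀ e < n + n, s.arr 12 e = partner n e

variable {S} {B : ℕ} {s : State}

theorem Ready.congr (h : Ready S s) {s' : State} (hr : ∀ x < 3, s'.reg x = s.reg x)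
    (ha : ∀ a < 13, s'.arr a = s.arr a) : Ready S s' := by
  constructor
  · rw [hr 0 (by omega)]; exact h.n_eq
  · rw [hr 1 (by omega)]; exact h.size
  · rw [hr 2 (by omega)]; exact h.width
  · rw [ha 0 (by omega)]; exact h.xlt
  · rw [ha 1 (by omega)]; exact h.xle
  · rw [ha 2 (by omega)]; exact h.x
  · rw [ha 3 (by omega)]; exact h.px
  · rw [ha 4 (by omega)]; exact h.ylt
  · rw [ha 5 (by omega)]; exact h.yle
  · rw [ha 6 (by omega)]; exact h.y
  · rw [ha 7 (by omega)]; exact h.py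
  · rw [ha 8 (by omega)]; exact h.lo
  · rw [ha 9 (by omega)]; exact h.hi
  · rw [ha 10 (by omega)]; exact h.upper
  · rw [ha 11 (by omega)]; exact h.count
  · rw [ha 12 (by omega)]; exact h.partner

theorem Ready.setReg (h : Ready S s) {x v : ℕ} (hx : 3 ≤ x) : Ready S (s.setReg x v) :=
  h.congr (fun y hy => by simp only [setReg_reg]; rw [if_neg (by omega)]) fun _ _ => rfl

theorem Ready.setArr (h : Ready S s) {a i v : ℕ} (ha : 13 ≤ a) : Ready S (s.setArr a i v) :=
  h.congr (fun _ _ => rfl) fun b hb => by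
    funext j; rw [setArr_arr, if_neg (by omega)]

theorem countLt_le (v : ℕ → ℝ) (N e : ℕ) : countLt v N e ≤ N := by
  classical
  exact (Finset.card_filter_le _ _).trans (by simp)

theorem countLe_le (v : ℕ → ℝ) (N e : ℕ) : countLe v N e ≤ N := by
  classical
  exact (Finset.card_filter_le _ _).trans (by simp)

/-- The index of an entry of a square table. -/
def idx (a c : Expr) : Expr := .add (.mul a (.reg 2)) c

theorem idx_le {N a c : ℕ} (ha : a ≤ N) (hc : c ≤ N) : a * (N + 1) + c ≤ (N + 2) * (N + 2) := by
  nlinarith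

theorem Val.idx (hB : WordBound n B) (hw : s.reg 2 = n + n + 1) {a c : Expr} {i j : ℕ}
    (ha : Val B s a i) (hc : Val B s c j) (hi : i ≤ n + n) (hj : j ≤ n + n) :
    Val B s (idx a c) (i * (n + n + 1) + j) := by
  have h1 := idx_le hi hj
  have h2 := hB.square
  have h3 := hB.small
  exact (ha.mul (.reg hw (by omega)) (by omega)).add hc (by omega)

/-- The number of endpoints in a box. -/
def countExpr (a b c d : Expr) : Expr :=
  .sub (.add (.cell 11 (idx b d)) (.cell 11 (idx a c)))
    (.add (.cell 11 (idx a d)) (.cell 11 (idx b c)))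

/-- Both sums are formed before the single subtraction, so truncation does no harm. The order
hypotheses are those of `Ranked.cnt_add`. -/
theorem Val.countExpr (hB : WordBound n B) (hs : Ready S s) {a b c d : Expr} {i j k l : ℕ}
    (ha : Val B s a i) (hb : Val B s b j) (hc : Val B s c k) (hd : Val B s d l) (hij : i ≤ j)
    (hj : j ≤ n + n) (hkl : k ≤ l) (hl : l ≤ n + n) :
    Val B s (countExpr a b c d) ((ranked S).cnt i j k l) := by
  have h3 := hB.small
  have key : ∀ {a c : Expr} {i k : ℕ}, Val B s a i → Val B s c k → i ≤ n + n → k ≤ n + n →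
      Val B s (.cell 11 (Stab.idx a c)) ((ranked S).prefixCount i k) := fun ha hc hi hk =>
    (ha.idx hB hs.width hc hi hk).cell (hs.count _ hi _ hk)
      (((ranked S).prefixCount_le _ _).trans (by omega))
  have b1 := (ranked S).prefixCount_le j l
  have b2 := (ranked S).prefixCount_le i k
  have b3 := (ranked S).prefixCount_le i l
  have b4 := (ranked S).prefixCount_le j k
  refine ((Val.add (key hb hd hj hl) (key ha hc (by omega) (by omega)) (by omega)).sub
    (Val.add (key ha hd (by omega) hl) (key hb hc hj (by omega)) (by omega))).cast ?_
  have := (ranked S).cnt_add hij hkl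
  omega

end Tables

/-! ### Shrinking a box -/

section Search

variable {m : ℕ} {P : Fin m → Point} {B : ℕ}

/-- Binary search between the values of the registers `x` and `y`; the result is stored in
register `d`, and it is the upper end of the final interval if `up` is true, and the lower end
otherwise. -/
def search (d x y : ℕ) (up : Bool) (p : Test) : Program :=
  .seq (.assign 13 (.reg x)) (.seq (.assign 14 (.reg y)) (.seq (bisect 13 14 15 p)
    (.assign d (.reg (if up then 14 else 13)))))

/-- Registers 13 to 15 are scratch; all lower registers except the target are preserved. -/
theorem runs_search {d x y : ℕ} {up : Bool} {p : Test} (hy : y < 13)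
    {s : State} {V : ℕ → Prop} (hB : 2 ≤ B) {u v M : ℕ} (hu : s.reg x = u) (hv : s.reg y = v)
    (hvB : 2 * v ≤ B) (hvM : v ≤ M)
    (hp : ∀ s' : State, s'.arr = s.arr → (∀ x < 13, s'.reg x = s.reg x) → u ≤ s'.reg 15 →
      s'.reg 15 ≤ v → Tests P B s' p (V (s'.reg 15)))
    (hlt : u < v) (h0 : ¬ V u) (h1 : V v) :
    Runs P B (search d x y up p) s ((p.cost + 15) * Nat.clog 2 M + 11) fun s' =>
      s'.arr = s.arr ∧ s'.out = s.out ∧ (∀ x < 13, x ≠ d → s'.reg x = s.reg x) ∧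
      ∃ k, u ≤ k ∧ k < v ∧ ¬ V k ∧ V (k + 1) ∧ s'.reg d = if up then k + 1 else k := by
  refine (runs_seq (Val.runs_assign (v := u) (.reg hu (by omega)) (runs_seq
    (Val.runs_assign (v := v) (.reg ?_ (by omega)) (runs_seq
    ((runs_bisect (V := V) (by omega) (by omega) (by omega) hB ?_ ?_ ?_ ?_ ?_).imp
      (Q' := fun s₁ => Runs P B _ s₁ (Expr.cost (.reg (if up then 14 else 13)) + 1) _)
      ?_)))))).of_le ?_
  · rw [setReg_reg, if_neg (by omega)]; exact hv
  · simpa using hvB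
  · intro s' h1 h2 h3 h4
    refine hp s' h1 (fun x hx => ?_) (by simpa using h3) (by simpa using h4)
    rw [h2 x (by omega) (by omega) (by omega)]
    simp only [setReg_reg]
    rw [if_neg (by omega), if_neg (by omega)]
  · simpa using hlt
  · simpa using h0
  · simpa using h1
  · rintro s' ⟨i1, i2, i3, i4, i5, i6, i7, i8⟩
    simp only [setReg_reg, if_true, if_neg (show (13 : ℕ) ≠ 14 by omega)] at i4 i5
    have hres : s'.reg (if up then 14 else 13) =
        if up then s'.reg 13 + 1 else s'.reg 13 := by
      split_ifs
      · exact i6.symm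
      · rfl
    refine Val.runs_assign (.reg hres (by split_ifs <;> omega)) ⟨i1, i2, ?_, s'.reg 13, i4,
      by omega, i7, i6 ▸ i8, by simp⟩
    intro x hx hxd
    rw [setReg_reg, if_neg hxd, i3 x (by omega) (by omega) (by omega)]
    simp only [setReg_reg]
    rw [if_neg (by omega), if_neg (by omega)]
  · simp only [Expr.cost, setReg_reg, if_true, if_neg (show (13 : ℕ) ≠ 14 by omega)]
    have h3 : Nat.clog 2 (v - u) ≤ Nat.clog 2 M := Nat.clog_mono_right 2 (by omega)
    have h4 := Nat.mul_le_mul_left (p.cost + 15) h3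
    omega

end Search

namespace Ranked

variable {n : ℕ} (I : Ranked n)

/-- The only endpoint that the move of the right side can add is the one with rank B + 1. This is
how a change of the count makes a side tight. -/
theorem inBox_px_of_cnt_ne {A B C D : ℕ} (hB : I.cnt A (B + 1) C D ≠ I.cnt A B C D) :
    I.InBox A (B + 1) C D (I.PX (B + 1)) := by
  by_contra hn
  refine hB (congrArg Finset.card (Finset.filter_congr fun e he => ?_))
  refine ⟨fun h => ?_, fun h => h.mono I le_rfl (by omega) le_rfl le_rfl⟩
  by_contra hc
  have : I.X e = B + 1 := by unfold InBox at h hc; omega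
  rw [← this, (I.x_spec e (Finset.mem_range.mp he)).2.2] at hn
  rw [this] at hn
  exact hn h

theorem inBox_py_of_cnt_ne {A B C D : ℕ} (hB : I.cnt A B C (D + 1) ≠ I.cnt A B C D) :
    I.InBox A B C (D + 1) (I.PY (D + 1)) := by
  by_contra hn
  refine hB (congrArg Finset.card (Finset.filter_congr fun e he => ?_))
  refine ⟨fun h => ?_, fun h => h.mono I le_rfl le_rfl le_rfl (by omega)⟩
  by_contra hc
  have : I.Y e = D + 1 := by unfold InBox at h hc; omega
  rw [← this, (I.y_spec e (Finset.mem_range.mp he)).2.2] at hn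
  rw [this] at hn
  exact hn h

theorem inBox_py_of_cnt_ne' {A B C D : ℕ} (hB : I.cnt A B C D ≠ I.cnt A B (C + 1) D) :
    I.InBox A B C D (I.PY (C + 1)) := by
  by_contra hn
  refine hB (congrArg Finset.card (Finset.filter_congr fun e he => ?_))
  refine ⟨fun h => ?_, fun h => h.mono I le_rfl le_rfl (by omega) le_rfl⟩
  by_contra hc
  have : I.Y e = C + 1 := by unfold InBox at h hc; omega
  rw [← this, (I.y_spec e (Finset.mem_range.mp he)).2.2] at hn
  exact hn h

/-- The counts stay equal to n, so the shrunken box has the same endpoints as the window, and each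
moved side is tight because one more step changes the count. Any other tight box in the window with
this left side has n endpoints, hence again those of the window. -/
theorem tight_of_shrink {A b c d B C D : ℕ} (hA : A + 1 ≤ b) (hb : b ≤ n + n) (hd : d ≤ n + n)
    (hfree : I.Free A b c d) (hcnt : I.cnt A b c d = n)
    (hl : c < I.Y (I.PX (A + 1)) ∧ I.Y (I.PX (A + 1)) ≤ d)
    (hB : B + 1 ≤ b) (hB1 : I.cnt A (B + 1) c d = n) (hB2 : I.cnt A B c d ≠ n)
    (hC : c ≤ C) (hCd : C < d) (hC1 : I.cnt A (B + 1) C d = n)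
    (hC2 : I.cnt A (B + 1) (C + 1) d ≠ n)
    (hD : D + 1 ≤ d) (hD1 : I.cnt A (B + 1) C (D + 1) = n) (hD2 : I.cnt A (B + 1) C D ≠ n) :
    I.Tight (A, B + 1, C, D + 1) ∧ ∀ y, I.Tight y → y.1 = A → y.2.1 ≤ b → c ≤ y.2.2.1 →
      y.2.2.2 ≤ d → y = (A, B + 1, C, D + 1) := by
  have m1 := fun {e} (he : e < n + n) =>
    I.inBox_iff_of_cnt_eq le_rfl hB hC hD (hD1.trans hcnt.symm) he
  have m2 := fun {e} (he : e < n + n) =>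
    I.inBox_iff_of_cnt_eq le_rfl le_rfl hC hD (hD1.trans hB1.symm) he
  have m3 := fun {e} (he : e < n + n) =>
    I.inBox_iff_of_cnt_eq le_rfl le_rfl le_rfl hD (hD1.trans hC1.symm) he
  have a1 := I.px_spec (A + 1) (by omega) (by omega)
  have a2 := I.px_spec (B + 1) (by omega) (by omega)
  have a3 := I.py_spec (C + 1) (by omega) (by omega)
  have ht : I.Tight (A, B + 1, C, D + 1) := by
    constructor <;> simp only
    · omega
    · omega
    · omega
    · omega
    · exact Free.stabBox I (hfree.anti I le_rfl hB hC hD) hD1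
    · refine (m1 a1.1).mp ?_
      unfold InBox
      omega
    · exact (m2 a2.1).mp (I.inBox_px_of_cnt_ne (hB1.trans_ne hB2.symm))
    · exact (m3 a3.1).mp (I.inBox_py_of_cnt_ne' (hC1.trans_ne hC2.symm))
    · exact I.inBox_py_of_cnt_ne (hD1.trans_ne hD2.symm)
  refine ⟨ht, fun y hy h1 h2 h3 h4 => hy.ext I ht fun e he => ?_⟩
  have hyc := hy.stab.cnt_eq
  rw [← m1 he]
  exact (I.inBox_iff_of_cnt_eq h1.ge h2 h3 h4 (hyc.trans hcnt.symm) he).symm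

end Ranked

/-! ### Reporting a box -/

section Emit

variable {n : ℕ} (S : Fin n → Segment)

/-- The box `x` with left side `A` has been found before. -/
def Marked (n A : ℕ) (s : State) (x : ℕ × ℕ × ℕ × ℕ) : Prop :=
  s.arr 15 (x.2.1 * (n + n + 1) + x.2.2.1) = A + 1

/-- The good boxes that have been reported are those to the right of `A`, and those with left
side `A` that are marked. -/
structure Reported (A : ℕ) (s : State) : Prop where
  list : ∃ K : List (ℕ × ℕ × ℕ × ℕ), s.out = K.map (ranked S).quad ∧ K.Nodup ∧
    ∀ x, x ∈ K ↔ Good S x ∧ (A < x.1 ∨ x.1 = A ∧ Marked n A s x)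
  marks : ∀ i, s.arr 15 i = 0 ∨ (A + 1 ≤ s.arr 15 i ∧ s.arr 15 i ≤ n + n)

/-- Mark the box given by the registers `3`, `10`, `12`, `11`, and report it if it is good. -/
def emit : Program :=
  .cond (.not (.eq (.cell 15 (idx (.reg 10) (.reg 12))) (.add (.reg 3) (.const 1))))
    (.seq (.store 15 (idx (.reg 10) (.reg 12)) (.add (.reg 3) (.const 1)))
      (.cond (.eq (countExpr (.cell 0 (.cell 3 (.add (.reg 3) (.const 1))))
          (.cell 1 (.cell 3 (.reg 10))) (.cell 4 (.cell 7 (.add (.reg 12) (.const 1))))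
          (.cell 5 (.cell 7 (.reg 11)))) (.reg 0))
        (.report (.cell 3 (.add (.reg 3) (.const 1))) (.cell 3 (.reg 10))
          (.cell 7 (.add (.reg 12) (.const 1))) (.cell 7 (.reg 11)))
        .skip))
    .skip

variable {S}

/-- Provides the order hypotheses of `Val.countExpr` for the rectangle of the plane. -/
theorem Ranked.Tight.bounds {x : ℕ × ℕ × ℕ × ℕ} (h : (ranked S).Tight x) :
    countLt (xkey S) (n + n) ((ranked S).quad x).1 ≤
        countLe (xkey S) (n + n) ((ranked S).quad x).2.1 ∧
      countLt (ykey S) (n + n) ((ranked S).quad x).2.2.1 ≤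
        countLe (ykey S) (n + n) ((ranked S).quad x).2.2.2 := by
  have a1 := (ranked S).px_spec (x.1 + 1) (by omega) h.hA
  have a2 := (ranked S).px_spec x.2.1 h.hB.1 h.hB.2
  have a3 := (ranked S).py_spec (x.2.2.1 + 1) (by omega) h.hC
  have a4 := (ranked S).py_spec x.2.2.2 h.hD.1 h.hD.2
  have b1 := (countLt_lt_rank (v := xkey S) a1.1).mpr le_rfl
  have b2 := (rank_le_countLe (v := xkey S) a2.1).mpr le_rfl
  have b3 := (countLt_lt_rank (v := ykey S) a3.1).mpr le_rfl
  have b4 := (rank_le_countLe (v := ykey S) a4.1).mpr le_rfl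
  change _ < (ranked S).X _ at b1
  change (ranked S).X _ ≤ _ at b2
  change _ < (ranked S).Y _ at b3
  change (ranked S).Y _ ≤ _ at b4
  have c := h.right
  have c' := h.top
  unfold Ranked.InBox at c c'
  unfold Ranked.quad
  simp only
  omega

theorem idx_inj {N a c a' c' : ℕ} (hc : c ≤ N) (hc' : c' ≤ N)
    (h : a * (N + 1) + c = a' * (N + 1) + c') : a = a' ∧ c = c' := by
  have h1 : (a * (N + 1) + c) / (N + 1) = a := by
    rw [mul_comm, Nat.mul_add_div (by omega), Nat.div_eq_of_lt (by omega), add_zero]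
  have h2 : (a' * (N + 1) + c') / (N + 1) = a' := by
    rw [mul_comm, Nat.mul_add_div (by omega), Nat.div_eq_of_lt (by omega), add_zero]
  have h3 : a = a' := by rw [← h1, h, h2]
  exact ⟨h3, by subst h3; omega⟩

/-- A box is marked when it is found, even if ties prevent it from being reported; so marks record
the search and goodness filters the output. -/
theorem runs_emit {m : ℕ} {P : Fin m → Point} {B : ℕ} (hB : WordBound n B) {s : State}
    (hs : Ready S s) {x : ℕ × ℕ × ℕ × ℕ} (hx : (ranked S).Tight x) (h3 : s.reg 3 = x.1)
    (h10 : s.reg 10 = x.2.1) (h12 : s.reg 12 = x.2.2.1) (h11 : s.reg 11 = x.2.2.2)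
    (hr : Reported S x.1 s) :
    Runs P B emit s 120 fun s' => s'.reg = s.reg ∧ (∀ a ≠ 15, s'.arr a = s.arr a) ∧
      Reported S x.1 s' ∧ Marked n x.1 s' x ∧ ∀ y, Marked n x.1 s y → Marked n x.1 s' y := by
  obtain ⟨A, b, C, D⟩ := x
  simp only at h3 h10 h12 h11 hr ⊢
  have hA := hx.hA
  have hb := hx.hB
  have hC := hx.hC
  have hD := hx.hD
  simp only at hA hb hC hD
  have a1 := (ranked S).px_spec (A + 1) (by omega) (by omega)
  have a2 := (ranked S).px_spec b hb.1 hb.2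
  have a3 := (ranked S).py_spec (C + 1) (by omega) (by omega)
  have a4 := (ranked S).py_spec D hD.1 hD.2
  have hsm := hB.small
  obtain ⟨K, k1, k2, k3⟩ := hr.list
  set i := b * (n + n + 1) + C with hi
  have hidx : Val B s (idx (.reg 10) (.reg 12)) i :=
    Val.idx hB hs.width (.reg h10 (by omega)) (.reg h12 (by omega)) (by omega) (by omega)
  have hA1 : Val B s (.add (.reg 3) (.const 1)) (A + 1) :=
    (Val.reg h3 (by omega)).add (.const (by omega)) (by omega)
  have hm := hr.marks i
  have hmark : Marked n A s (A, b, C, D) ↔ s.arr 15 i = A + 1 := Iff.rfl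
  -- For the current left side, a cell of the mark table belongs to at most one tight box.
  have hsame : ∀ y, (ranked S).Tight y → y.1 = A → y.2.1 * (n + n + 1) + y.2.2.1 = i →
      y = (A, b, C, D) := by
    intro y hy h1 h2
    have := idx_inj (by have := hy.hC; omega) (by omega) h2
    exact hy.eq_of_three _ hx h1 this.1 this.2
  refine (Tests.runs_cond (T₁ := 100) (T₂ := 1)
    (Tests.not (Tests.eq (hidx.cell (a := 15) rfl (by omega)) hA1))
    (fun hne => ?_) (fun heq => ?_)).of_le (by decide)
  · set s₁ := s.setArr 15 i (A + 1) with hs1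
    have hs₁ : Ready S s₁ := hs.setArr (by omega)
    have hA2 : Val B s₁ (.cell 3 (.add (.reg 3) (.const 1))) ((ranked S).PX (A + 1)) :=
      ((Val.reg (s := s₁) h3 (by omega)).add (.const (by omega)) (by omega)).cell
        (hs₁.px _ (by omega) (by omega)) (by omega)
    have hb2 : Val B s₁ (.cell 3 (.reg 10)) ((ranked S).PX b) :=
      (Val.reg (s := s₁) h10 (by omega)).cell (hs₁.px _ hb.1 hb.2) (by omega)
    have hC2 : Val B s₁ (.cell 7 (.add (.reg 12) (.const 1))) ((ranked S).PY (C + 1)) :=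
      ((Val.reg (s := s₁) h12 (by omega)).add (.const (by omega)) (by omega)).cell
        (hs₁.py _ (by omega) (by omega)) (by omega)
    have hD2 : Val B s₁ (.cell 7 (.reg 11)) ((ranked S).PY D) :=
      (Val.reg (s := s₁) h11 (by omega)).cell (hs₁.py _ hD.1 hD.2) (by omega)
    have bds := Ranked.Tight.bounds hx
    simp only [Ranked.quad] at bds
    have l1 := countLt_le (xkey S) (n + n) ((ranked S).PX (A + 1))
    have l2 := countLe_le (xkey S) (n + n) ((ranked S).PX b)
    have l3 := countLt_le (ykey S) (n + n) ((ranked S).PY (C + 1))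
    have l4 := countLe_le (ykey S) (n + n) ((ranked S).PY D)
    have hcount : Val B s₁ (countExpr (.cell 0 (.cell 3 (.add (.reg 3) (.const 1))))
          (.cell 1 (.cell 3 (.reg 10))) (.cell 4 (.cell 7 (.add (.reg 12) (.const 1))))
          (.cell 5 (.cell 7 (.reg 11)))) (spanCount S ((ranked S).quad (A, b, C, D))) :=
      Val.countExpr hB hs₁ (hA2.cell (hs₁.xlt _ a1.1) ((countLt_le _ _ _).trans (by omega)))
        (hb2.cell (hs₁.xle _ a2.1) ((countLe_le _ _ _).trans (by omega)))
        (hC2.cell (hs₁.ylt _ a3.1) ((countLt_le _ _ _).trans (by omega)))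
        (hD2.cell (hs₁.yle _ a4.1) ((countLe_le _ _ _).trans (by omega))) bds.1 l2 bds.2 l4
    have hmarks : ∀ j, s₁.arr 15 j = 0 ∨ (A + 1 ≤ s₁.arr 15 j ∧ s₁.arr 15 j ≤ n + n) := by
      intro j
      simp only [hs1, setArr_arr, true_and]
      split_ifs
      · right; omega
      · exact hr.marks j
    have harr : ∀ a ≠ 15, s₁.arr a = s.arr a := by
      intro a ha
      funext j
      simp [hs1, ha]
    have hmk : ∀ y, Marked n A s₁ y ↔ Marked n A s y ∨ y.2.1 * (n + n + 1) + y.2.2.1 = i := by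
      intro y
      simp only [Marked, hs1, setArr_arr, true_and]
      split_ifs with h
      · simp [h]
      · simp [h]
    have hrep : ∀ y, Good S y → (Marked n A s₁ y ∧ y.1 = A ↔
        Marked n A s y ∧ y.1 = A ∨ y = (A, b, C, D)) := by
      intro y hy
      rw [hmk]
      constructor
      · rintro ⟨h | h, h1⟩
        · exact Or.inl ⟨h, h1⟩
        · exact Or.inr (hsame y hy.1 h1 h)
      · rintro (h | rfl)
        · exact ⟨Or.inl h.1, h.2⟩
        · exact ⟨Or.inr rfl, rfl⟩
    have hfin : Marked n A s₁ (A, b, C, D) := (hmk _).mpr (Or.inr rfl)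
    have hmono : ∀ y, Marked n A s y → Marked n A s₁ y := fun y hy => (hmk y).mpr (Or.inl hy)
    refine (runs_seq (Val.runs_store hidx hA1 (Tests.runs_cond
      (Tests.eq hcount (.reg hs₁.n_eq (by omega)))
      (fun hg => runs_report hA2.1 hb2.1 hC2.1 hD2.1 ?_)
      (fun hg => runs_skip ?_)))).of_le (by decide)
    · refine ⟨rfl, harr, ⟨⟨K ++ [(A, b, C, D)], ?_, ?_, ?_⟩, hmarks⟩, hfin, hmono⟩
      · rw [hA2.2, hb2.2, hC2.2, hD2.2, report_out, List.map_append, ← k1]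
        rfl
      · rw [List.nodup_append]
        refine ⟨k2, List.nodup_singleton _, ?_⟩
        intro y hy z hz hyz
        rw [List.mem_singleton] at hz
        rw [hyz, hz, k3, hmark] at hy
        rcases hy.2 with h | h
        · simp at h
        · exact hne h.2
      · intro y
        rw [List.mem_append, List.mem_singleton, k3]
        change _ ↔ Good S y ∧ (A < y.1 ∨ y.1 = A ∧ Marked n A s₁ y)
        constructor
        · rintro (⟨h1, h2⟩ | rfl)
          · refine ⟨h1, h2.imp id fun h => ⟨h.1, hmono y h.2⟩⟩
          · exact ⟨⟨hx, hg⟩, Or.inr ⟨rfl, hfin⟩⟩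
        · rintro ⟨h1, h2 | h2⟩
          · exact Or.inl ⟨h1, Or.inl h2⟩
          · rcases (hrep y h1).mp h2.symm with h | h
            · exact Or.inl ⟨h1, Or.inr h.symm⟩
            · exact Or.inr h
    · refine ⟨rfl, harr, ⟨⟨K, k1, k2, fun y => ?_⟩, hmarks⟩, hfin, hmono⟩
      rw [k3]
      refine and_congr_right fun hy => or_congr_right ?_
      have := hrep y hy
      constructor
      · rintro ⟨h1, h2⟩
        exact ⟨h1, hmono y h2⟩
      · rintro ⟨h1, h2⟩
        rcases this.mp ⟨h2, h1⟩ with h | rfl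
        · exact h.symm
        · exact absurd hy.2 hg
  · exact runs_skip ⟨rfl, fun _ _ => rfl, hr, not_not.mp heq, fun _ h => h⟩

end Emit

/-! ### Examination of one free window. -/

section Examine

variable {n : ℕ} (S : Fin n → Segment)

/-- Examine the window `(A, b) × (c, h)`, where `A`, `b`, `c`, `h` are in the registers `3`, `4`,
`7`, `9`: if it contains `n` endpoints, the one with `x`-rank `A + 1` included, then shrink it to
a tight box, and report that. -/
def examine : Program :=
  .seq (.assign 10 (.sub (.reg 4) (.const 1))) (.seq (.assign 11 (.sub (.reg 9) (.const 1)))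
    (.cond (.and (.lt (.reg 7) (.cell 6 (.cell 3 (.add (.reg 3) (.const 1)))))
        (.and (.lt (.cell 6 (.cell 3 (.add (.reg 3) (.const 1)))) (.reg 9))
          (.eq (countExpr (.reg 3) (.reg 10) (.reg 7) (.reg 11)) (.reg 0))))
      (.seq (search 10 3 10 true (.eq (countExpr (.reg 3) (.reg 15) (.reg 7) (.reg 11)) (.reg 0)))
        (.seq (search 12 7 11 false
            (.not (.eq (countExpr (.reg 3) (.reg 10) (.reg 15) (.reg 11)) (.reg 0))))
          (.seq (search 11 12 11 true
              (.eq (countExpr (.reg 3) (.reg 10) (.reg 12) (.reg 15)) (.reg 0)))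
            emit)))
      .skip))

/-- The time for examining a window. -/
def examineTime (n : ℕ) : ℕ := 133 * Nat.clog 2 (n + n + 1) + 300

variable {S}

/-- A window that fails the test contains no tight box with left side A: such a box has n endpoints,
a free window has no more, and the box contains the endpoint of rank A + 1. Otherwise the box found
is the only one, by `tight_of_shrink`. -/
theorem runs_examine {m : ℕ} {P : Fin m → Point} {B : ℕ} (hB : WordBound n B) {s : State}
    (hs : Ready S s) {A b c h : ℕ} (h3 : s.reg 3 = A) (h4 : s.reg 4 = b) (h7 : s.reg 7 = c)
    (h9 : s.reg 9 = h) (hA : A < n + n) (hAb : A + 1 < b) (hb : b ≤ n + n + 1) (hch : c < h)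
    (hh : h ≤ n + n + 1) (hfree : (ranked S).WFree A b c h) (hr : Reported S A s) :
    Runs P B examine s (examineTime n) fun s' => (∀ x < 10, s'.reg x = s.reg x) ∧
      (∀ a ≠ 15, s'.arr a = s.arr a) ∧ Reported S A s' ∧
      (∀ y, Marked n A s y → Marked n A s' y) ∧
      ∀ y, (ranked S).Tight y → y.1 = A → y.2.1 < b → c ≤ y.2.2.1 → y.2.2.2 < h →
        Marked n A s' y := by
  have hsm := hB.small
  have hn := hB.pos
  have hF : (ranked S).Free A (b - 1) c (h - 1) := ((ranked S).wfree_iff_free _ _ _ _).mp hfree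
  set s₁ := s.setReg 10 (b - 1) with hs1
  set s₂ := s₁.setReg 11 (h - 1) with hs2
  have hs₁ : Ready S s₁ := hs.setReg (by omega)
  have hs₂ : Ready S s₂ := hs₁.setReg (by omega)
  have q3 : s₂.reg 3 = A := by simp [hs1, hs2, h3]
  have q4 : s₂.reg 4 = b := by simp [hs1, hs2, h4]
  have q7 : s₂.reg 7 = c := by simp [hs1, hs2, h7]
  have q9 : s₂.reg 9 = h := by simp [hs1, hs2, h9]
  have q10 : s₂.reg 10 = b - 1 := by simp [hs1, hs2]
  have q11 : s₂.reg 11 = h - 1 := by simp [hs2]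
  have qlt : ∀ x < 10, s₂.reg x = s.reg x := fun x hx => by
    simp only [hs1, hs2, setReg_reg]; rw [if_neg (by omega), if_neg (by omega)]
  have a1 := (ranked S).px_spec (A + 1) (by omega) (by omega)
  have a2 := (ranked S).y_spec _ a1.1
  have hY : Val B s₂ (.cell 6 (.cell 3 (.add (.reg 3) (.const 1))))
      ((ranked S).Y ((ranked S).PX (A + 1))) :=
    (((Val.reg q3 (by omega)).add (.const (by omega)) (by omega)).cell
      (hs₂.px _ (by omega) (by omega)) (by omega)).cell (hs₂.y _ a1.1) (by omega)
  refine (runs_seq (Val.runs_assign (v := b - 1) ((Val.reg h4 (by omega)).sub (.const (by omega)))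
    (runs_seq (Val.runs_assign (v := h - 1) ((Val.reg (s := s₁) (by simp [hs1, h9])
      (by omega)).sub (.const (by omega)))
    (Tests.runs_cond (Tests.and (Tests.lt (.reg q7 (by omega)) hY) (Tests.and
      (Tests.lt hY (.reg q9 (by omega))) (Tests.eq (Val.countExpr hB hs₂ (.reg q3 (by omega))
        (.reg q10 (by omega)) (.reg q7 (by omega)) (.reg q11 (by omega)) (by omega) (by omega)
        (by omega) (by omega)) (.reg hs₂.n_eq (by omega)))))
      -- A comparison of `countExpr` with n costs 29, its negation 30, and `runs_bisect` adds 15 for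
      -- each round; 44 + 45 + 44 = 133.
      (T₁ := (44 * Nat.clog 2 (n + n + 1) + 11) + ((45 * Nat.clog 2 (n + n + 1) + 11) +
        ((44 * Nat.clog 2 (n + n + 1) + 11) + 120))) (T₂ := 1)
      (fun hc => ?_) (fun hc => ?_)))))).of_le ?_
  · obtain ⟨hc1, hc2, hcnt⟩ := hc
    refine runs_seq ((runs_search (V := fun k => (ranked S).cnt A k c (h - 1) = n)
      (u := A) (v := b - 1) (M := n + n + 1) (by omega) (by omega) q3 q10 (by omega) (by omega)
      ?_ (by omega) ?_ hcnt).imp ?_)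
    · intro s' e1 e2 e3 e4
      have r' : Ready S s' := hs₂.congr (fun x hx => e2 x (by omega)) fun a _ => by rw [e1]
      exact Tests.eq (Val.countExpr hB r' (.reg ((e2 3 (by omega)).trans q3) (by omega))
        (.reg rfl (by omega)) (.reg ((e2 7 (by omega)).trans q7) (by omega))
        (.reg ((e2 11 (by omega)).trans q11) (by omega)) e3 (by omega) (by omega) (by omega))
        (.reg r'.n_eq (by omega))
    · rw [(ranked S).cnt_eq_zero (Or.inl le_rfl)]; omega
    rintro s₃ ⟨i1, i2, i3, k, hk1, hk2, hk3, hk4, hk5⟩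
    rw [if_pos rfl] at hk5
    have hs₃ : Ready S s₃ := hs₂.congr (fun x hx => i3 x (by omega) (by omega))
      fun a _ => by rw [i1]
    refine runs_seq ((runs_search (V := fun j => ¬ (ranked S).cnt A (k + 1) j (h - 1) = n)
      (u := c) (v := h - 1) (M := n + n + 1) (by omega) (by omega)
      ((i3 7 (by omega) (by omega)).trans q7) ((i3 11 (by omega) (by omega)).trans q11)
      (by omega) (by omega) ?_ ?_ (not_not.mpr hk4) ?_).imp ?_)
    · intro s' e1 e2 e3 e4
      have r' : Ready S s' := hs₃.congr (fun x hx => e2 x (by omega)) fun a _ => by rw [e1]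
      exact Tests.not (Tests.eq (Val.countExpr hB r'
        (.reg ((e2 3 (by omega)).trans ((i3 3 (by omega) (by omega)).trans q3)) (by omega))
        (.reg ((e2 10 (by omega)).trans hk5) (by omega)) (.reg rfl (by omega))
        (.reg ((e2 11 (by omega)).trans ((i3 11 (by omega) (by omega)).trans q11)) (by omega))
        (by omega) (by omega) e4 (by omega)) (.reg r'.n_eq (by omega)))
    · by_contra hcc
      rw [(ranked S).cnt_eq_zero (Or.inr (by omega))] at hk4; omega
    · rw [(ranked S).cnt_eq_zero (Or.inr le_rfl)]; omega
    rintro s₄ ⟨j1, j2, j3, C, hC1, hC2, hC3, hC4, hC5⟩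
    rw [if_neg (by simp)] at hC5
    rw [not_not] at hC3
    have hs₄ : Ready S s₄ := hs₃.congr (fun x hx => j3 x (by omega) (by omega))
      fun a _ => by rw [j1]
    have w3 : s₄.reg 3 = A := (j3 3 (by omega) (by omega)).trans
      ((i3 3 (by omega) (by omega)).trans q3)
    have w10 : s₄.reg 10 = k + 1 := (j3 10 (by omega) (by omega)).trans hk5
    have w11 : s₄.reg 11 = h - 1 := (j3 11 (by omega) (by omega)).trans
      ((i3 11 (by omega) (by omega)).trans q11)
    refine runs_seq ((runs_search (V := fun j => (ranked S).cnt A (k + 1) C j = n)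
      (u := C) (v := h - 1) (M := n + n + 1) (by omega) (by omega) hC5 w11
      (by omega) (by omega) ?_ hC2 ?_ hC3).imp ?_)
    · intro s' e1 e2 e3 e4
      have r' : Ready S s' := hs₄.congr (fun x hx => e2 x (by omega)) fun a _ => by rw [e1]
      exact Tests.eq (Val.countExpr hB r' (.reg ((e2 3 (by omega)).trans w3) (by omega))
        (.reg ((e2 10 (by omega)).trans w10) (by omega))
        (.reg ((e2 12 (by omega)).trans hC5) (by omega)) (.reg rfl (by omega))
        (by omega) (by omega) e3 (by omega)) (.reg r'.n_eq (by omega))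
    · rw [(ranked S).cnt_eq_zero (Or.inr le_rfl)]; omega
    rintro s₅ ⟨l1, l2, l3, D, hD1, hD2, hD3, hD4, hD5⟩
    rw [if_pos rfl] at hD5
    have hs₅ : Ready S s₅ := hs₄.congr (fun x hx => l3 x (by omega) (by omega))
      fun a _ => by rw [l1]
    have harr : s₅.arr = s.arr := by rw [l1, j1, i1]; rfl
    have hout : s₅.out = s.out := by rw [l2, j2, i2]; rfl
    obtain ⟨ht, huniq⟩ := (ranked S).tight_of_shrink (by omega) (by omega) (by omega) hF hcnt
      ⟨hc1, by omega⟩ (by omega) hk4 hk3 hC1 hC2 hC3 hC4 (by omega) hD4 hD3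
    have hrep : Reported S A s₅ := by
      refine ⟨?_, by rw [harr]; exact hr.marks⟩
      have := hr.list
      unfold Marked at *
      rw [hout, harr]
      exact this
    refine (runs_emit hB hs₅ ht ((l3 3 (by omega) (by omega)).trans w3)
      ((l3 10 (by omega) (by omega)).trans w10) ((l3 12 (by omega) (by omega)).trans hC5) hD5
      hrep).imp ?_
    rintro s₆ ⟨m1, m2, m3, m4, m5⟩
    refine ⟨fun x hx => ?_, fun a ha => (m2 a ha).trans (by rw [harr]), m3, fun y hy => m5 y ?_,
      fun y hy y1 y2 y3 y4 => ?_⟩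
    · rw [m1, l3 x (by omega) (by omega), j3 x (by omega) (by omega), i3 x (by omega) (by omega),
        qlt x hx]
    · unfold Marked at *
      rw [harr]; exact hy
    · rw [huniq y hy y1 (by omega) y3 (by omega)]
      exact m4
  · refine runs_skip ⟨qlt, fun _ _ => rfl, ⟨hr.list, hr.marks⟩, fun y hy => hy, ?_⟩
    intro y hy y1 y2 y3 y4
    exfalso
    subst y1
    have g1 := hy.stab.cnt_eq
    have g2 := (ranked S).cnt_mono (le_refl y.1) (show y.2.1 ≤ b - 1 by omega) y3
      (show y.2.2.2 ≤ h - 1 by omega)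
    have g3 := Ranked.Free.cnt_le _ hF
    have g4 := hy.left
    unfold Ranked.InBox at g4
    exact hc ⟨by omega, by omega, by omega⟩
  · simp only [examineTime, Expr.cost, Test.cost, countExpr, idx]
    omega

end Examine

/-! ### Examination of a run of consecutive windows. -/

section Flush

variable {n : ℕ} {S : Fin n → Segment}

/-- Examine the windows whose lower ends belong to the chain and are less than register `8`,
starting from register `7`. -/
def flush : Program :=
  .loop (.lt (.reg 7) (.reg 8)) (.seq (.assign 9 (.cell 10 (.cell 14 (.reg 7))))
    (.seq examine (.assign 7 (.cell 14 (.reg 7)))))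

theorem Ranked.IsUpper.le {I : Ranked n} {HW : ℕ → ℕ} (h : I.IsUpper HW) {A b : ℕ}
    {nxt : ℕ → ℕ} {K : Finset ℕ} (hK : I.Chain HW A b nxt K) {u : ℕ} (hu : u ∈ K) :
    u < HW (nxt u) ∧ HW (nxt u) ≤ n + n + 1 := by
  have hlt := hK.lt_nxt u hu
  have hle := hK.le u hu
  rcases hK.nxt_mem u hu with h1 | h1
  · obtain ⟨t, ht, htl⟩ := hK.src _ h1 (by omega)
    have := I.lo_spec ht.1
    rw [← htl, h.lo t ht.1]
    omega
  · rw [h1, h.last]; omega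

theorem Ranked.Chain.nxt_le {I : Ranked n} {HW : ℕ → ℕ} {A b : ℕ}
    {nxt : ℕ → ℕ} {K : Finset ℕ} (hK : I.Chain HW A b nxt K) {u : ℕ} (hu : u ∈ K) :
    nxt u ≤ n + n + 1 := by
  rcases hK.nxt_mem u hu with h1 | h1
  · have := hK.le _ h1; omega
  · exact h1.le

/-- The tight boxes with left side `A` and right side before `b` that fit into the window
`(c, h)` are marked. -/
def Covered (S : Fin n → Segment) (A b c h : ℕ) (s : State) : Prop :=
  ∀ y, (ranked S).Tight y → y.1 = A → y.2.1 < b → c ≤ y.2.2.1 → y.2.2.2 < h → Marked n A s y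

/-- The time is proportional to the number of windows passed, which is what the amortization in
`runs_sweepStep` needs. Examination changes neither register 7 nor the links in array 14, so the
walk along the list can go on. -/
theorem runs_flush {m : ℕ} {P : Fin m → Point} {B : ℕ} (hB : WordBound n B) {s : State}
    (hs : Ready S s) {A b c l : ℕ} {K : Finset ℕ} (h3 : s.reg 3 = A) (h4 : s.reg 4 = b)
    (h7 : s.reg 7 = c) (h8 : s.reg 8 = l) (hA : A < n + n) (hAb : A + 1 < b)
    (hb : b ≤ n + n + 1) (hl : l ≤ n + n + 1) (hc : c ∈ K ∨ c = n + n + 1)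
    (hK : (ranked S).Chain (s.arr 10) A b (s.arr 14) K) (hr : Reported S A s) :
    Runs P B flush s
      ((examineTime n + 10) * (K.filter fun u => c ≤ u ∧ u < l).card + 3) fun s' =>
      (∀ x < 7, s'.reg x = s.reg x) ∧ (∀ a ≠ 15, s'.arr a = s.arr a) ∧ Reported S A s' ∧
      (∀ y, Marked n A s y → Marked n A s' y) ∧ (s'.reg 7 ∈ K ∨ s'.reg 7 = n + n + 1) ∧
      l ≤ s'.reg 7 ∧ (∀ u ∈ K, c ≤ u → u < s'.reg 7 → u < l) ∧
      ∀ u ∈ K, c ≤ u → u < l → Covered S A b u (s.arr 10 (s.arr 14 u)) s' := by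
  have hsm := hB.small
  refine runs_loop (fun φ s' => ((∀ x < 7, s'.reg x = s.reg x) ∧ s'.reg 8 = l ∧
      (∀ a ≠ 15, s'.arr a = s.arr a) ∧ Reported S A s' ∧
      (∀ y, Marked n A s y → Marked n A s' y) ∧ (s'.reg 7 ∈ K ∨ s'.reg 7 = n + n + 1) ∧
      (∀ u ∈ K, c ≤ u → u < s'.reg 7 → u < l ∧
        Covered S A b u (s.arr 10 (s.arr 14 u)) s') ∧ c ≤ s'.reg 7) ∧
      φ = (examineTime n + 10) * (K.filter fun u => s'.reg 7 ≤ u ∧ u < l).card + 3)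
    ?_ _ _ ⟨⟨fun _ _ => rfl, h8, fun _ _ => rfl, hr, fun _ h => h, h7 ▸ hc,
      fun u _ h1 h2 => absurd h2 (by omega), h7.ge⟩, by rw [h7]⟩ (by simp [Test.cost])
  rintro φ s' ⟨⟨i1, i2, i3, i4, i5, i6, i7, i8⟩, rfl⟩
  have hs' : Ready S s' := hs.congr (fun x hx => i1 x (by omega)) fun a ha => i3 a (by omega)
  have le7 : s'.reg 7 ≤ n + n + 1 := by
    rcases i6 with h | h
    · have := hK.le _ h; omega
    · omega
  have hT : Tests P B s' (.lt (.reg 7) (.reg 8)) (s'.reg 7 < l) :=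
    Tests.lt (.reg rfl (by omega)) (.reg i2 (by omega))
  refine ⟨hT.1, by simp [Test.cost, Expr.cost], ?_, ?_⟩
  · intro hn
    have hn' : l ≤ s'.reg 7 := not_lt.mp fun h => hn (hT.2.mpr h)
    exact ⟨i1, i3, i4, i5, i6, hn', fun u hu h1 h2 => (i7 u hu h1 h2).1,
      fun u hu h1 h2 => (i7 u hu h1 (by omega)).2⟩
  · intro hy
    have hy' : s'.reg 7 < l := hT.2.mp hy
    set v := s'.reg 7 with hv
    have hvK : v ∈ K := i6.resolve_right (by omega)
    have hup := hs.upper.le hK hvK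
    have hnx := hK.nxt_le hvK
    set w := s.arr 14 v with hw
    set h := s.arr 10 w with hh
    have b7 : s'.arr 14 v = w := by rw [i3 14 (by omega)]
    have b9 : s'.arr 10 w = h := by rw [i3 10 (by omega)]
    set s₁ := s'.setReg 9 h with hs1
    have hs₁ : Ready S s₁ := hs'.setReg (by omega)
    refine ⟨4 + (examineTime n + 3), runs_seq (T₁ := 4) (Val.runs_assign (v := h)
      (((Val.reg rfl (by omega)).cell b7 (by omega)).cell b9 (by omega))
      (runs_seq (T₂ := 3) ((runs_examine (A := A) (b := b) (c := v) (h := h) hB hs₁ ?_ ?_ ?_ ?_ hA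
        hAb hb hup.1 hup.2 (hK.free v hvK) ⟨i4.list, i4.marks⟩).imp ?_)))⟩
    · simp [hs1, i1, h3]
    · simp [hs1, i1, h4]
    · simp [hs1, hv]
    · simp [hs1]
    rintro s₂ ⟨j1, j2, j3, j4, j5⟩
    have k7 : s₂.reg 7 = v := by rw [j1 7 (by omega)]; simp [hs1, hv]
    have k14 : s₂.arr 14 v = w := by rw [j2 14 (by omega)]; exact b7
    -- No element of the chain lies strictly between `v` and its successor `w`, so a step removes
    -- exactly one window from the count.
    have hcard : (K.filter fun u => v ≤ u ∧ u < l).card =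
        (K.filter fun u => w ≤ u ∧ u < l).card + 1 := by
      have : K.filter (fun u => v ≤ u ∧ u < l) =
          insert v (K.filter fun u => w ≤ u ∧ u < l) := by
        ext u
        simp only [Finset.mem_filter, Finset.mem_insert]
        constructor
        · rintro ⟨h1, h2, h3⟩
          rcases h2.eq_or_lt with h4 | h4
          · exact Or.inl h4.symm
          · exact Or.inr ⟨h1, hK.gap v hvK u h1 h4, h3⟩
        · rintro (rfl | ⟨h1, h2, h3⟩)
          · exact ⟨hvK, le_rfl, hy'⟩
          · have := hK.lt_nxt v hvK
            exact ⟨h1, by omega, h3⟩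
      rw [this, Finset.card_insert_of_notMem]
      have := hK.lt_nxt v hvK
      simp only [Finset.mem_filter]; omega
    refine Val.runs_assign (v := w) ((Val.reg k7 (by omega)).cell k14 (by omega))
      ⟨_, ⟨⟨fun x hx => ?_, ?_, fun a ha => ?_, ⟨j3.list, j3.marks⟩, fun y hy => j4 y (i5 y hy),
        ?_, ?_, ?_⟩, rfl⟩, ?_⟩
    · rw [setReg_reg, if_neg (by omega), j1 x (by omega), hs1, setReg_reg, if_neg (by omega),
        i1 x hx]
    · rw [setReg_reg, if_neg (by omega), j1 8 (by omega), hs1, setReg_reg, if_neg (by omega), i2]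
    · rw [setReg_arr, j2 a ha]; exact i3 a ha
    · rw [setReg_reg, if_pos rfl]; exact hK.nxt_mem v hvK
    · rw [setReg_reg, if_pos rfl]
      intro u hu hcu huw
      by_cases huv : u < v
      · exact ⟨(i7 u hu hcu huv).1,
          fun y y1 y2 y3 y4 y5 => j4 y ((i7 u hu hcu huv).2 y y1 y2 y3 y4 y5)⟩
      · have : u = v := by
          by_contra hne
          have := hK.gap v hvK u hu (by omega)
          omega
        subst this
        exact ⟨hy', fun y y1 y2 y3 y4 y5 => j5 y y1 y2 y3 y4 y5⟩
    · rw [setReg_reg, if_pos rfl]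
      have := hK.lt_nxt v hvK
      omega
    · simp only [setReg_reg, if_true, hcard, Test.cost, Expr.cost]
      rw [Nat.mul_succ]
      omega

end Flush

/-! ### The sweep of the right side for a fixed left side. -/

section Sweep

variable {n : ℕ} (S : Fin n → Segment)

/-- Insert the segment whose right endpoint has the `x`-rank in register `4`, if there is such a
segment and if it is to the right of the left side. -/
def sweepStep : Program :=
  .seq (.assign 5 (.cell 3 (.reg 4))) (.seq (.assign 6 (.cell 12 (.reg 5)))
    (.cond (.and (.lt (.reg 3) (.cell 2 (.reg 6))) (.and (.lt (.cell 2 (.reg 6)) (.reg 4))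
        (.lt (.cell 13 (.reg 5)) (.cell 8 (.reg 5)))))
      (.seq (.assign 7 (.cell 13 (.reg 5))) (.seq (.assign 8 (.cell 8 (.reg 5)))
        (.seq flush (.seq (.store 14 (.cell 13 (.reg 5)) (.cell 8 (.reg 5)))
          (.store 14 (.cell 8 (.reg 5)) (.reg 7))))))
      .skip))

/-- The state of the sweep with left side `A` before the point with rank `b` is processed. -/
structure Sweep (A b : ℕ) (K : Finset ℕ) (s : State) : Prop where
  ready : Ready S s
  left : s.reg 3 = A
  cur : s.reg 4 = b
  chain : (ranked S).Chain (s.arr 10) A b (s.arr 14) K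
  start : ∀ e < n + n, (ranked S).FSpec A ((ranked S).X e) ((ranked S).hi e) (s.arr 13 e)
  reported : Reported S A s
  found : ∀ y, (ranked S).Tight y → y.1 = A → y.2.1 < b →
    Marked n A s y ∨ (ranked S).WFree A b y.2.2.1 (y.2.2.2 + 1)

variable {S}

theorem Ranked.FSpec.le {I : Ranked n} {A b h f : ℕ} (hf : I.FSpec A b h f) : f ≤ n + n := by
  rcases hf.2 with rfl | ⟨t, ht, -, rfl⟩
  · omega
  · have := I.lo_spec ht.1; omega

theorem Ranked.Tight.wfree {I : Ranked n} {y : ℕ × ℕ × ℕ × ℕ} (h : I.Tight y) :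
    I.WFree y.1 (y.2.1 + 1) y.2.2.1 (y.2.2.2 + 1) :=
  (I.wfree_iff_free _ _ _ _).mpr h.stab.free

/-- A box whose right side is b enters consideration now; it is free, so its window contains no
segment inserted so far. -/
theorem Sweep.found_succ {A b : ℕ} {K : Finset ℕ} {s : State} (h : Sweep S A b K s)
    {y : ℕ × ℕ × ℕ × ℕ} (hy : (ranked S).Tight y) (h1 : y.1 = A) (h2 : y.2.1 < b + 1) :
    Marked n A s y ∨ (ranked S).WFree A b y.2.2.1 (y.2.2.2 + 1) := by
  by_cases hlt : y.2.1 < b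
  · exact h.found y hy h1 hlt
  · right
    have := hy.wfree
    rw [h1, show y.2.1 = b by omega] at this
    exact fun e he => this e (he.mono _ (by omega))

/-- The size of the chain serves as potential: removed windows pay for their examination. A box not
found so far whose window the new segment spoils lies in one of the maximal windows flushed in this
step. -/
theorem runs_sweepStep {m : ℕ} {P : Fin m → Point} {B : ℕ} (hB : WordBound n B) {s : State}
    {A b : ℕ} {K : Finset ℕ} (hA : A < n + n) (hb1 : 1 ≤ b) (hb : b ≤ n + n)
    (h : Sweep S A b K s) :
    ∃ T K', Runs P B sweepStep s T (fun s' => s'.reg 4 = b ∧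
        Sweep S A (b + 1) K' (s'.setReg 4 (b + 1)) ∧ s'.arr 13 = s.arr 13) ∧
      T + (examineTime n + 10) * K'.card ≤ (examineTime n + 10) * (K.card + 2) + 60 := by
  have hsm := hB.small
  have hs := h.ready
  have r1 := (ranked S).px_spec b hb1 hb
  set e := (ranked S).PX b with he
  have p1 := partner_lt r1.1
  set p := partner n e with hp
  have xe := (ranked S).x_spec e r1.1
  have xp := (ranked S).x_spec p p1
  have lo1 := (ranked S).lo_spec r1.1
  have hf := h.start e r1.1
  have hfle := hf.le
  set f := s.arr 13 e with hfdef
  rw [r1.2] at hf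
  set l := (ranked S).lo e with hldef
  set s₁ := s.setReg 5 e with hs1
  set s₂ := s₁.setReg 6 p with hs2
  have hs₁ : Ready S s₁ := hs.setReg (by omega)
  have hs₂ : Ready S s₂ := hs₁.setReg (by omega)
  have q3 : s₂.reg 3 = A := by simp [hs1, hs2, h.left]
  have q4 : s₂.reg 4 = b := by simp [hs1, hs2, h.cur]
  have q5 : s₂.reg 5 = e := by simp [hs1, hs2]
  have q6 : s₂.reg 6 = p := by simp [hs2]
  have vX : Val B s₂ (.cell 2 (.reg 6)) ((ranked S).X p) :=
    (Val.reg q6 (by omega)).cell (hs₂.x p p1) (by omega)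
  have vF : Val B s₂ (.cell 13 (.reg 5)) f := (Val.reg q5 (by omega)).cell rfl (by omega)
  have vL : Val B s₂ (.cell 8 (.reg 5)) l :=
    (Val.reg q5 (by omega)).cell (hs₂.lo e r1.1) (by omega)
  have hTest := Tests.and (P := P) (Tests.lt (.reg q3 (by omega)) vX)
    (Tests.and (Tests.lt vX (.reg q4 (by omega))) (Tests.lt vF vL))
  by_cases hcase : A < (ranked S).X p ∧ (ranked S).X p < b ∧ f < l
  · obtain ⟨hc1, hc2, hc3⟩ := hcase
    have hins : (ranked S).Ins A (b + 1) e :=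
      ⟨r1.1, hc1, hc2.trans_eq r1.2.symm, r1.2.trans_lt (by omega)⟩
    obtain ⟨hfK, hfh⟩ := h.chain.mem_of_fspec _ hins hf hc3
    set k := (K.filter fun u => f ≤ u ∧ u < l).card with hk
    set K' := insert l (K.filter fun u => ¬ (f < u ∧ u < l)) with hK'
    -- All examined windows except the one at `f` leave the chain, and only l enters it; hence the
    -- 2.
    have hcard : K'.card + k ≤ K.card + 2 := by
      have c1 : K'.card ≤ (K.filter fun u => ¬ (f < u ∧ u < l)).card + 1 :=
        Finset.card_insert_le _ _
      have c2 := Finset.card_filter_add_card_filter_not (s := K) (fun u => f < u ∧ u < l)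
      have c3 : K.filter (fun u => f ≤ u ∧ u < l) ⊆
          insert f (K.filter fun u => f < u ∧ u < l) := by
        intro u
        simp only [Finset.mem_filter, Finset.mem_insert]
        rintro ⟨h1, h2, h3⟩
        rcases h2.eq_or_lt with h4 | h4
        · exact Or.inl h4.symm
        · exact Or.inr ⟨h1, h4, h3⟩
      have c4 := (Finset.card_le_card c3).trans (Finset.card_insert_le _ _)
      omega
    refine ⟨3 + (3 + (15 + (3 + (3 + (((examineTime n + 10) * k + 3) + (5 + 4)))) + 1)), K', ?_, ?_⟩
    swap
    · have := Nat.mul_le_mul_left (examineTime n + 10) hcard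
      rw [Nat.mul_add] at this
      omega
    refine runs_seq (T₁ := 3) (Val.runs_assign (v := e) ((Val.reg h.cur (by omega)).cell
      (hs.px b hb1 hb) (by omega)) (runs_seq (T₁ := 3) (Val.runs_assign (v := p)
      ((Val.reg (s := s₁) (v := e) (by simp [hs1]) (by omega)).cell (hs₁.partner e r1.1) (by omega))
      (hTest.runs_cond (T₂ := 1) (fun _ => ?_) (fun hn => absurd ⟨hc1, hc2, hc3⟩ hn)))))
    set s₃ := s₂.setReg 7 f with hs3
    have hs₃ : Ready S s₃ := hs₂.setReg (by omega)
    set s₄ := s₃.setReg 8 l with hs4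
    have hs₄ : Ready S s₄ := hs₃.setReg (by omega)
    refine runs_seq (T₁ := 3) (vF.runs_assign (runs_seq (T₁ := 3) (Val.runs_assign (v := l)
      ((Val.reg (s := s₃) (v := e) (by simp [hs3, q5]) (by omega)).cell (hs₃.lo e r1.1) (by omega))
      (runs_seq ((runs_flush (A := A) (b := b) (c := f) (l := l) (K := K) hB hs₄ ?_ ?_ ?_ ?_ hA
        (by omega) (by omega) (by omega) (Or.inl hfK) h.chain
        ⟨h.reported.list, h.reported.marks⟩).imp ?_)))))
    · simp [hs4, hs3, q3]
    · simp [hs4, hs3, q4]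
    · simp [hs4, hs3]
    · simp [hs4]
    rintro s₅ ⟨j1, j2, j3, j4, j5, j6, j7, j8⟩
    have k3 : s₅.reg 3 = A := by rw [j1 3 (by omega)]; simp [hs4, hs3, q3]
    have k4 : s₅.reg 4 = b := by rw [j1 4 (by omega)]; simp [hs4, hs3, q4]
    have k5 : s₅.reg 5 = e := by rw [j1 5 (by omega)]; simp [hs4, hs3, q5]
    have hs₅ : Ready S s₅ := hs₄.congr (fun x hx => j1 x (by omega)) fun a ha => j2 a (by omega)
    have jarr : ∀ a ≠ 15, s₅.arr a = s.arr a := j2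
    set z := s₅.reg 7 with hz
    have hzle : z ≤ n + n + 1 := by
      rcases j5 with h1 | h1
      · have := h.chain.le _ h1; omega
      · omega
    -- The lower end l belongs to the new segment only, so it is not in the chain, and it is smaller
    -- than 2n + 1.
    have hlz : l < z := by
      refine lt_of_le_of_ne j6 fun hlz => ?_
      rcases j5 with h1 | h1
      · obtain ⟨t, ht, htl⟩ := h.chain.src _ h1 (by omega)
        have h4 := (ranked S).ins_ne r1.2 hins ht
        rcases (ranked S).lo_inj r1.1 ht.1 (by rw [htl, ← hlz]) with h5 | h5
        · exact h4.1 h5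
        · exact h4.2 h5
      · omega
    have vF5 : Val B s₅ (.cell 13 (.reg 5)) f :=
      (Val.reg k5 (by omega)).cell (by rw [jarr 13 (by omega)]) (by omega)
    have vL5 : Val B s₅ (.cell 8 (.reg 5)) l :=
      (Val.reg k5 (by omega)).cell (hs₅.lo e r1.1) (by omega)
    set s₆ := s₅.setArr 14 f l with hs6
    have hs₆ : Ready S s₆ := hs₅.setArr (by omega)
    refine runs_seq (T₁ := 5) (Val.runs_store vF5 vL5 (Val.runs_store (v := l) (w := z)
      ((Val.reg (s := s₆) k5 (by omega)).cell (hs₆.lo e r1.1) (by omega))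
      (Val.reg (s := s₆) rfl (by omega)) ⟨k4, ?_, ?_⟩))
    · have hs₇ : Ready S (s₆.setArr 14 l z) := hs₆.setArr (by omega)
      refine ⟨hs₇.setReg (by omega), ?_, ?_, ?_, ?_, ?_, ?_⟩
      · simp [k3]
      · simp
      · have e10 : ((s₆.setArr 14 l z).setReg 4 (b + 1)).arr 10 = s.arr 10 := by
          rw [← jarr 10 (by omega)]; funext j; simp [hs6]
        have e14 : ((s₆.setArr 14 l z).setReg 4 (b + 1)).arr 14 =
            Function.update (Function.update (s.arr 14) f l) l z := by
          rw [← jarr 14 (by omega)]; funext j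
          simp [hs6, Function.update_apply]
        rw [e10, e14]
        exact h.chain.insert_segment _ hs.upper hins r1.2 hf hc3 j5 hlz j7
      · have e13 : ((s₆.setArr 14 l z).setReg 4 (b + 1)).arr 13 = s.arr 13 := by
          rw [← jarr 13 (by omega)]; funext j; simp [hs6]
        rw [e13]
        exact h.start
      · have e15 : ((s₆.setArr 14 l z).setReg 4 (b + 1)).arr 15 = s₅.arr 15 := by
          funext j; simp [hs6]
        refine ⟨?_, by rw [e15]; exact j3.marks⟩
        have := j3.list
        unfold Marked at *
        rw [e15]
        exact this
      · have e15 : ((s₆.setArr 14 l z).setReg 4 (b + 1)).arr 15 = s₅.arr 15 := by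
          funext j; simp [hs6]
        have hmk : ∀ y, Marked n A ((s₆.setArr 14 l z).setReg 4 (b + 1)) y ↔ Marked n A s₅ y :=
          fun y => by unfold Marked; rw [e15]
        intro y hy y1 y2
        rw [hmk]
        rcases h.found_succ hy y1 y2 with h1 | h1
        · exact Or.inl (j4 y h1)
        · by_cases hin : y.2.2.1 < l ∧ (ranked S).hi e < y.2.2.2 + 1
          · left
            -- The box cannot have right side b, because it would then contain the new segment
            -- entirely.
            have hyb : y.2.1 < b := by
              by_contra hc
              have h5 := hy.wfree
              rw [y1, show y.2.1 = b by omega] at h5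
              exact h5 e hins hin
            have hyD := hy.hD
            -- The maximal window around the box reaches above the new segment, so it starts at `f`
            -- or later, and it starts below l; it was flushed.
            obtain ⟨w, hw, hw1, hw2⟩ := h.chain.cover _ _ (by omega) (by omega) h1
            have hfw := hf.le_of_window _ h.chain hw (by omega)
            exact j8 w hw hfw (by omega) y hy y1 hyb hw1 hw2
          · right
            rw [(ranked S).wfree_insert hins r1.2]
            exact ⟨h1, hin⟩
    · rw [← jarr 13 (by omega)]; funext j; simp
  · refine ⟨3 + (3 + (15 + 1 + 1)), K, ?_, by rw [Nat.mul_add]; omega⟩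
    refine runs_seq (T₁ := 3) (Val.runs_assign (v := e) ((Val.reg h.cur (by omega)).cell
      (hs.px b hb1 hb) (by omega)) (runs_seq (T₁ := 3) (Val.runs_assign (v := p)
      ((Val.reg (s := s₁) (v := e) (by simp [hs1]) (by omega)).cell (hs₁.partner e r1.1) (by omega))
      (hTest.runs_cond (T₁ := 1) (T₂ := 1) (fun hy => absurd hy hcase) (fun _ => runs_skip ?_)))))
    have hchain : (ranked S).Chain (s.arr 10) A (b + 1) (s.arr 14) K := by
      by_cases hins : (ranked S).Ins A (b + 1) e
      · refine h.chain.insert_of_lt _ hins r1.2 hf ?_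
        have h1 := hf.ne_lo _ hins r1.2
        have h2 := hins.2
        rw [r1.2] at h2
        by_contra hc
        exact hcase ⟨h2.1, h2.2.1, lt_of_le_of_ne (not_lt.mp hc) h1⟩
      · refine h.chain.congr _ fun t => ?_
        rw [(ranked S).ins_succ_iff]
        refine ⟨fun ht => ht.resolve_right ?_, Or.inl⟩
        rintro ⟨h1, h2⟩
        exact hins ((ranked S).x_inj h1.1 r1.1 (h2.trans r1.2.symm) ▸ h1)
    refine ⟨q4, ⟨hs₂.setReg (by omega), by simp [q3], by simp, hchain, h.start,
      ⟨h.reported.list, h.reported.marks⟩, ?_⟩, rfl⟩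
    intro y hy y1 y2
    change Marked n A s y ∨ _
    rcases h.found_succ hy y1 y2 with h1 | h1
    · exact Or.inl h1
    · have hyD := hy.hD
      have hyC := hy.hC
      have htop := hy.left
      right
      intro t ht hcon
      by_cases hyb : y.2.1 < b
      · rcases ((ranked S).ins_succ_iff).mp ht with h3 | ⟨h3, h4⟩
        · exact h1 t h3 hcon
        · have hte := (ranked S).x_inj h3.1 r1.1 (h4.trans r1.2.symm)
          subst hte
          have h5 := h3.2
          rw [h4] at h5
          -- The test failed although the segment lies between A and b + 1, so it contains the
          -- y-interval of an older segment, which the window would contain as well.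
          have hfl : l < f := by
            refine lt_of_le_of_ne ?_ (hf.ne_lo _ h3 h4).symm
            by_contra hc
            exact hcase ⟨h5.1, h5.2.1, not_le.mp hc⟩
          obtain ⟨w, hw1, hw2, hw3⟩ := hf.2.resolve_left (by omega)
          exact h1 w hw1 ⟨by omega, by omega⟩
      · have h5 := hy.wfree
        rw [y1, show y.2.1 = b by omega] at h5
        exact h5 t ht hcon

/-- Find all boxes with the left side in register `3`. -/
def sweep : Program :=
  .seq (.store 14 (.const 0) (.reg 2)) (.seq (.assign 4 (.const 1))
    (.seq (countUp 4 2 sweepStep) (.seq (.assign 7 (.const 0)) (.seq (.assign 8 (.reg 2)) flush))))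

/-- Boxes not found during the sweep still have a free window at the end, and the final flush goes
through the whole chain. -/
theorem runs_sweep {m : ℕ} {P : Fin m → Point} {B : ℕ} (hB : WordBound n B) {s : State}
    (hs : Ready S s) {A : ℕ} (h3 : s.reg 3 = A) (hA : A < n + n)
    (hf : ∀ e < n + n, (ranked S).FSpec A ((ranked S).X e) ((ranked S).hi e) (s.arr 13 e))
    (hr : Reported S A s) :
    Runs P B sweep s ((4 * examineTime n + 110) * (n + n + 1)) fun s' =>
      Ready S s' ∧ s'.reg 3 = A ∧ s'.arr 13 = s.arr 13 ∧ Reported S A s' ∧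
      ∀ y, (ranked S).Tight y → y.1 = A → Marked n A s' y := by
  have hsm := hB.small
  have hn := hB.pos
  set E := examineTime n + 10 with hE
  set s₁ := s.setArr 14 0 (n + n + 1) with hs1
  have hs₁ : Ready S s₁ := hs.setArr (by omega)
  have hinit : Sweep S A 1 {0} (s₁.setReg 4 1) := by
    refine ⟨hs₁.setReg (by omega), by simp [hs1, h3], by simp, ?_, ?_, ?_, ?_⟩
    · refine Ranked.Chain.init _ (hs₁.setReg (x := 4) (v := 1) (by omega)).upper (by omega) ?_
      simp [hs1]
    · have : (s₁.setReg 4 1).arr 13 = s.arr 13 := by funext j; simp [hs1]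
      rw [this]; exact hf
    · have e15 : (s₁.setReg 4 1).arr 15 = s.arr 15 := by funext j; simp [hs1]
      refine ⟨?_, by rw [e15]; exact hr.marks⟩
      have := hr.list
      unfold Marked at *
      rw [e15]; exact this
    · intro y hy y1 y2
      have := hy.hB
      omega
  refine (runs_seq (T₁ := 3) (T₂ := 2 + (((E * 3 + 60) * (n + n + 1) + 7 * (n + n + 1 - 1) + 3) +
    (2 + (2 + (E * (n + n + 1) + 3))))) (Val.runs_store (v := 0) (w := n + n + 1)
    (.const (by omega)) (.reg hs.width (by omega)) (runs_seq (T₁ := 2) (Val.runs_assign (v := 1)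
    (.const (by omega)) (runs_seq ((runs_countUp (L := n + n + 1) (by omega) (by omega)
    (fun b φ s' => s'.arr 13 = s.arr 13 ∧ 1 ≤ b ∧
      -- Each remaining rank brings 2E + 60 time units, and each window in the chain stores E for
      -- its later examination.
      ∃ K, Sweep S A b K s' ∧ φ = (E * 2 + 60) * (n + n + 1 - b) + E * K.card) ?_ ?_
      (i := 1) (φ := (E * 2 + 60) * (n + n + 1 - 1) + E * 1) (by omega)
      ⟨?_, le_rfl, {0}, hinit, rfl⟩).mono ?_ ?_)))))).of_le ?_
  · rintro b φ s' ⟨-, -, K, h, -⟩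
    exact ⟨h.cur, h.ready.width⟩
  · rintro b φ s' hb ⟨harr, hb1, K, h, rfl⟩
    obtain ⟨T, K', hT, hle⟩ := runs_sweepStep (P := P) hB hA hb1 (by omega) h
    refine ⟨T, hT.imp ?_⟩
    rintro s'' ⟨g1, g2, g3⟩
    refine ⟨g1, (E * 2 + 60) * (n + n + 1 - (b + 1)) + E * K'.card, ?_, g3.trans harr, by omega,
      K', g2, rfl⟩
    have : n + n + 1 - b = (n + n + 1 - (b + 1)) + 1 := by omega
    rw [this]
    rw [← hE] at hle
    linarith
  · funext j; simp [hs1]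
  · refine Nat.add_le_add_right (Nat.add_le_add_right ?_ _) 3
    rw [show n + n + 1 - 1 = n + n by omega]
    nlinarith [Nat.zero_le (E * (n + n))]
  · rintro s₂ ⟨φ, harr, -, K, h, -⟩
    set s₃ := s₂.setReg 7 0 with hs3
    set s₄ := s₃.setReg 8 (n + n + 1) with hs4
    have hs₃ : Ready S s₃ := h.ready.setReg (by omega)
    have hs₄ : Ready S s₄ := hs₃.setReg (by omega)
    refine runs_seq (T₁ := 2) (Val.runs_assign (v := 0) (.const (by omega))
      (runs_seq (T₁ := 2) (Val.runs_assign (v := n + n + 1) (.reg hs₃.width (by omega))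
      ((runs_flush (A := A) (b := n + n + 1) (c := 0) (l := n + n + 1) (K := K) hB hs₄ ?_ ?_ ?_ ?_
        hA (by omega) le_rfl le_rfl (Or.inl h.chain.zero_mem) h.chain
        ⟨h.reported.list, h.reported.marks⟩).mono ?_ ?_))))
    · simp [hs4, hs3, h.left]
    · simp [hs4, hs3, h.cur]
    · simp [hs4, hs3]
    · simp [hs4]
    · refine Nat.add_le_add_right (Nat.mul_le_mul_left _ ?_) 3
      have : (K.filter fun u => 0 ≤ u ∧ u < n + n + 1) ⊆ Finset.range (n + n + 1) := by
        intro u hu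
        rw [Finset.mem_filter] at hu
        exact Finset.mem_range.mpr hu.2.2
      exact (Finset.card_le_card this).trans (by simp)
    · rintro s₅ ⟨j1, j2, j3, j4, j5, j6, j7, j8⟩
      refine ⟨hs₄.congr (fun x hx => j1 x (by omega)) fun a ha => j2 a (by omega), ?_,
        (j2 13 (by omega)).trans harr, j3, ?_⟩
      · rw [j1 3 (by omega)]; simp [hs4, hs3, h.left]
      · intro y hy y1
        have hyB := hy.hB
        have hyD := hy.hD
        rcases h.found y hy y1 (by omega) with h1 | h1
        · exact j4 y h1
        · have : y.2.2.1 < y.2.2.2 + 1 := by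
            have := hy.left
            unfold Ranked.InBox at this
            omega
          obtain ⟨w, hw, hw1, hw2⟩ := h.chain.cover _ _ this (by omega) h1
          have := h.chain.le w hw
          exact j8 w hw (by omega) (by omega) y hy y1 (by omega) hw1 hw2
  · have : n + n + 1 - 1 ≤ n + n + 1 := by omega
    have h1 : (4 * examineTime n + 110) * (n + n + 1) =
        (E * 3 + 60) * (n + n + 1) + E * (n + n + 1) + 10 * (n + n + 1) := by
      rw [hE]; ring
    omega

end Sweep

/-! ### The move of the left side, and the main loop. -/

section Main

variable {n : ℕ} {S : Fin n → Segment}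

/-- Moving the left side from A + 1 to A admits only the segment whose left endpoint has rank A + 1,
represented by its right endpoint. -/
theorem Ranked.ins_left (I : Ranked n) {A b t : ℕ} (hA : A < n + n) :
    I.Ins A b t ↔ I.Ins (A + 1) b t ∨ (t = partner n (I.PX (A + 1)) ∧
      A + 1 < I.X (partner n (I.PX (A + 1))) ∧ I.X (partner n (I.PX (A + 1))) < b) := by
  have a1 := I.px_spec (A + 1) (by omega) hA
  unfold Ins
  constructor
  · rintro ⟨h1, h2, h3, h4⟩
    by_cases h : I.X (partner n t) = A + 1
    · right
      have h5 : partner n t = I.PX (A + 1) :=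
        I.x_inj (partner_lt h1) a1.1 (h.trans a1.2.symm)
      rw [← h5, partner_partner h1]
      exact ⟨rfl, by omega, h4⟩
    · left
      exact ⟨h1, by omega, h3, h4⟩
  · rintro (⟨h1, h2, h3, h4⟩ | ⟨rfl, h2, h3⟩)
    · exact ⟨h1, by omega, h3, h4⟩
    · rw [partner_partner a1.1, a1.2]
      exact ⟨partner_lt a1.1, by omega, h2, h3⟩

/-- The entry is a maximum over segments, and at most one new segment takes part in it. -/
theorem Ranked.fspec_left (I : Ranked n) {A b h f f' : ℕ} (hA : A < n + n)
    (hf : I.FSpec (A + 1) b h f)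
    (h1 : A + 1 < I.X (partner n (I.PX (A + 1))) → I.X (partner n (I.PX (A + 1))) < b →
      I.hi (partner n (I.PX (A + 1))) < h → f' = max f (I.lo (partner n (I.PX (A + 1)))))
    (h2 : ¬ (A + 1 < I.X (partner n (I.PX (A + 1))) ∧ I.X (partner n (I.PX (A + 1))) < b ∧
      I.hi (partner n (I.PX (A + 1))) < h) → f' = f) :
    I.FSpec A b h f' := by
  set r := partner n (I.PX (A + 1)) with hr
  have hins := fun t => I.ins_left (b := b) (t := t) hA
  simp only [← hr] at hins
  by_cases hc : A + 1 < I.X r ∧ I.X r < b ∧ I.hi r < h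
  · have hf' := h1 hc.1 hc.2.1 hc.2.2
    refine ⟨fun t ht hth => ?_, ?_⟩
    · rcases (hins t).mp ht with h3 | ⟨rfl, -⟩
      · have := hf.1 t h3 hth; omega
      · omega
    · rcases le_total f (I.lo r) with h4 | h4
      · exact Or.inr ⟨r, (hins r).mpr (Or.inr ⟨rfl, hc.1, hc.2.1⟩), hc.2.2, by omega⟩
      · rw [max_eq_left h4] at hf'
        rw [hf']
        exact hf.2.imp id fun ⟨t, ht, ht1⟩ => ⟨t, (hins t).mpr (Or.inl ht), ht1⟩
  · rw [h2 hc]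
    refine ⟨fun t ht hth => ?_, ?_⟩
    · rcases (hins t).mp ht with h3 | ⟨rfl, h3⟩
      · exact hf.1 t h3 hth
      · exact absurd ⟨h3.1, h3.2, hth⟩ hc
    · exact hf.2.imp id fun ⟨t, ht, ht1⟩ => ⟨t, (hins t).mpr (Or.inl ht), ht1⟩

/-- Update the table of start windows when the left side moves to register `3`. -/
def insertLeft : Program :=
  .seq (.assign 5 (.cell 12 (.cell 3 (.add (.reg 3) (.const 1)))))
    (.cond (.lt (.add (.reg 3) (.const 1)) (.cell 2 (.reg 5)))
      (.seq (.assign 4 (.const 0)) (countUp 4 1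
        (.cond (.and (.lt (.cell 2 (.reg 5)) (.cell 2 (.reg 4)))
            (.and (.lt (.cell 9 (.reg 5)) (.cell 9 (.reg 4)))
              (.lt (.cell 13 (.reg 4)) (.cell 8 (.reg 5)))))
          (.store 13 (.reg 4) (.cell 8 (.reg 5))) .skip)))
      .skip)

/-- If the endpoint of rank A + 1 is a right endpoint, no segment is added and the table stays
valid. Otherwise one pass compares the new segment with every entry. -/
theorem runs_insertLeft {m : ℕ} {P : Fin m → Point} {B : ℕ} (hB : WordBound n B) {s : State}
    (hs : Ready S s) {A : ℕ} (h3 : s.reg 3 = A) (hA : A < n + n)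
    (hf : ∀ e < n + n, (ranked S).FSpec (A + 1) ((ranked S).X e) ((ranked S).hi e) (s.arr 13 e)) :
    Runs P B insertLeft s (40 * (n + n) + 30) fun s' =>
      Ready S s' ∧ s'.reg 3 = A ∧ s'.arr 15 = s.arr 15 ∧ s'.out = s.out ∧
      ∀ e < n + n, (ranked S).FSpec A ((ranked S).X e) ((ranked S).hi e) (s'.arr 13 e) := by
  have hsm := hB.small
  have hn := hB.pos
  have a1 := (ranked S).px_spec (A + 1) (by omega) hA
  have r1 := partner_lt a1.1
  have hleft := fun {b h f f' : ℕ} => (ranked S).fspec_left (b := b) (h := h) (f := f) (f' := f') hA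
  set r := partner n ((ranked S).PX (A + 1)) with hr
  have xr := (ranked S).x_spec r r1
  have yr := (ranked S).lo_spec r1
  set s₁ := s.setReg 5 r with hs1
  have hs₁ : Ready S s₁ := hs.setReg (by omega)
  have v5 : s₁.reg 5 = r := by simp [hs1]
  have v3 : s₁.reg 3 = A := by simp [hs1, h3]
  refine (runs_seq (T₁ := 6) (Val.runs_assign (v := r) ((((Val.reg h3 (by omega)).add
    (.const (by omega)) (by omega)).cell (hs.px _ (by omega) (by omega)) (by omega)).cell
    (hs.partner _ a1.1) (by omega)) (Tests.runs_cond (T₁ := 2 + ((25 + 7) * (n + n - 0) + 3))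
      (T₂ := 1) (Tests.lt ((Val.reg v3 (by omega)).add (.const (by omega)) (by omega))
      ((Val.reg v5 (by omega)).cell (hs₁.x r r1) (by omega))) (fun hlt => ?_)
      (fun hlt => runs_skip ?_)))).of_le ?_
  · have hinit : ∀ e < n + n, (0 ≤ e → (s₁.setReg 4 0).arr 13 e = s.arr 13 e) := fun e _ _ => rfl
    refine runs_seq (T₁ := 2) (Val.runs_assign (v := 0) (.const (by omega))
      ((runs_countUp_const (L := n + n) (by omega) (by omega) 25
      (fun i s' => Ready S s' ∧ s'.reg 3 = A ∧ s'.reg 4 = i ∧ s'.reg 5 = r ∧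
        s'.arr 15 = s.arr 15 ∧ s'.out = s.out ∧
        (∀ e < n + n, e < i →
          (ranked S).FSpec A ((ranked S).X e) ((ranked S).hi e) (s'.arr 13 e)) ∧
        ∀ e < n + n, i ≤ e → s'.arr 13 e = s.arr 13 e) ?_ ?_ (i := 0) (by omega)
      ⟨hs₁.setReg (by omega), by simp [v3], by simp, by simp [v5], rfl, rfl,
        fun e _ he => absurd he (by omega), hinit⟩).imp ?_))
    · rintro i s' ⟨g1, -, g3, -⟩
      exact ⟨g3, g1.size⟩
    · rintro i s' hi ⟨g1, g2, g3, g4, g5, g6, g7, g8⟩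
      have xi := (ranked S).x_spec i hi
      have yi := (ranked S).lo_spec hi
      have fi := hf i hi
      have fle := fi.le
      have hFi := g8 i hi le_rfl
      have key := fun f' => hleft (f' := f') fi
      have vlo : Val B s' (.cell 8 (.reg 5)) ((ranked S).lo r) :=
        (Val.reg g4 (by omega)).cell (g1.lo r r1) (by omega)
      refine (Tests.runs_cond (T₁ := 4) (T₂ := 1)
        (Tests.and (Tests.lt ((Val.reg g4 (by omega)).cell (g1.x r r1) (by omega))
            ((Val.reg g3 (by omega)).cell (g1.x i hi) (by omega)))
          (Tests.and (Tests.lt ((Val.reg g4 (by omega)).cell (g1.hi r r1) (by omega))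
            ((Val.reg g3 (by omega)).cell (g1.hi i hi) (by omega)))
          (Tests.lt ((Val.reg g3 (by omega)).cell hFi (by omega)) vlo)))
        (fun hc => ?_) (fun hc => ?_)).of_le (by simp [Test.cost, Expr.cost])
      · refine Val.runs_store (Val.reg g3 (by omega)) vlo ⟨by simpa using g3,
          (g1.setArr (by omega)).setReg (by omega), by simp [g2], by simp, by simp [g4], ?_, by
          simp [g6], ?_, ?_⟩
        · rw [← g5]; funext j; simp
        · intro e he hei
          rcases Nat.lt_succ_iff_lt_or_eq.mp hei with h4 | rfl
          · simpa [h4.ne] using g7 e he h4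
          · simp only [setReg_arr, setArr_arr, and_self, if_true]
            refine key _ (fun _ _ _ => (max_eq_right hc.2.2.le).symm) (fun h => ?_)
            exact absurd ⟨hlt, hc.1, hc.2.1⟩ h
        · intro e he hei
          have : e ≠ i := by omega
          simpa [this] using g8 e he (by omega)
      · refine runs_skip ⟨g3, g1.setReg (by omega), by simp [g2], by simp, by simp [g4], g5, g6,
          ?_, fun e he hei => g8 e he (by omega)⟩
        intro e he hei
        rcases Nat.lt_succ_iff_lt_or_eq.mp hei with h4 | rfl
        · exact g7 e he h4
        · rw [setReg_arr, hFi]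
          refine key _ (fun _ h5 h6 => ?_) (fun _ => rfl)
          exact (max_eq_left (not_lt.mp fun h7 => hc ⟨h5, h6, h7⟩)).symm
    · rintro s' ⟨g1, g2, g3, g4, g5, g6, g7, g8⟩
      exact ⟨g1, g2, g5, g6, fun e he => g7 e he he⟩
  · refine ⟨hs₁, v3, rfl, rfl, fun e he => ?_⟩
    exact hleft (hf e he) (fun h => absurd h hlt) (fun _ => rfl)
  · simp only [Test.cost, Expr.cost]; omega

/-- Run the sweep for all left sides, from right to left. -/
def mainLoop : Program :=
  .seq (.assign 3 (.reg 1)) (.loop (.lt (.const 0) (.reg 3))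
    (.seq (.assign 3 (.sub (.reg 3) (.const 1))) (.seq insertLeft sweep)))

variable (S) in
/-- The good boxes with left sides at least `a` have been reported. -/
structure Progress (a : ℕ) (s : State) : Prop where
  ready : Ready S s
  left : s.reg 3 = a
  le : a ≤ n + n
  start : ∀ e < n + n, (ranked S).FSpec a ((ranked S).X e) ((ranked S).hi e) (s.arr 13 e)
  list : ∃ K : List (ℕ × ℕ × ℕ × ℕ), s.out = K.map (ranked S).quad ∧ K.Nodup ∧
    ∀ x, x ∈ K ↔ Good S x ∧ a ≤ x.1
  marks : ∀ i, s.arr 15 i = 0 ∨ (a + 1 ≤ s.arr 15 i ∧ s.arr 15 i ≤ n + n)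

/-- The time for one round of the main loop. -/
def roundTime (n : ℕ) : ℕ := (4 * examineTime n + 110) * (n + n + 1) + 40 * (n + n) + 40

/-- Left sides run from 2n - 1 down to 0, so that segments are only added to the start table and
marks only decrease. -/
theorem runs_mainLoop {m : ℕ} {P : Fin m → Point} {B : ℕ} (hB : WordBound n B) {s : State}
    (hs : Ready S s) (h13 : ∀ i, s.arr 13 i = 0) (h15 : ∀ i, s.arr 15 i = 0) (hout : s.out = []) :
    Runs P B mainLoop s (roundTime n * (n + n) + 5) fun s' => ReportsAll S s'.out := by
  have hsm := hB.small
  have hn := hB.pos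
  refine (runs_seq (T₁ := 2) (T₂ := roundTime n * (n + n) + 3) (Val.runs_assign (v := n + n)
    (.reg hs.size (by omega)) (runs_loop (fun φ s' => ∃ a, Progress S a s' ∧
      φ = roundTime n * a + 3) ?_ _ _ ⟨n + n, ?_, rfl⟩ (by simp [Test.cost])))).of_le (by omega)
  · rintro φ s' ⟨a, h, rfl⟩
    have ha := h.le
    have hT : Tests P B s' (.lt (.const 0) (.reg 3)) (0 < a) :=
      Tests.lt (.const (by omega)) (.reg h.left (by omega))
    refine ⟨hT.1, by simp [Test.cost, Expr.cost], fun hp => ?_, fun hp => ?_⟩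
    · have h0 : a = 0 := by
        by_contra hne
        exact hp (hT.2.mpr (by omega))
      obtain ⟨K, k1, k2, k3⟩ := h.list
      rw [k1]
      exact reportsAll_of_good hB.pos k2 fun x => by rw [k3, h0]; simp
    · have h0 : 0 < a := hT.2.mp hp
      obtain ⟨A, rfl⟩ : ∃ A, a = A + 1 := ⟨a - 1, by omega⟩
      set s₁ := s'.setReg 3 A with hs1
      have hs₁ : Ready S s₁ := h.ready.setReg (by omega)
      refine ⟨4 + ((40 * (n + n) + 30) + (4 * examineTime n + 110) * (n + n + 1)),
        runs_seq (T₁ := 4) (Val.runs_assign (v := A)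
        ((Val.reg h.left (by omega)).sub (.const (by omega))) (runs_seq
        ((runs_insertLeft (A := A) hB hs₁ (by simp [hs1]) (by omega) h.start).imp ?_)))⟩
      rintro s₂ ⟨i1, i2, i3, i4, i5⟩
      have hrep : Reported S A s₂ := by
        obtain ⟨K, k1, k2, k3⟩ := h.list
        refine ⟨⟨K, i4.trans k1, k2, fun x => ?_⟩, fun i => ?_⟩
        · rw [k3]
          refine and_congr_right fun hx => ⟨fun h4 => Or.inl h4, fun h4 => ?_⟩
          rcases h4 with h4 | ⟨h4, h5⟩
          · exact h4
          -- Marks of earlier rounds are at least A + 2, so nothing is marked for A yet and the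
          -- table needs no reset.
          · have h6 := h.marks (x.2.1 * (n + n + 1) + x.2.2.1)
            rw [Marked, i3] at h5
            change s'.arr 15 _ = _ at h5
            omega
        · rw [i3]
          have := h.marks i
          change s'.arr 15 i = 0 ∨ _ ≤ s'.arr 15 i ∧ s'.arr 15 i ≤ _
          omega
      refine (runs_sweep hB i1 i2 (by omega) i5 hrep).imp ?_
      rintro s₃ ⟨j1, j2, j3, j4, j5⟩
      refine ⟨_, ⟨A, ⟨j1, j2, by omega, by rw [j3]; exact i5, ?_, j4.marks⟩, rfl⟩, ?_⟩
      · obtain ⟨K, k1, k2, k3⟩ := j4.list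
        refine ⟨K, k1, k2, fun x => ?_⟩
        rw [k3]
        refine and_congr_right fun hx => ⟨fun h4 => ?_, fun h4 => ?_⟩
        · rcases h4 with h4 | ⟨h4, -⟩ <;> omega
        · rcases h4.eq_or_lt with h5 | h5
          · exact Or.inr ⟨h5.symm, j5 x hx.1 h5.symm⟩
          · exact Or.inl h5
      · have : roundTime n * (A + 1) = roundTime n * A + roundTime n := Nat.mul_succ _ _
        have h5 : roundTime n = (4 * examineTime n + 110) * (n + n + 1) + 40 * (n + n) + 40 := rfl
        simp only [Test.cost, Expr.cost]
        omega
  -- For left side 2n no segment and no tight box is left, so the zero table and the empty output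
  -- are correct.
  · refine ⟨hs.setReg (by omega), by simp, le_rfl, fun e he => ⟨fun t ht => ?_, Or.inl ?_⟩,
      ⟨[], hout, List.nodup_nil, fun x => ?_⟩, fun i => Or.inl (h15 i)⟩
    · have h1 := ht.2
      have h2 := (ranked S).x_spec t ht.1
      omega
    · exact h13 e
    · simp only [List.not_mem_nil, false_iff, not_and, not_le]
      exact fun hx => hx.1.hA

end Main

/-! ### Preprocessing -/

section Preprocessing

theorem countLt_zero (v : ℕ → ℝ) (e : ℕ) : countLt v 0 e = 0 := by simp [countLt]

theorem countLe_zero (v : ℕ → ℝ) (e : ℕ) : countLe v 0 e = 0 := by simp [countLe]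

theorem rank_zero (v : ℕ → ℝ) (e : ℕ) : rank v 0 e = 0 := by simp [rank]

open Classical in
theorem countLt_succ (v : ℕ → ℝ) (j e : ℕ) :
    countLt v (j + 1) e = countLt v j e + if v j < v e then 1 else 0 := by
  simp only [countLt, Finset.card_filter, Finset.sum_range_succ]

open Classical in
theorem countLe_succ (v : ℕ → ℝ) (j e : ℕ) :
    countLe v (j + 1) e = countLe v j e + if ¬ v e < v j then 1 else 0 := by
  simp only [countLe, Finset.card_filter, Finset.sum_range_succ]

open Classical in
theorem rank_succ (v : ℕ → ℝ) (j e : ℕ) :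
    rank v (j + 1) e = rank v j e + if v j < v e ∨ (¬ v e < v j ∧ j ≤ e) then 1 else 0 := by
  simp only [rank, Finset.card_filter, Finset.sum_range_succ]

/-- The state `s'` differs from `s` only in registers from `3` on and in arrays from `A`. -/
structure Frame (A : Set ℕ) (s s' : State) : Prop where
  reg : ∀ x < 3, s'.reg x = s.reg x
  arr : ∀ a ∉ A, s'.arr a = s.arr a
  out : s'.out = s.out

theorem Frame.refl (A : Set ℕ) (s : State) : Frame A s s :=
  ⟨fun _ _ => rfl, fun _ _ => rfl, rfl⟩

theorem Frame.setReg {A : Set ℕ} {s s' : State} (h : Frame A s s') {x v : ℕ} (hx : 3 ≤ x) :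
    Frame A s (s'.setReg x v) :=
  ⟨fun y hy => by rw [setReg_reg, if_neg (by omega)]; exact h.reg y hy, h.arr, h.out⟩

theorem Frame.setArr {A : Set ℕ} {s s' : State} (h : Frame A s s') {a i v : ℕ} (ha : a ∈ A) :
    Frame A s (s'.setArr a i v) :=
  ⟨h.reg, fun b hb => by
    funext j
    have hba : b ≠ a := fun hc => hb (hc ▸ ha)
    rw [setArr_arr, if_neg fun hc => hba hc.1, h.arr b hb], h.out⟩

variable {m : ℕ} {P : Fin m → Point} {B : ℕ}

/-- Increment register `x`. -/
def incr (x : ℕ) : Program := .assign x (.add (.reg x) (.const 1))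

theorem runs_incr {s : State} {x v : ℕ} {Q : State → Prop} (hv : s.reg x = v) (hB : v + 1 ≤ B)
    (h : Q (s.setReg x (v + 1))) : Runs P B (incr x) s 4 Q :=
  Val.runs_assign ((Val.reg hv (by omega)).add (.const (by omega)) hB) h

/-- Compare the key in register `3` with all other keys. -/
def compareAll (lt : Expr → Expr → Test) : Program :=
  .seq (.assign 4 (.const 0)) (.seq (.assign 5 (.const 0)) (.seq (.assign 6 (.const 0))
    (.seq (.assign 7 (.const 0)) (countUp 4 1
      (.cond (lt (.reg 4) (.reg 3)) (.seq (incr 5) (.seq (incr 6) (incr 7)))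
        (.cond (lt (.reg 3) (.reg 4)) .skip
          (.seq (incr 6) (.cond (.lt (.reg 3) (.reg 4)) .skip (incr 7)))))))))

variable {lt : Expr → Expr → Test} {v : ℕ → ℝ} {N : ℕ}

/-- One pass maintains all three counts, with ties in the rank decided by the numbers. The
comparison is a parameter, so the same program serves both coordinates. -/
theorem runs_compareAll (hN : N + 1 ≤ B) (hcost : ∀ e f, (lt e f).cost = e.cost + f.cost + 1)
    (hT : ∀ s e f i j, Val B s e i → Val B s f j → i < N → j < N →
      Tests P B s (lt e f) (v i < v j))
    {s : State} (h1 : s.reg 1 = N) {e : ℕ} (h3 : s.reg 3 = e) (he : e < N) :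
    Runs P B (compareAll lt) s (38 * N + 11) fun s' => s'.arr = s.arr ∧ s'.out = s.out ∧
      (∀ x < 4, s'.reg x = s.reg x) ∧ s'.reg 5 = countLt v N e ∧ s'.reg 6 = countLe v N e ∧
      s'.reg 7 = rank v N e := by
  refine (runs_seq (T₁ := 2) (Val.runs_assign (v := 0) (.const (by omega))
    (runs_seq (T₁ := 2) (Val.runs_assign (v := 0) (.const (by omega))
    (runs_seq (T₁ := 2) (Val.runs_assign (v := 0) (.const (by omega))
    (runs_seq (T₁ := 2) (Val.runs_assign (v := 0) (.const (by omega))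
    ((runs_countUp_const (L := N) (by omega) (by omega) 31
      (fun j s' => s'.arr = s.arr ∧ s'.out = s.out ∧ (∀ x < 4, s'.reg x = s.reg x) ∧
        s'.reg 4 = j ∧ s'.reg 5 = countLt v j e ∧ s'.reg 6 = countLe v j e ∧
        s'.reg 7 = rank v j e) ?_ ?_ (i := 0) (by omega) ?_).imp ?_))))))))).of_le (by omega)
  · rintro j s' ⟨-, -, g, h4, -⟩
    exact ⟨h4, (g 1 (by omega)).trans h1⟩
  · rintro j s' hj ⟨g1, g2, g3, g4, g5, g6, g7⟩
    have v4 : Val B s' (.reg 4) j := .reg g4 (by omega)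
    have v3 : Val B s' (.reg 3) e := .reg ((g3 3 (by omega)).trans h3) (by omega)
    have b5 : countLt v j e ≤ j := countLt_le v j e
    have b6 : countLe v j e ≤ j := countLe_le v j e
    have b7 : rank v j e ≤ j := rank_le e
    have c5 := countLt_succ v j e
    have c6 := countLe_succ v j e
    have c7 := rank_succ v j e
    refine (Tests.runs_cond (T₁ := 4 + (4 + 4)) (T₂ := 16) (hT s' _ _ j e v4 v3 hj he)
      (fun hlt => ?_) (fun hlt => ?_)).of_le (by simp [hcost, Expr.cost])
    · have hlt' : ¬ v e < v j := not_lt.mpr hlt.le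
      rw [if_pos hlt] at c5
      rw [if_pos hlt'] at c6
      rw [if_pos (Or.inl hlt)] at c7
      refine runs_seq (runs_incr g5 (by omega) (runs_seq (runs_incr (v := countLe v j e)
        (by simp [g6]) (by omega) (runs_incr (v := rank v j e) (by simp [g7]) (by omega)
        ⟨by simp [g4], g1, g2, fun x hx => ?_, by simp, by simp [c5], by simp [c6],
          by simp [c7]⟩))))
      simp only [setReg_reg]
      rw [if_neg (by omega), if_neg (by omega), if_neg (by omega), if_neg (by omega)]
      exact g3 x hx
    · rw [if_neg hlt] at c5
      refine (Tests.runs_cond (T₁ := 1) (T₂ := 4 + 8) (hT s' _ _ e j v3 v4 he hj)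
        (fun hgt => ?_) (fun hgt => ?_)).of_le (by simp [hcost, Expr.cost])
      · rw [if_neg (not_not.mpr hgt)] at c6
        rw [if_neg (by tauto)] at c7
        refine runs_skip ⟨g4, g1, g2, fun x hx => ?_, by simp, by simp [c5, g5],
          by simp [c6, g6], by simp [c7, g7]⟩
        rw [setReg_reg, if_neg (by omega)]
        exact g3 x hx
      · rw [if_pos hgt] at c6
        refine runs_seq (runs_incr g6 (by omega) ((Tests.runs_cond (R := e < j) (T₁ := 1) (T₂ := 4)
          (.lt (.reg (by simpa [Expr.eval] using v3.2) (by omega))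
            (.reg (by simpa using g4) (by omega)))
          (fun hej => runs_skip ?_)
          (fun hej => runs_incr (v := rank v j e) (by simp [g7]) (by omega) ?_)).of_le
            (by simp [Test.cost, Expr.cost])))
        · rw [if_neg (by rintro (h | h); exacts [hlt h, by omega])] at c7
          refine ⟨by simp [g4], g1, g2, fun x hx => ?_, by simp, by simp [c5, g5],
            by simp [c6], by simp [c7, g7]⟩
          simp only [setReg_reg]
          rw [if_neg (by omega), if_neg (by omega)]
          exact g3 x hx
        · rw [if_pos (Or.inr ⟨hgt, by omega⟩)] at c7
          refine ⟨by simp [g4], g1, g2, fun x hx => ?_, by simp, by simp [c5, g5],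
            by simp [c6], by simp [c7]⟩
          simp only [setReg_reg]
          rw [if_neg (by omega), if_neg (by omega), if_neg (by omega)]
          exact g3 x hx
  · refine ⟨rfl, rfl, fun x hx => ?_, by simp, by simp [countLt_zero], by simp [countLe_zero],
      by simp [rank_zero]⟩
    simp only [setReg_reg]
    rw [if_neg (by omega), if_neg (by omega), if_neg (by omega), if_neg (by omega)]
  · rintro s' ⟨g1, g2, g3, -, g5, g6, g7⟩
    exact ⟨g1, g2, g3, g5, g6, g7⟩

/-- Fill the arrays `a`, …, `a + 3` with the numbers of smaller keys, the numbers of keys that are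
not larger, the ranks, and the keys sorted by rank. -/
def rankAll (lt : Expr → Expr → Test) (a : ℕ) : Program :=
  .seq (.assign 3 (.const 0)) (countUp 3 1 (.seq (compareAll lt)
    (.seq (.store a (.reg 3) (.reg 5)) (.seq (.store (a + 1) (.reg 3) (.reg 6))
      (.seq (.store (a + 2) (.reg 3) (.reg 7)) (.store (a + 3) (.reg 7) (.reg 3)))))))

/-- Comparing all pairs is affordable within the quadratic budget. Ranks are distinct, so writing
each key to the cell of its rank inverts the table. -/
theorem runs_rankAll (hN : N + 1 ≤ B) (hcost : ∀ e f, (lt e f).cost = e.cost + f.cost + 1)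
    (hT : ∀ s e f i j, Val B s e i → Val B s f j → i < N → j < N →
      Tests P B s (lt e f) (v i < v j))
    (a : ℕ) {s : State} (h1 : s.reg 1 = N) :
    Runs P B (rankAll lt a) s ((38 * N + 30) * N + 5) fun s' =>
      Frame {a, a + 1, a + 2, a + 3} s s' ∧
      (∀ e < N, s'.arr a e = countLt v N e) ∧ (∀ e < N, s'.arr (a + 1) e = countLe v N e) ∧
      (∀ e < N, s'.arr (a + 2) e = rank v N e) ∧
      ∀ r, 1 ≤ r → r ≤ N → s'.arr (a + 3) r = unrank v N r := by
  refine (runs_seq (T₁ := 2) (Val.runs_assign (v := 0) (.const (by omega))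
    ((runs_countUp_const (L := N) (by omega) (by omega) ((38 * N + 11) + (3 + (3 + (3 + 3))))
      (fun i s' => Frame {a, a + 1, a + 2, a + 3} s s' ∧ s'.reg 3 = i ∧
        (∀ e < i, s'.arr a e = countLt v N e) ∧ (∀ e < i, s'.arr (a + 1) e = countLe v N e) ∧
        (∀ e < i, s'.arr (a + 2) e = rank v N e) ∧
        ∀ e < i, s'.arr (a + 3) (rank v N e) = e) ?_ ?_ (i := 0) (by omega)
      ⟨(Frame.refl _ _).setReg (by omega), by simp, by simp, by simp, by simp, by simp⟩).imp
      ?_))).of_le ?_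
  · rintro i s' ⟨g, h, -⟩
    exact ⟨h, (g.reg 1 (by omega)).trans h1⟩
  · rintro i s' hi ⟨g, h, g1, g2, g3, g4⟩
    refine runs_seq ((runs_compareAll hN hcost hT ((g.reg 1 (by omega)).trans h1) h hi).imp ?_)
    rintro s₁ ⟨e1, e2, e3, e5, e6, e7⟩
    have b5 := countLt_le v N i
    have b6 := countLe_le v N i
    have b7 : rank v N i ≤ N := rank_le i
    have k3 : s₁.reg 3 = i := (e3 3 (by omega)).trans h
    have f : Frame {a, a + 1, a + 2, a + 3} s s₁ :=
      ⟨fun x hx => (e3 x (by omega)).trans (g.reg x hx), fun b hb => by rw [e1, g.arr b hb],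
        e2.trans g.out⟩
    refine runs_seq (Val.runs_store (.reg k3 (by omega)) (.reg e5 (by omega))
      (runs_seq (Val.runs_store (.reg k3 (by omega)) (.reg e6 (by omega))
      (runs_seq (Val.runs_store (.reg k3 (by omega)) (.reg e7 (by omega))
      (Val.runs_store (.reg e7 (by omega)) (.reg k3 (by omega)) ⟨k3, ?_, by simp, ?_⟩))))))
    · exact ((((f.setArr (by simp)).setArr (by simp)).setArr (by simp)).setArr
        (by simp)).setReg le_rfl
    · have old : ∀ {w : ℕ → ℕ} {b : ℕ}, (∀ e < i, s'.arr b e = w e) → ∀ e < i + 1, e ≠ i →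
          s₁.arr b e = w e := fun hw e he hei => by rw [e1]; exact hw e (by omega)
      refine ⟨fun e he => ?_, fun e he => ?_, fun e he => ?_, fun e he => ?_⟩
      · by_cases hei : e = i
        · simp [hei]
        · simpa [hei] using old g1 e he hei
      · by_cases hei : e = i
        · simp [hei]
        · simpa [hei] using old g2 e he hei
      · by_cases hei : e = i
        · simp [hei]
        · simpa [hei] using old g3 e he hei
      · by_cases hei : e = i
        · simp [hei]
        · have hr : rank v N e ≠ rank v N i := fun hr => hei (rank_inj (by omega) hi hr)
          have := g4 e (by omega)
          simpa [hr, e1] using this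
  · rintro s' ⟨g, -, g1, g2, g3, g4⟩
    refine ⟨g, g1, g2, g3, fun r h1 h2 => ?_⟩
    obtain ⟨u1, u2⟩ := unrank_spec (v := v) h1 h2
    have := g4 _ u1
    rwa [u2] at this
  · rw [Nat.sub_zero]
    have : 38 * N + 11 + (3 + (3 + (3 + 3))) + 7 = 38 * N + 30 := by omega
    rw [this]; omega

end Preprocessing

/-! ### The tables of segments and of prefix counts. -/

section Preprocessing

variable {n m : ℕ} {S : Fin n → Segment} {P : Fin m → Point} {B : ℕ}

/-- Fill the tables about the segments: other endpoints, and lower and upper ends. -/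
def segmentTable : Program :=
  .seq (.assign 3 (.const 0)) (.seq (countUp 3 1
    (.seq (.cond (.lt (.reg 3) (.reg 0)) (.assign 4 (.add (.reg 3) (.reg 0)))
        (.assign 4 (.sub (.reg 3) (.reg 0))))
      (.seq (.store 12 (.reg 3) (.reg 4))
      (.seq (.cond (.lt (.cell 6 (.reg 3)) (.cell 6 (.reg 4)))
          (.seq (.assign 5 (.cell 6 (.reg 3))) (.assign 6 (.cell 6 (.reg 4))))
          (.seq (.assign 5 (.cell 6 (.reg 4))) (.assign 6 (.cell 6 (.reg 3)))))
      (.seq (.store 8 (.reg 3) (.reg 5))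
      (.seq (.store 9 (.reg 3) (.reg 6)) (.store 10 (.reg 5) (.reg 6))))))))
    (.store 10 (.reg 2) (.reg 2)))

theorem runs_segmentTable (hB : WordBound n B) {s : State} (h0 : s.reg 0 = n)
    (h1 : s.reg 1 = n + n) (h2 : s.reg 2 = n + n + 1)
    (h6 : ∀ e < n + n, s.arr 6 e = (ranked S).Y e) :
    Runs P B segmentTable s (57 * (n + n) + 10) fun s' => Frame {8, 9, 10, 12} s s' ∧
      (∀ e < n + n, s'.arr 8 e = (ranked S).lo e) ∧ (∀ e < n + n, s'.arr 9 e = (ranked S).hi e) ∧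
      (ranked S).IsUpper (s'.arr 10) ∧ ∀ e < n + n, s'.arr 12 e = partner n e := by
  have hsm := hB.small
  refine (runs_seq (T₁ := 2) (Val.runs_assign (v := 0) (.const (by omega))
    (runs_seq (T₂ := 3) ((runs_countUp_const (L := n + n) (by omega) (by omega) 50
      (fun i s' => Frame {8, 9, 10, 12} s s' ∧ s'.reg 3 = i ∧
        (∀ e < i, s'.arr 8 e = (ranked S).lo e) ∧ (∀ e < i, s'.arr 9 e = (ranked S).hi e) ∧
        (∀ e < i, s'.arr 10 ((ranked S).lo e) = (ranked S).hi e) ∧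
        ∀ e < i, s'.arr 12 e = partner n e) ?_ ?_ (i := 0) (by omega)
      ⟨(Frame.refl _ _).setReg le_rfl, by simp, by simp, by simp, by simp, by simp⟩).imp
      ?_)))).of_le (by omega)
  · rintro i s' ⟨g, h, -⟩
    exact ⟨h, (g.reg 1 (by omega)).trans h1⟩
  · rintro i s' hi ⟨g, g3, g8, g9, g10, g12⟩
    have k0 : s'.reg 0 = n := (g.reg 0 (by omega)).trans h0
    have hp := partner_lt hi
    have hl := (ranked S).lo_spec hi
    set r := partner n i with hr
    have y1 := (ranked S).y_spec i hi
    have y2 := (ranked S).y_spec r hp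
    refine (runs_seq (T₂ := 39) (Q := _) (Runs.imp (Q := fun s₁ => s₁ = s'.setReg 4 r)
      (Tests.runs_cond (T₁ := 4) (T₂ := 4)
      (Tests.lt (.reg g3 (by omega)) (.reg k0 (by omega)))
      (fun hc => Val.runs_assign (((Val.reg g3 (by omega)).add (.reg k0 (by omega))
        (by omega)).cast ?_) rfl)
      (fun hc => Val.runs_assign (((Val.reg g3 (by omega)).sub (.reg k0 (by omega))).cast ?_)
        rfl)) ?_)).of_le (by simp [Test.cost, Expr.cost])
    · rw [hr, partner, if_pos hc]
    · rw [hr, partner, if_neg hc]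
    · rintro s₁ rfl
      refine (runs_seq (T₁ := 3) (T₂ := 36) (Val.runs_store (v := i) (w := r)
        (.reg (by simpa using g3) (by omega)) (.reg (by simp) (by omega)) ?_))
      set s₂ := (s'.setReg 4 r).setArr 12 i r with hs2
      have f2 : Frame {8, 9, 10, 12} s s₂ := (g.setReg (by omega)).setArr (by simp)
      have v3 : Val B s₂ (.reg 3) i := .reg (by simpa [hs2] using g3) (by omega)
      have v4 : Val B s₂ (.reg 4) r := .reg (by simp [hs2]) (by omega)
      have a6 : s₂.arr 6 = s.arr 6 := f2.arr 6 (by simp)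
      have w3 : Val B s₂ (.cell 6 (.reg 3)) ((ranked S).Y i) :=
        v3.cell ((congrFun a6 i).trans (h6 i hi)) (by omega)
      have w4 : Val B s₂ (.cell 6 (.reg 4)) ((ranked S).Y r) :=
        v4.cell ((congrFun a6 r).trans (h6 r hp)) (by omega)
      have set5 : ∀ {e x w : ℕ}, Val B s₂ (.cell 6 (.reg e)) w → e ≠ 5 →
          Val B (s₂.setReg 5 x) (.cell 6 (.reg e)) w := by
        intro e x w hv he
        simpa [Val, Expr.Fits, Expr.eval, he] using hv
      have hmid : Runs P B (.cond (.lt (.cell 6 (.reg 3)) (.cell 6 (.reg 4)))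
          (.seq (.assign 5 (.cell 6 (.reg 3))) (.assign 6 (.cell 6 (.reg 4))))
          (.seq (.assign 5 (.cell 6 (.reg 4))) (.assign 6 (.cell 6 (.reg 3))))) s₂ 17
          fun s₃ => s₃ = (s₂.setReg 5 ((ranked S).lo i)).setReg 6 ((ranked S).hi i) := by
        refine (Tests.runs_cond (T₁ := 3 + 3) (T₂ := 3 + 3) (Tests.lt w3 w4) (fun hc => ?_)
          (fun hc => ?_)).of_le (by simp [Test.cost, Expr.cost])
        · refine runs_seq (Val.runs_assign w3 (Val.runs_assign (set5 w4 (by omega)) ?_))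
          rw [Ranked.lo, Ranked.hi, ← hr, min_eq_left hc.le, max_eq_right hc.le]
        · refine runs_seq (Val.runs_assign w4 (Val.runs_assign (set5 w3 (by omega)) ?_))
          rw [Ranked.lo, Ranked.hi, ← hr, min_eq_right (not_lt.mp hc), max_eq_left (not_lt.mp hc)]
      refine (runs_seq (T₂ := 9) (hmid.imp ?_)).of_le (by omega)
      rintro s₃ rfl
      have b3 : s₂.reg 3 = i := v3.2
      refine runs_seq (T₁ := 3) (Val.runs_store (v := i) (w := (ranked S).lo i)
        (.reg (by simp [b3]) (by omega)) (.reg (by simp) (by omega))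
        (runs_seq (T₁ := 3) (Val.runs_store (v := i) (w := (ranked S).hi i)
        (.reg (by simp [b3]) (by omega)) (.reg (by simp) (by omega))
        (Val.runs_store (v := (ranked S).lo i) (w := (ranked S).hi i)
        (.reg (by simp) (by omega)) (.reg (by simp) (by omega))
        ⟨by simp [b3], ?_, by simp, ?_, ?_, ?_, ?_⟩))))
      · exact ((((((f2.setReg (by omega)).setReg (by omega)).setArr (by simp)).setArr
          (by simp)).setArr (by simp)).setReg le_rfl)
      · intro e he
        by_cases hei : e = i
        · simp [hei]
        · simpa [hei, hs2] using g8 e (by omega)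
      · intro e he
        by_cases hei : e = i
        · simp [hei]
        · simpa [hei, hs2] using g9 e (by omega)
      · intro e he
        -- Both endpoints of a segment write to the same cell, and they write the same value.
        by_cases hlo : (ranked S).lo e = (ranked S).lo i
        · have := (ranked S).hi_eq_of_lo_eq (by omega) hi hlo
          simp [hlo, this]
        · have hei : e ≠ i := fun h => hlo (h ▸ rfl)
          simpa [hlo, hs2] using g10 e (by omega)
      · intro e he
        by_cases hei : e = i
        · simp [hei, hs2, hr]
        · simpa [hei, hs2] using g12 e (by omega)
  · rintro s' ⟨g, -, g8, g9, g10, g12⟩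
    have k2 : s'.reg 2 = n + n + 1 := (g.reg 2 (by omega)).trans h2
    refine Val.runs_store (.reg k2 (by omega)) (.reg k2 (by omega))
      ⟨g.setArr (by simp), by simpa using g8, by simpa using g9, ⟨by simp, fun e he => ?_⟩,
        by simpa using g12⟩
    -- Lower ends are below 2n + 1, so the entry for the end of the list overwrites none of them.
    have := (ranked S).lo_spec he
    rw [setArr_arr, if_neg (by omega)]
    exact g10 e he

/-- Fill the table of the numbers of endpoints with bounded ranks. -/
def countTable : Program :=
  .seq (.assign 3 (.const 0)) (countUp 3 1
    (.seq (.assign 5 (.cell 6 (.cell 3 (.add (.reg 3) (.const 1)))))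
    (.seq (.assign 4 (.const 0)) (countUp 4 2
      (.cond (.lt (.reg 4) (.reg 5))
        (.store 11 (idx (.add (.reg 3) (.const 1)) (.reg 4)) (.cell 11 (idx (.reg 3) (.reg 4))))
        (.store 11 (idx (.add (.reg 3) (.const 1)) (.reg 4))
          (.add (.cell 11 (idx (.reg 3) (.reg 4))) (.const 1))))))))

/-- Row A + 1 is row A, increased by one from the y-rank of the endpoint with x-rank A + 1 on. Row 0
is zero in the initial memory. -/
theorem runs_countTable (hB : WordBound n B) {s : State} (h1 : s.reg 1 = n + n)
    (h2 : s.reg 2 = n + n + 1)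
    (h3 : ∀ r, 1 ≤ r → r ≤ n + n → s.arr 3 r = (ranked S).PX r)
    (h6 : ∀ e < n + n, s.arr 6 e = (ranked S).Y e) (h11 : ∀ i, s.arr 11 i = 0) :
    Runs P B countTable s ((47 * (n + n + 1) + 18) * (n + n) + 5) fun s' => Frame {11} s s' ∧
      ∀ A ≤ n + n, ∀ C ≤ n + n,
        s'.arr 11 (A * (n + n + 1) + C) = (ranked S).prefixCount A C := by
  have hsm := hB.small
  refine (runs_seq (T₁ := 2) (Val.runs_assign (v := 0) (.const (by omega))
    ((runs_countUp_const (L := n + n) (by omega) (by omega) (6 + (2 + ((40 + 7) * (n + n + 1) + 3)))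
      (fun i s' => Frame {11} s s' ∧ s'.reg 3 = i ∧ ∀ A ≤ i, ∀ C ≤ n + n,
        s'.arr 11 (A * (n + n + 1) + C) = (ranked S).prefixCount A C) ?_ ?_ (i := 0) (by omega)
      ⟨(Frame.refl _ _).setReg le_rfl, by simp, fun A hA C _ => ?_⟩).imp ?_))).of_le ?_
  · rintro i s' ⟨g, h, -⟩
    exact ⟨h, (g.reg 1 (by omega)).trans h1⟩
  · rintro i s' hi ⟨g, g3, g11⟩
    have p1 := (ranked S).px_spec (i + 1) (by omega) hi
    have y1 := (ranked S).y_spec _ p1.1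
    set y := (ranked S).Y ((ranked S).PX (i + 1)) with hy
    have a3 : s'.arr 3 (i + 1) = (ranked S).PX (i + 1) := by
      rw [g.arr 3 (by simp)]; exact h3 _ (by omega) hi
    have a6 : s'.arr 6 ((ranked S).PX (i + 1)) = y := by
      rw [g.arr 6 (by simp)]; exact h6 _ p1.1
    refine runs_seq (Val.runs_assign (v := y) ((((Val.reg g3 (by omega)).add (.const (by omega))
      (by omega)).cell a3 (by omega)).cell a6 (by omega)) (runs_seq (T₁ := 2)
      (Val.runs_assign (v := 0) (.const (by omega))
      ((runs_countUp_const (L := n + n + 1) (by omega) (by omega) 40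
      (fun j s₁ => Frame {11} s s₁ ∧ s₁.reg 3 = i ∧ s₁.reg 4 = j ∧ s₁.reg 5 = y ∧
        (∀ A ≤ i, ∀ C ≤ n + n,
          s₁.arr 11 (A * (n + n + 1) + C) = (ranked S).prefixCount A C) ∧
        ∀ C < j, s₁.arr 11 ((i + 1) * (n + n + 1) + C) = (ranked S).prefixCount (i + 1) C)
      ?_ ?_ (i := 0) (by omega) ⟨(g.setReg (by omega)).setReg (by omega), by simp [g3], by simp,
        by simp, g11, by simp⟩).imp ?_))))
    · rintro j s₁ ⟨f, -, f4, -⟩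
      exact ⟨f4, (f.reg 2 (by omega)).trans h2⟩
    · rintro j s₁ hj ⟨f, f3, f4, f5, f6, f7⟩
      have k2 := (f.reg 2 (by omega)).trans h2
      have hle := (ranked S).prefixCount_le i j
      have hstep := (ranked S).prefixCount_succ hi j
      rw [← hy] at hstep
      have v3 : Val B s₁ (.reg 3) i := .reg f3 (by omega)
      have v4 : Val B s₁ (.reg 4) j := .reg f4 (by omega)
      have v31 := v3.add (.const (k := 1) (by omega)) (by omega)
      have vi := v31.idx hB k2 v4 (by omega) (by omega)
      have vc : Val B s₁ (.cell 11 (idx (.reg 3) (.reg 4))) ((ranked S).prefixCount i j) :=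
        (v3.idx hB k2 v4 (by omega) (by omega)).cell (f6 i le_rfl j (by omega)) (by omega)
      have key : ∀ w, w = (ranked S).prefixCount (i + 1) j →
          (s₁.setArr 11 ((i + 1) * (n + n + 1) + j) w).reg 4 = j ∧
          Frame {11} s ((s₁.setArr 11 ((i + 1) * (n + n + 1) + j) w).setReg 4 (j + 1)) ∧
          ((s₁.setArr 11 ((i + 1) * (n + n + 1) + j) w).setReg 4 (j + 1)).reg 3 = i ∧
          ((s₁.setArr 11 ((i + 1) * (n + n + 1) + j) w).setReg 4 (j + 1)).reg 4 = j + 1 ∧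
          ((s₁.setArr 11 ((i + 1) * (n + n + 1) + j) w).setReg 4 (j + 1)).reg 5 = y ∧
          (∀ A ≤ i, ∀ C ≤ n + n,
            ((s₁.setArr 11 ((i + 1) * (n + n + 1) + j) w).setReg 4 (j + 1)).arr 11
              (A * (n + n + 1) + C) = (ranked S).prefixCount A C) ∧
          ∀ C < j + 1, ((s₁.setArr 11 ((i + 1) * (n + n + 1) + j) w).setReg 4 (j + 1)).arr 11
            ((i + 1) * (n + n + 1) + C) = (ranked S).prefixCount (i + 1) C := by
        rintro w rfl
        refine ⟨f4, (f.setArr rfl).setReg (by omega), by simp [f3], by simp, by simp [f5],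
          fun A hA C hC => ?_, fun C hC => ?_⟩
        -- Rows up to i end before row i + 1 begins, so they are not overwritten.
        · have : A * (n + n + 1) + C < (i + 1) * (n + n + 1) + j := by
            have := Nat.mul_le_mul_right (n + n + 1) (show A + 1 ≤ i + 1 by omega)
            rw [Nat.succ_mul] at this
            omega
          rw [setReg_arr, setArr_arr, if_neg (by omega)]
          exact f6 A hA C hC
        · by_cases hCj : C = j
          · simp [hCj]
          · rw [setReg_arr, setArr_arr, if_neg (by omega)]
            exact f7 C (by omega)
      refine (Tests.runs_cond (T₁ := 15) (T₂ := 17) (Tests.lt v4 (.reg f5 (by omega)))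
        (fun hc => (vi.runs_store vc (key _ ?_)).of_le (by simp [Expr.cost, idx]))
        (fun hc => (vi.runs_store (vc.add (.const (by omega)) (by omega)) (key _ ?_)).of_le
          (by simp [Expr.cost, idx]))).of_le (by simp [Test.cost, Expr.cost])
      · rw [hstep, if_neg (by omega), Nat.add_zero]
      · rw [hstep, if_pos (by omega)]
    · rintro s₁ ⟨f, f3, -, -, f6, f7⟩
      refine ⟨f3, f.setReg le_rfl, by simp, fun A hA C hC => ?_⟩
      rcases Nat.le_succ_iff.mp hA with h | rfl
      · exact f6 A h C hC
      · exact f7 C (by omega)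
  · obtain rfl : A = 0 := by omega
    rw [Ranked.prefixCount_zero]
    exact h11 _
  · rintro s' ⟨g, -, h⟩
    exact ⟨g, h⟩
  · rw [Nat.sub_zero]
    have : 6 + (2 + ((40 + 7) * (n + n + 1) + 3)) + 7 = 47 * (n + n + 1) + 18 := by omega
    rw [this]; omega

/-- Compute the sizes and the tables. -/
def preprocess : Program :=
  .seq (.assign 1 (.add (.reg 0) (.reg 0))) (.seq (.assign 2 (.add (.reg 1) (.const 1)))
    (.seq (rankAll .xlt 0) (.seq (rankAll .ylt 4) (.seq segmentTable countTable))))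

theorem tests_xlt {s : State} {e f : Expr} {i j : ℕ} (he : Val B s e i) (hf : Val B s f j)
    (hi : i < n + n) (hj : j < n + n) :
    Tests (endpoint S) B s (.xlt e f) (xkey S i < xkey S j) := by
  obtain ⟨h1, h2⟩ := he
  obtain ⟨h3, h4⟩ := hf
  refine ⟨⟨h1, h3⟩, ?_⟩
  simp only [Test.Holds, h2, h4, xkey, pos, dif_pos hi, dif_pos hj]
  constructor
  · rintro ⟨a, b, rfl, rfl, h⟩
    exact h
  · exact fun h => ⟨⟨i, hi⟩, ⟨j, hj⟩, rfl, rfl, h⟩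

theorem tests_ylt {s : State} {e f : Expr} {i j : ℕ} (he : Val B s e i) (hf : Val B s f j)
    (hi : i < n + n) (hj : j < n + n) :
    Tests (endpoint S) B s (.ylt e f) (ykey S i < ykey S j) := by
  obtain ⟨h1, h2⟩ := he
  obtain ⟨h3, h4⟩ := hf
  refine ⟨⟨h1, h3⟩, ?_⟩
  simp only [Test.Holds, h2, h4, ykey, pos, dif_pos hi, dif_pos hj]
  constructor
  · rintro ⟨a, b, rfl, rfl, h⟩
    exact h
  · exact fun h => ⟨⟨i, hi⟩, ⟨j, hj⟩, rfl, rfl, h⟩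

/-- A bound for the time of the preprocessing. -/
def preprocessTime (n : ℕ) : ℕ :=
  2 * ((38 * (n + n) + 30) * (n + n)) + (47 * (n + n + 1) + 18) * (n + n) + 57 * (n + n) + 35

theorem runs_preprocess (hB : WordBound n B) :
    Runs (endpoint S) B preprocess (State.init n) (preprocessTime n) fun s' =>
      Ready S s' ∧ (∀ i, s'.arr 13 i = 0) ∧ (∀ i, s'.arr 15 i = 0) ∧ s'.out = [] := by
  have hsm := hB.small
  have r0 : (State.init n).reg 0 = n := by simp [State.init]
  refine (runs_seq (T₁ := 4) (Val.runs_assign (v := n + n)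
    ((Val.reg r0 (by omega)).add (.reg r0 (by omega)) (by omega))
    (runs_seq (T₁ := 4) (Val.runs_assign (v := n + n + 1)
    ((Val.reg (v := n + n) (by simp) (by omega)).add (.const (by omega)) (by omega)) ?_)))).of_le
    (T := 4 + (4 + (((38 * (n + n) + 30) * (n + n) + 5) + (((38 * (n + n) + 30) * (n + n) + 5) +
      ((57 * (n + n) + 10) + ((47 * (n + n + 1) + 18) * (n + n) + 5)))))) ?_
  · set s := ((State.init n).setReg 1 (n + n)).setReg 2 (n + n + 1) with hs
    have k0 : s.reg 0 = n := by simp [hs, r0]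
    have k1 : s.reg 1 = n + n := by simp [hs]
    have k2 : s.reg 2 = n + n + 1 := by simp [hs]
    refine runs_seq ((runs_rankAll (v := xkey S) (N := n + n) (by omega) (fun _ _ => rfl)
      (fun _ _ _ _ _ he hf hi hj => tests_xlt he hf hi hj) 0 k1).imp ?_)
    rintro s₁ ⟨f, x0, x1, x2, x3⟩
    refine runs_seq ((runs_rankAll (v := ykey S) (N := n + n) (by omega) (fun _ _ => rfl)
      (fun _ _ _ _ _ he hf hi hj => tests_ylt he hf hi hj) 4
      ((f.reg 1 (by omega)).trans k1)).imp ?_)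
    rintro s₂ ⟨f', y0, y1, y2, y3⟩
    have q0 : s₂.reg 0 = n := (f'.reg 0 (by omega)).trans ((f.reg 0 (by omega)).trans k0)
    have q1 : s₂.reg 1 = n + n := (f'.reg 1 (by omega)).trans ((f.reg 1 (by omega)).trans k1)
    have q2 : s₂.reg 2 = n + n + 1 := (f'.reg 2 (by omega)).trans ((f.reg 2 (by omega)).trans k2)
    have f'0 := f'.arr 0 (by simp)
    have f'1 := f'.arr 1 (by simp)
    have f'2 := f'.arr 2 (by simp)
    have f'3 := f'.arr 3 (by simp)
    have zero : ∀ a, 8 ≤ a → ∀ i, s₂.arr a i = 0 := by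
      intro a ha i
      rw [f'.arr a (by simp; omega), f.arr a (by simp; omega)]
      rfl
    refine runs_seq ((runs_segmentTable (S := S) hB q0 q1 q2 y2).imp ?_)
    rintro s₃ ⟨g, g8, g9, g10, g12⟩
    refine (runs_countTable (S := S) hB ((g.reg 1 (by omega)).trans q1)
      ((g.reg 2 (by omega)).trans q2) (fun r hr1 hr2 => ?_) (fun e he => ?_) (fun i => ?_)).imp ?_
    · rw [g.arr 3 (by simp), f'3]; exact x3 r hr1 hr2
    · rw [g.arr 6 (by simp)]; exact y2 e he
    · rw [g.arr 11 (by simp)]; exact zero 11 (by omega) i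
    rintro s₄ ⟨h, h11⟩
    have low : ∀ a < 8, s₄.arr a = s₂.arr a := fun a ha => by
      rw [h.arr a (by simp; omega), g.arr a (by simp; omega)]
    have high : ∀ a, 8 ≤ a → a ≠ 11 → s₄.arr a = s₃.arr a := fun a _ ha => h.arr a (by simpa)
    refine ⟨⟨?_, ?_, ?_, ?_, ?_, ?_, ?_, ?_, ?_, ?_, ?_, ?_, ?_, ?_, h11, ?_⟩, ?_, ?_, ?_⟩
    · exact (h.reg 0 (by omega)).trans ((g.reg 0 (by omega)).trans q0)
    · exact (h.reg 1 (by omega)).trans ((g.reg 1 (by omega)).trans q1)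
    · exact (h.reg 2 (by omega)).trans ((g.reg 2 (by omega)).trans q2)
    · rw [low 0 (by omega), f'0]; exact x0
    · rw [low 1 (by omega), f'1]; exact x1
    · rw [low 2 (by omega), f'2]; exact x2
    · rw [low 3 (by omega), f'3]; exact x3
    · rw [low 4 (by omega)]; exact y0
    · rw [low 5 (by omega)]; exact y1
    · rw [low 6 (by omega)]; exact y2
    · rw [low 7 (by omega)]; exact y3
    · rw [high 8 (by omega) (by omega)]; exact g8
    · rw [high 9 (by omega) (by omega)]; exact g9
    · rw [high 10 (by omega) (by omega)]; exact g10
    · rw [high 12 (by omega) (by omega)]; exact g12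
    · rw [high 13 (by omega) (by omega), g.arr 13 (by simp)]; exact zero 13 (by omega)
    · rw [high 15 (by omega) (by omega), g.arr 15 (by simp)]; exact zero 15 (by omega)
    · rw [h.out, g.out, f'.out, f.out]; rfl
  · unfold preprocessTime; omega

end Preprocessing

/-! ### The total time -/

/-- (2n + 2)² = 4(n + 1)² is at most (n + 1)⁴ because n + 1 ≥ 2. -/
theorem wordBound_pow {n : ℕ} (hn : 1 ≤ n) : WordBound n ((n + 1) ^ 4) := by
  have h2 : 2 * 2 ≤ (n + 1) * (n + 1) := Nat.mul_le_mul (by omega) (by omega)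
  have h4 : (n + 1) ^ 4 = (n + 1) * (n + 1) * ((n + 1) * (n + 1)) := by ring
  have hsq : (n + n + 2) * (n + n + 2) ≤ (n + 1) ^ 4 := by
    rw [h4, show (n + n + 2) * (n + n + 2) = 2 * 2 * ((n + 1) * (n + 1)) by ring]
    exact Nat.mul_le_mul_right _ h2
  exact ⟨hn, (Nat.mul_le_mul_right _ (by omega)).trans hsq, hsq⟩

theorem total_time_le {n : ℕ} (hn : 2 ≤ n) :
    preprocessTime n + (roundTime n * (n + n) + 5) ≤ 19000 * (n * n * Nat.log 2 n) := by
  have hl : 1 ≤ Nat.log 2 n := Nat.log_pos one_lt_two hn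
  have hclog : Nat.clog 2 (n + n + 1) ≤ Nat.log 2 n + 2 := by
    refine Nat.clog_le_of_le_pow ?_
    have := Nat.lt_pow_succ_log_self one_lt_two n
    rw [pow_succ] at this ⊢
    omega
  set l := Nat.log 2 n
  -- 133(l + 2) + 300 ≤ 699 l because l ≥ 1; the later constants absorb lower order terms in the
  -- same way, using n ≥ 2.
  have h1 : examineTime n ≤ 699 * l := by unfold examineTime; omega
  have h2 : roundTime n ≤ 8838 * (n * l) := by
    have h3 : (4 * examineTime n + 110) * (n + n + 1) ≤ (2906 * l) * (3 * n) :=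
      Nat.mul_le_mul (by omega) (by omega)
    have h4 : (2906 * l) * (3 * n) = 8718 * (n * l) := by ring
    have h5 : n * 1 ≤ n * l := Nat.mul_le_mul_left n hl
    unfold roundTime; omega
  have h3 : roundTime n * (n + n) ≤ 17676 * (n * n * l) := by
    refine (Nat.mul_le_mul_right (n + n) h2).trans_eq ?_
    ring
  have h4 : n * n * 1 ≤ n * n * l := Nat.mul_le_mul_left _ hl
  have h5 : n * 2 ≤ n * n := Nat.mul_le_mul_left n hn
  have h6 : preprocessTime n + 5 ≤ 1000 * (n * n) := by
    have h7 : preprocessTime n = 492 * (n * n) + 364 * n + 35 := by unfold preprocessTime; ring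
    omega
  omega

/-- 2^(log₂ n) ≤ n, and the natural logarithm of 2 exceeds 1/2. -/
theorem natLog_two_le {n : ℕ} (hn : 2 ≤ n) : (Nat.log 2 n : ℝ) ≤ 2 * Real.log n := by
  have h1 : ((2 : ℕ) : ℝ) ^ Nat.log 2 n ≤ n := by
    exact_mod_cast Nat.pow_log_le_self 2 (by omega)
  have h2 := Real.log_le_log (by positivity) h1
  rw [Real.log_pow] at h2
  have h3 := Real.log_two_gt_d9
  have h4 : (0 : ℝ) ≤ Nat.log 2 n := Nat.cast_nonneg _
  push_cast at h2
  nlinarith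

end Stab

/-! ### The theorem. -/

theorem mainTheorem2 :
    (∃ (prog : Stab.Program) (k : ℕ) (C : ℝ), ∀ n : ℕ, 1 ≤ n →
      ∀ S : Fin n → Stab.Segment, (∀ i, (S i).1 ≠ (S i).2) →
        ∃ (s : Stab.State) (t : ℕ),
          Stab.Exec (Stab.endpoint S) ((n + 1) ^ k) prog (Stab.State.init n) s t ∧
          Stab.ReportsAll S s.out ∧
          (2 ≤ n → (t : ℝ) ≤ C * ((n : ℝ) ^ 2 * Real.log n))) ∧
    (∃ C : ℝ, ∀ n : ℕ, 1 ≤ n →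
      ∀ S : Fin n → Stab.Segment, (∀ i, (S i).1 ≠ (S i).2) →
        (Stab.stabberClasses S).Finite ∧
        ((Stab.stabberClasses S).ncard : ℝ) ≤ C * (n : ℝ) ^ 2) ∧
    (∃ c : ℝ, 0 < c ∧ ∀ n : ℕ, 1 ≤ n →
      ∃ S : Fin n → Stab.Segment,
        (∀ i, (S i).1.1 ≠ (S i).2.1 ∧ (S i).1.2 ≠ (S i).2.2) ∧
        (Function.Injective fun i => s((S i).1, (S i).2)) ∧
        (Stab.stabberClasses S).Finite ∧
        c * (n : ℝ) ^ 2 ≤ ((Stab.stabberClasses S).ncard : ℝ)) := by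
  -- The exponent 4 is from `wordBound_pow`; 38000 is twice the constant of `total_time_le`, the
  -- factor 2 being that of `natLog_two_le`.
  refine ⟨⟨.seq Stab.preprocess Stab.mainLoop, 4, 38000, fun n hn S _ => ?_⟩,
    ⟨12, fun n hn S _ => ?_⟩, 1 / 4, by norm_num, fun n hn => ⟨fun i => Stab.crossSegment n i, ?_⟩⟩
  · have hB := Stab.wordBound_pow hn
    obtain ⟨s, t, h1, h2, h3⟩ := Stab.runs_seq ((Stab.runs_preprocess (S := S) hB).imp
      fun s ⟨i1, i2, i3, i4⟩ => Stab.runs_mainLoop (P := Stab.endpoint S) hB i1 i2 i3 i4)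
    refine ⟨s, t, h1, h3, fun h => ?_⟩
    have h4 : (t : ℝ) ≤ 19000 * ((n : ℝ) * n * Nat.log 2 n) := by
      exact_mod_cast h2.trans (Stab.total_time_le h)
    have h5 := mul_le_mul_of_nonneg_left (Stab.natLog_two_le h)
      (mul_self_nonneg (n : ℝ))
    nlinarith
  · obtain ⟨h1, h2⟩ := Stab.stabberClasses_bound hn S
    exact ⟨h1, by exact_mod_cast h2⟩
  · refine ⟨fun i => ?_, Stab.crossSegment_injective n, (Stab.stabberClasses_bound hn _).1, ?_⟩
    · have := Stab.crossSegment_ne n i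
      exact ⟨this.1.ne, this.2.ne⟩
    · have := Stab.crossSegment_ncard n hn
      linarith
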